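/- An instance of the Steiner Forest Orientation problem consists of a finite undirected graph $G=(V,E)$ (parallel edges and loops are allowed), nonnegative rational edge costs $c:E\to\mathbb{Q}_{\ge 0}$, and a set $P\subseteq V\times V$ of ordered pairs of nodes. A feasible solution is a subgraph $H$ of $G$ (a subset of the edges, on the node set $V$) together with an orientation $D$ of $H$, that is, a choice of one of the two directions for every edge of $H$, such that for every $(u,v)\in P$ the directed graph $D$ contains a directed path from $u$ to $v$ (the trivial path if $u=v$). The cost of the solution is $c(H)=\sum_{e\in H}c(e)$. Theorem 1. Steiner Forest Orientation admits a polynomial-time $4$-approximation algorithm. That is, there is a deterministic algorithm that, on every instance $(G,c,P)$, with numbers written in binary, runs in time polynomial in the size of the input; if the instance has a feasible solution, it outputs a feasible solution $(H,D)$ with $c(H)\le 4\,c(H')$ for every feasible solution $(H',D')$ (so $c(H)\le 4\,\mathsf{opt}$), and otherwise it reports that there is none. -/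

import Mathlib

/-!
# A machine model with a step count

Structured while-programs on binary trees (the data type of pure Lisp).  The store of a program is
one binary tree.  Every construct that is executed is charged `1` plus the size of the tree to which
it is applied, so a program that runs for time `t` produces no tree of size more than `t`.  Up to a
polynomial this is the time of a deterministic Turing machine: one charged operation can be done by a
Turing machine in time polynomial in its charge, and one step of a Turing machine is a bounded number
of operations on a tree that holds the state and the two halves of the tape as lists.
-/

namespace TreeMachine

/-- Binary trees: the data of the programs. -/
inductive Val : Type
  | nil : Val
  | cons : Val → Val → Val

/-- The number of vertices of a tree. -/
def Val.size : Val → ℕ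
  | .nil => 1
  | .cons a b => 1 + a.size + b.size

/-- The left subtree, by convention `nil` for `nil`. -/
def Val.head : Val → Val
  | .nil => .nil
  | .cons a _ => a

/-- The right subtree, by convention `nil` for `nil`. -/
def Val.tail : Val → Val
  | .nil => .nil
  | .cons _ b => b

/-- Programs; each one transforms a tree `x` (its input) into a tree (its output).
* `skip` returns `x`; `nil` returns the empty tree; `head`, `tail` return the subtrees of `x`;
* `pair p q` runs `p` and `q` on `x` and joins the two outputs to one tree;
* `seq p q` runs `p` on `x` and then `q` on the output of `p`;
* `cond c p q` runs `c` on `x`; then it runs `p` on `x` if the output of `c` is not `nil`, and `q` on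
  `x` if it is `nil`;
* `loop c p` is `while c(x) ≠ nil do x := p(x)`. -/
inductive Prog : Type
  | skip : Prog
  | nil : Prog
  | head : Prog
  | tail : Prog
  | pair : Prog → Prog → Prog
  | seq : Prog → Prog → Prog
  | cond : Prog → Prog → Prog → Prog
  | loop : Prog → Prog → Prog

/-- `Run p x y t`: on input `x` the program `p` halts with output `y` after running for time `t`. -/
inductive Run : Prog → Val → Val → ℕ → Prop
  | skip (x : Val) : Run .skip x x (1 + x.size)
  | nil (x : Val) : Run .nil x .nil (1 + x.size)
  | head (x : Val) : Run .head x x.head (1 + x.size)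
  | tail (x : Val) : Run .tail x x.tail (1 + x.size)
  | pair {p q : Prog} {x y z : Val} {s t : ℕ} :
      Run p x y s → Run q x z t → Run (.pair p q) x (.cons y z) (1 + x.size + s + t)
  | seq {p q : Prog} {x y z : Val} {s t : ℕ} :
      Run p x y s → Run q y z t → Run (.seq p q) x z (1 + x.size + s + t)
  | cond_true {c p q : Prog} {x b y : Val} {s t : ℕ} :
      Run c x b s → b ≠ .nil → Run p x y t → Run (.cond c p q) x y (1 + x.size + s + t)
  | cond_false {c p q : Prog} {x y : Val} {s t : ℕ} :
      Run c x .nil s → Run q x y t → Run (.cond c p q) x y (1 + x.size + s + t)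
  | loop_done {c p : Prog} {x : Val} {s : ℕ} :
      Run c x .nil s → Run (.loop c p) x x (1 + x.size + s)
  | loop_step {c p : Prog} {x b y z : Val} {s t r : ℕ} :
      Run c x b s → b ≠ .nil → Run p x y t → Run (.loop c p) y z r →
        Run (.loop c p) x z (1 + x.size + s + t + r)

/-- The model is deterministic: output and running time are determined by program and input. -/
theorem Run.det {p : Prog} {x y y' : Val} {t t' : ℕ} (h : Run p x y t) (h' : Run p x y' t') :
    y = y' ∧ t = t' := by
  induction h generalizing y' t' with
  | skip x => cases h'; exact ⟨rfl, rfl⟩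
  | nil x => cases h'; exact ⟨rfl, rfl⟩
  | head x => cases h'; exact ⟨rfl, rfl⟩
  | tail x => cases h'; exact ⟨rfl, rfl⟩
  | pair _ _ ih₁ ih₂ =>
    cases h' with
    | pair a b =>
      obtain ⟨rfl, rfl⟩ := ih₁ a
      obtain ⟨rfl, rfl⟩ := ih₂ b
      exact ⟨rfl, rfl⟩
  | seq _ _ ih₁ ih₂ =>
    cases h' with
    | seq a b =>
      obtain ⟨rfl, rfl⟩ := ih₁ a
      obtain ⟨rfl, rfl⟩ := ih₂ b
      exact ⟨rfl, rfl⟩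
  | cond_true _ hb _ ih₁ ih₂ =>
    cases h' with
    | cond_true a _ b =>
      obtain ⟨rfl, rfl⟩ := ih₁ a
      obtain ⟨rfl, rfl⟩ := ih₂ b
      exact ⟨rfl, rfl⟩
    | cond_false a b => exact absurd (ih₁ a).1 hb
  | cond_false _ _ ih₁ ih₂ =>
    cases h' with
    | cond_true a hb b => exact absurd (ih₁ a).1.symm hb
    | cond_false a b =>
      obtain ⟨-, rfl⟩ := ih₁ a
      obtain ⟨rfl, rfl⟩ := ih₂ b
      exact ⟨rfl, rfl⟩
  | loop_done _ ih₁ =>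
    cases h' with
    | loop_done a =>
      obtain ⟨-, rfl⟩ := ih₁ a
      exact ⟨rfl, rfl⟩
    | loop_step a hb b c => exact absurd (ih₁ a).1.symm hb
  | loop_step _ hb _ _ ih₁ ih₂ ih₃ =>
    cases h' with
    | loop_done a => exact absurd (ih₁ a).1 hb
    | loop_step a _ b c =>
      obtain ⟨rfl, rfl⟩ := ih₁ a
      obtain ⟨rfl, rfl⟩ := ih₂ b
      obtain ⟨rfl, rfl⟩ := ih₃ c
      exact ⟨rfl, rfl⟩

/-- `f` is computable in polynomial time, where `enc` encodes the inputs and `out` the outputs: some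
program computes `f`, in time at most a polynomial in the size of the encoded input. -/
def PolyTime {α : Type} {β : α → Type} (enc : α → Val) (out : (a : α) → β a → Val)
    (f : (a : α) → β a) : Prop :=
  ∃ (p : Prog) (q : Polynomial ℕ), ∀ a : α, ∃ t : ℕ,
    Run p (enc a) (out a (f a)) t ∧ t ≤ q.eval (enc a).size

/-! ### Encodings -/

/-- A list of trees as one tree. -/
def Val.ofList : List Val → Val
  | [] => .nil
  | a :: l => .cons a (Val.ofList l)

/-- A bit. -/
def Val.ofBool : Bool → Val
  | false => .nil
  | true => .cons .nil .nil

/-- A natural number, as the list of its binary digits, the least significant one first. -/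
def Val.ofNat (k : ℕ) : Val := Val.ofList (k.bits.map Val.ofBool)

/-- A nonnegative rational number, as numerator and denominator in lowest terms. -/
def Val.ofNNRat (c : ℚ≥0) : Val := .cons (Val.ofNat c.num) (Val.ofNat c.den)

end TreeMachine

/-! # Steiner Forest Orientation -/

namespace SFO

open TreeMachine

/-- An instance of the problem: an undirected graph (loops and parallel edges are allowed) with node
set `Fin n` and edge set `Fin m`, nonnegative edge costs, and a list of ordered pairs of nodes.  The
two ends of an edge are presented in some order, which has no meaning. -/
structure Input : Type where
  n : ℕ
  m : ℕ
  ends : Fin m → Fin n × Fin n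
  cost : Fin m → ℚ≥0
  pairs : List (Fin n × Fin n)

/-- The edge `e` as an unordered pair of nodes. -/
def Input.edge (I : Input) (e : Fin I.m) : Sym2 (Fin I.n) :=
  s((I.ends e).1, (I.ends e).2)

/-- A subgraph `H` of the graph, given by its set of edges, with an orientation `D` of `H`: each edge
of `H` is assigned one of its two directions, `dir e = (tail, head)`. -/
structure OrientedSubgraph (I : Input) : Type where
  H : Finset (Fin I.m)
  dir : {e : Fin I.m // e ∈ H} → Fin I.n × Fin I.n
  dir_spec : ∀ e : {e : Fin I.m // e ∈ H}, s((dir e).1, (dir e).2) = I.edge e.1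

namespace OrientedSubgraph

variable {I : Input}

/-- The directed graph `D`. -/
def digraph (S : OrientedSubgraph I) : Digraph (Fin I.n) where
  Adj u v := ∃ e, S.dir e = (u, v)

/-- `D` has a directed `uv`-path for every given pair `(u, v)`. -/
def Satisfies (S : OrientedSubgraph I) : Prop :=
  ∀ p ∈ I.pairs, Relation.ReflTransGen S.digraph.Adj p.1 p.2

/-- The cost of `H`. -/
def cost (S : OrientedSubgraph I) : ℚ≥0 := ∑ e ∈ S.H, I.cost e

end OrientedSubgraph

/-- The instance as a tree: the list of nodes, the list of edges (each with its ends and its cost),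
and the list of pairs. -/
def Input.encode (I : Input) : Val :=
  .cons (.ofList ((List.finRange I.n).map fun v => .ofNat v))
    (.cons
      (.ofList ((List.finRange I.m).map fun e =>
        .cons (.cons (.ofNat (I.ends e).1) (.ofNat (I.ends e).2)) (.ofNNRat (I.cost e))))
      (.ofList (I.pairs.map fun p => .cons (.ofNat p.1) (.ofNat p.2))))

/-- An answer as a tree.  The answer "there is no solution" is `nil`.  An oriented subgraph is tagged
and written as a list with one entry for each edge of the input graph, in order: `nil` if the edge
does not belong to `H`, and otherwise its tail and its head. -/
def encodeAnswer (I : Input) : Option (OrientedSubgraph I) → Val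
  | none => .nil
  | some S => .cons .nil (.ofList ((List.finRange I.m).map fun e =>
      if h : e ∈ S.H then .cons (.ofNat (S.dir ⟨e, h⟩).1) (.ofNat (S.dir ⟨e, h⟩).2) else .nil))

/-- The answer is within the factor `ρ` of the optimum: it is an oriented subgraph that satisfies the
pairs and whose cost is at most `ρ` times the cost of every one that does; the answer "there is no
solution" is allowed only if there is none. -/
def IsApproxAnswer (ρ : ℚ≥0) (I : Input) : Option (OrientedSubgraph I) → Prop
  | none => ¬ ∃ S : OrientedSubgraph I, S.Satisfies
  | some S => S.Satisfies ∧ ∀ S' : OrientedSubgraph I, S'.Satisfies → S.cost ≤ ρ * S'.cost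

end SFO

/-! Without directions, every solution is a Steiner forest for the pairs, so a primal-dual
2-approximation yields a forest `H` of cost at most `2 opt`. What obstructs an orientation is an
edge `e` of `H` that one pair needs in one direction and another pair in the other (`Conflict`). In
any solution `K` the ends of such an edge are joined by `(H - e) ∪ (K \ H)`: otherwise one pair
forces `e` to be directed one way and the other pair the opposite way (`meets_conflicts_of_reach`).
Hence a second primal-dual run, on the edges outside `H`, joins the ends of all conflict edges at a
further cost of at most `2 opt`; together this is the factor 4 (`phases_spec`).

In both phases the edges bought have to cross all sets of an uncrossable family
(`uncrossable_demands`, `uncrossable_conflicts`). The minimal violated sets are then disjoint; their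
duals grow uniformly, edges are bought as they become tight, and superfluous edges are deleted in
reverse order. The combinatorial core is `sum_card_cut_le`: the minimal violated sets have on
average at most two edges of a minimal cover. `prune_minimal` supplies the minimality, and
`wsum_le_of_minimal` turns the average into a cost bound by splitting the cost function step by
step.

In the union of `H` and the second edge set no bridge is needed in both directions. As in Robbins'
theorem, the edges can be directed one after the other so that all pairs, and both directions of
every non-bridge, stay reachable while the remaining edges count as undirected; `exists_direction`
shows that one of the two directions always works, and `orient_phases` applies this to the two
phases.

For the running time, `PTime` is a calculus of polynomial-time functions closed under composition,
pairing, case distinction and folds whose intermediate states stay small. The algorithm is written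
with these means only, on lists of natural numbers, so that `pTime_solve` is mostly assembled by
`fun_prop`. Clearing denominators once and doubling the costs in each step keeps the arithmetic
integral. -/

namespace TreeMachine

/-! ### Polynomial-time functions between encoded types -/

theorem Val.size_pos (x : Val) : 0 < x.size := by
  cases x <;> simp only [Val.size] <;> omega

theorem Val.size_head_le (x : Val) : x.head.size ≤ x.size := by
  cases x <;> simp [Val.size, Val.head]; omega

theorem Val.size_tail_le (x : Val) : x.tail.size ≤ x.size := by
  cases x <;> simp [Val.size, Val.tail]

theorem Run.size_le {p : Prog} {x y : Val} {t : ℕ} (h : Run p x y t) : y.size ≤ t := by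
  induction h with
  | skip x => omega
  | nil x => simp [Val.size]
  | head x => have := x.size_head_le; omega
  | tail x => have := x.size_tail_le; omega
  | pair _ _ _ _ => simp only [Val.size]; omega
  | _ => omega

/-- A type whose elements are represented by trees. -/
class Enc (α : Type) where
  enc : α → Val


open Enc

/-- The size of the representing tree. -/
def len {α : Type} [Enc α] (a : α) : ℕ := (enc a).size

/-- Functions between encoded types that some program computes in polynomial time. -/
@[fun_prop]
def PTime {α β : Type} [Enc α] [Enc β] (f : α → β) : Prop :=
  ∃ (p : Prog) (q : Polynomial ℕ), ∀ a : α, ∃ t : ℕ,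
    Run p (enc a) (enc (f a)) t ∧ t ≤ q.eval (len a)

/-- Quantities bounded by a polynomial in the size of the argument. -/
def PolyBdd {α : Type} [Enc α] (b : α → ℕ) : Prop :=
  ∃ q : Polynomial ℕ, ∀ a, b a ≤ q.eval (len a)

/-- The coefficients are natural numbers, so no monomial decreases. This is what allows one size
bound to be substituted into another. -/
theorem eval_mono (q : Polynomial ℕ) : Monotone fun n => q.eval n := by
  intro m n h
  simp only [Polynomial.eval_eq_sum, Polynomial.sum]
  gcongr

section

variable {α β γ δ : Type} [Enc α] [Enc β] [Enc γ] [Enc δ]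

theorem PolyBdd.mono {b c : α → ℕ} (hc : PolyBdd c) (h : ∀ a, b a ≤ c a) : PolyBdd b :=
  let ⟨q, hq⟩ := hc
  ⟨q, fun a => (h a).trans (hq a)⟩

theorem PolyBdd.const (c : ℕ) : PolyBdd fun _ : α => c := ⟨.C c, by simp⟩

theorem PolyBdd.len_self : PolyBdd fun a : α => len a := ⟨.X, by simp⟩

theorem PolyBdd.add {b c : α → ℕ} (hb : PolyBdd b) (hc : PolyBdd c) :
    PolyBdd fun a => b a + c a :=
  let ⟨p, hp⟩ := hb
  let ⟨q, hq⟩ := hc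
  ⟨p + q, fun a => by simpa using add_le_add (hp a) (hq a)⟩

theorem PolyBdd.mul {b c : α → ℕ} (hb : PolyBdd b) (hc : PolyBdd c) :
    PolyBdd fun a => b a * c a :=
  let ⟨p, hp⟩ := hb
  let ⟨q, hq⟩ := hc
  ⟨p * q, fun a => by simpa using Nat.mul_le_mul (hp a) (hq a)⟩

theorem PolyBdd.comp {b : β → ℕ} {f : α → β} (hb : PolyBdd b) (hf : PolyBdd fun a => len (f a)) :
    PolyBdd fun a => b (f a) :=
  let ⟨p, hp⟩ := hb
  let ⟨q, hq⟩ := hf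
  ⟨p.comp q, fun a => by
    rw [Polynomial.eval_comp]
    exact (hp _).trans (eval_mono p (hq a))⟩

/-- Every construct is charged for the tree it handles, so by `Run.size_le` a time bound is also a
bound on the output. -/
theorem PTime.polyBdd {f : α → β} (hf : PTime f) : PolyBdd fun a => len (f a) :=
  let ⟨_, q, h⟩ := hf
  ⟨q, fun a => let ⟨_, hr, ht⟩ := h a; hr.size_le.trans ht⟩

/-- A program for `f` with a polynomially bounded running time, not given as a polynomial. -/
theorem PTime.of_polyBdd {f : α → β} (p : Prog) {b : α → ℕ} (hb : PolyBdd b)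
    (h : ∀ a, ∃ t, Run p (enc a) (enc (f a)) t ∧ t ≤ b a) : PTime f :=
  let ⟨q, hq⟩ := hb
  ⟨p, q, fun a => let ⟨t, hr, ht⟩ := h a; ⟨t, hr, ht.trans (hq a)⟩⟩

theorem PTime.exists_run {f : α → β} (hf : PTime f) :
    ∃ (p : Prog) (b : α → ℕ), PolyBdd b ∧ ∀ a, ∃ t, Run p (enc a) (enc (f a)) t ∧ t ≤ b a :=
  let ⟨p, q, h⟩ := hf
  ⟨p, fun a => q.eval (len a), ⟨q, fun _ => le_rfl⟩, h⟩

@[fun_prop]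
theorem PTime.id : PTime fun a : α => a :=
  .of_polyBdd .skip ((PolyBdd.const 1).add .len_self) fun _ => ⟨_, .skip _, le_rfl⟩

@[fun_prop]
theorem PTime.comp {g : β → γ} {f : α → β} (hg : PTime g) (hf : PTime f) :
    PTime fun a => g (f a) := by
  obtain ⟨p, b, hb, hp⟩ := hf.exists_run
  obtain ⟨p', b', hb', hp'⟩ := hg.exists_run
  refine .of_polyBdd (.seq p p')
    ((((PolyBdd.const 1).add .len_self).add hb).add (hb'.comp hf.polyBdd)) fun a => ?_
  obtain ⟨s, hs, hs'⟩ := hp a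
  obtain ⟨t, ht, ht'⟩ := hp' (f a)
  exact ⟨_, .seq hs ht, by unfold len; omega⟩

/-- The tree is built from `nil` by nested `pair`s, all run on the same input; the factor `c`
depends on `v` alone. -/
theorem exists_run_const (v : Val) : ∃ (p : Prog) (c : ℕ), ∀ x : Val, ∃ t,
    Run p x v t ∧ t ≤ c * (1 + x.size) := by
  induction v with
  | nil => exact ⟨.nil, 1, fun x => ⟨_, .nil x, by omega⟩⟩
  | cons a b iha ihb =>
    obtain ⟨p, c, hp⟩ := iha
    obtain ⟨q, d, hq⟩ := ihb
    refine ⟨.pair p q, 1 + c + d, fun x => ?_⟩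
    obtain ⟨s, hs, hs'⟩ := hp x
    obtain ⟨t, ht, ht'⟩ := hq x
    exact ⟨_, .pair hs ht, by linarith⟩

@[fun_prop]
theorem PTime.const (b : β) : PTime fun _ : α => b := by
  obtain ⟨p, c, hp⟩ := exists_run_const (enc b)
  exact .of_polyBdd p ((PolyBdd.const c).mul ((PolyBdd.const 1).add .len_self)) fun a => hp _

instance : Enc Val := ⟨fun v => v⟩
instance : Enc (α × β) := ⟨fun p => .cons (enc p.1) (enc p.2)⟩
instance : Enc Bool := ⟨Val.ofBool⟩
instance : Enc (List α) := ⟨fun l => .ofList (l.map enc)⟩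
instance : Enc ℕ := ⟨Val.ofNat⟩

theorem len_pair (a : α) (b : β) : len (a, b) = 1 + len a + len b := rfl
@[simp] theorem len_nil : len ([] : List α) = 1 := rfl
@[simp] theorem len_cons (a : α) (l : List α) : len (a :: l) = 1 + len a + len l := rfl
theorem len_bool_le (b : Bool) : len b ≤ 3 := by cases b <;> decide
theorem len_pos (a : α) : 0 < len a := Val.size_pos _

@[fun_prop]
theorem PTime.fst : PTime fun p : α × β => p.1 :=
  .of_polyBdd .head ((PolyBdd.const 1).add .len_self) fun _ => ⟨_, .head _, le_rfl⟩

@[fun_prop]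
theorem PTime.snd : PTime fun p : α × β => p.2 :=
  .of_polyBdd .tail ((PolyBdd.const 1).add .len_self) fun _ => ⟨_, .tail _, le_rfl⟩

@[fun_prop]
theorem PTime.prodMk {f : α → β} {g : α → γ} (hf : PTime f) (hg : PTime g) :
    PTime fun a => (f a, g a) := by
  obtain ⟨p, b, hb, hp⟩ := hf.exists_run
  obtain ⟨p', b', hb', hp'⟩ := hg.exists_run
  refine .of_polyBdd (.pair p p')
    ((((PolyBdd.const 1).add .len_self).add hb).add hb') fun a => ?_
  obtain ⟨s, hs, hs'⟩ := hp a
  obtain ⟨t, ht, ht'⟩ := hp' a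
  exact ⟨_, .pair hs ht, by unfold len; omega⟩

/-- Functions given by the same trees are computed by the same programs. -/
theorem PTime.congr_enc {α' β' : Type} [Enc α'] [Enc β'] {f : α → β} {g : α' → β'} (hf : PTime f)
    (i : α' → α) (hi : ∀ a, enc (i a) = enc a) (h : ∀ a, enc (f (i a)) = enc (g a)) :
    PTime g := by
  obtain ⟨p, q, hp⟩ := hf
  refine ⟨p, q, fun a => ?_⟩
  obtain ⟨t, h1, h2⟩ := hp (i a)
  exact ⟨t, by rwa [hi, h] at h1, by simpa [len, hi] using h2⟩

@[fun_prop]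
theorem PTime.encode : PTime fun a : α => enc a :=
  (PTime.id (α := α)).congr_enc (fun a => a) (fun _ => rfl) fun _ => rfl

@[fun_prop]
theorem PTime.cons {f : α → β} {l : α → List β} (hf : PTime f) (hl : PTime l) :
    PTime fun a => f a :: l a :=
  (hf.prodMk hl).congr_enc (fun a => a) (fun _ => rfl) fun _ => rfl

@[fun_prop]
theorem PTime.cond {c : α → Bool} {f g : α → β} (hc : PTime c) (hf : PTime f) (hg : PTime g) :
    PTime fun a => cond (c a) (f a) (g a) := by
  obtain ⟨p, b, hb, hp⟩ := hc.exists_run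
  obtain ⟨p', b', hb', hp'⟩ := hf.exists_run
  obtain ⟨p'', b'', hb'', hp''⟩ := hg.exists_run
  refine .of_polyBdd (.cond p p' p'')
    (((((PolyBdd.const 1).add .len_self).add hb).add hb').add hb'') fun a => ?_
  obtain ⟨r, hr, hr'⟩ := hp a
  obtain ⟨s, hs, hs'⟩ := hp' a
  obtain ⟨t, ht, ht'⟩ := hp'' a
  cases h : c a with
  | true => exact ⟨_, .cond_true hr (by rw [h]; exact fun e => by cases e) hs, by unfold len; omega⟩
  | false => exact ⟨_, .cond_false (by rw [h] at hr; exact hr) ht, by unfold len; omega⟩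

/-- Case distinction on a list. -/
def elimList {ι β : Type} (l : List ι) (b : β) (f : ι → List ι → β) : β :=
  match l with
  | [] => b
  | i :: l => f i l

@[fun_prop]
theorem PTime.elimList {l : α → List β} {f : α → γ} {g : α → β → List β → γ} (hl : PTime l)
    (hf : PTime f) (hg : PTime fun x : α × β × List β => g x.1 x.2.1 x.2.2) :
    PTime fun a => elimList (l a) (f a) (g a) := by
  obtain ⟨p, b, hb, hp⟩ := hl.exists_run
  obtain ⟨p', b', hb', hp'⟩ := hf.exists_run
  obtain ⟨p'', b'', ⟨q, hq⟩, hp''⟩ := hg.exists_run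
  have key : PolyBdd fun a : α => q.eval (1 + len a + len (l a)) :=
    (PolyBdd.comp (f := fun a => (a, l a)) ⟨q, fun _ => le_rfl⟩
      (((PolyBdd.const 1).add .len_self).add hl.polyBdd)).mono fun a => le_rfl
  -- A nonempty list and the pair of its head and tail are the same tree, so joining the input with
  -- `l a` already gives the argument of the program for `g`.
  refine .of_polyBdd (.cond p (.seq (.pair .skip p) p'') p')
    ((((((((PolyBdd.const 4).add .len_self).add .len_self).add .len_self).add .len_self).add
      hb).add hb).add (hb'.add key)) fun a => ?_
  obtain ⟨r, hr, hr'⟩ := hp a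
  cases h : l a with
  | nil =>
    obtain ⟨s, hs, hs'⟩ := hp' a
    exact ⟨_, .cond_false (by rw [h] at hr; exact hr) hs, by unfold len; omega⟩
  | cons i m =>
    obtain ⟨s, hs, hs'⟩ := hp'' (a, i, m)
    have hs2 := hs'.trans (hq _)
    have e : len (a, i, m) = 1 + len a + len (i :: m) := rfl
    rw [e] at hs2
    rw [h] at hr
    refine ⟨_, .cond_true hr (fun e => by cases e) (.seq (.pair (.skip _) hr) hs), ?_⟩
    unfold len at *; omega

/-! ### Bounded iteration along a list -/

theorem foldl_run {ι σ : Type} [Enc ι] [Enc σ] {step : α → σ → ι → σ}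
    (hs : PTime fun x : α × σ × ι => step x.1 x.2.1 x.2.2) :
    ∃ (p : Prog) (q : Polynomial ℕ), ∀ (a : α) (N : ℕ) (l : List ι) (s : σ),
      (∀ l', l' <+: l → len a + len (l'.foldl (step a) s) + len l + 2 ≤ N) →
      ∃ t, Run p (.cons (enc a) (.cons (enc s) (enc l)))
        (.cons (enc a) (.cons (enc (l.foldl (step a) s)) .nil)) t ∧
        t ≤ (l.length + 1) * q.eval N := by
  have hb : PTime fun x : α × σ × ι × List ι => (x.1, step x.1 x.2.1 x.2.2.1, x.2.2.2) := by
    have := hs.comp (f := fun x : α × σ × ι × List ι => (x.1, x.2.1, x.2.2.1)) (by fun_prop)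
    fun_prop
  have hc : PTime fun x : α × σ × List ι => x.2.2 := by fun_prop
  obtain ⟨c, qc, hc⟩ := hc
  obtain ⟨b, qb, hb⟩ := hb
  -- The loop carries the parameter, the state and the rest of the list. `N` bounds every tree that
  -- it meets, so each test and each round costs at most the value of this polynomial at `N`.
  refine ⟨.loop c b, 1 + .X + qc + qb, fun a N l => ?_⟩
  induction l with
  | nil =>
    intro s hN
    have h0 := hN [] (List.prefix_refl _)
    obtain ⟨t, ht, ht'⟩ := hc (a, s, [])
    refine ⟨_, .loop_done ht, ?_⟩
    have e : len (a, s, ([] : List ι)) ≤ N := by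
      simp only [len_pair, len_nil, List.foldl_nil] at h0 ⊢; omega
    have h1 := eval_mono qc e
    have h2 : (Val.cons (enc a) (.cons (enc s) (enc ([] : List ι)))).size ≤ N := e
    simp only [List.length_nil, Polynomial.eval_add, Polynomial.eval_one, Polynomial.eval_X]
    simp only at h1
    change 1 + (Val.cons (enc a) (.cons (enc s) (enc ([] : List ι)))).size + t ≤ _
    omega
  | cons i l ih =>
    intro s hN
    have h0 := hN [] (List.nil_prefix)
    obtain ⟨t, ht, ht'⟩ := hc (a, s, i :: l)
    obtain ⟨r, hr, hr'⟩ := hb (a, s, i, l)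
    obtain ⟨u, hu, hu'⟩ := ih (step a s i) (fun l' hl' => by
      have := hN (i :: l') (by simpa using hl')
      simp only [List.foldl_cons, len_cons] at this
      omega)
    refine ⟨_, .loop_step ht (fun e => by cases e) hr hu, ?_⟩
    have e : len (a, s, i :: l) ≤ N := by
      simp only [len_pair, List.foldl_nil] at h0 ⊢; omega
    have h1 := eval_mono qc e
    have h3 := eval_mono qb (show len (a, s, i, l) ≤ N from e)
    have h2 : (Val.cons (enc a) (.cons (enc s) (enc (i :: l)))).size ≤ N := e
    simp only [List.length_cons, Polynomial.eval_add, Polynomial.eval_one, Polynomial.eval_X] at hu' ⊢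
    simp only at h1 h3
    change 1 + (Val.cons (enc a) (.cons (enc s) (enc (i :: l)))).size + t + r + u ≤ _
    rw [add_mul _ 1]
    omega

theorem length_le_len {ι : Type} [Enc ι] (l : List ι) : l.length + 1 ≤ len l := by
  induction l with
  | nil => simp
  | cons i l ih => simp; omega

/-- All iteration reduces to this form. A polynomial-time step is not enough, since repeated steps
may let the state grow exponentially; hence the separate bound `b` on the states after all prefixes
of the list. -/
theorem PTime.foldl {ι σ : Type} [Enc ι] [Enc σ] {l : α → List ι} {init : α → σ}
    {step : α → σ → ι → σ} (hl : PTime l) (hi : PTime init)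
    (hs : PTime fun x : α × σ × ι => step x.1 x.2.1 x.2.2) {b : α → ℕ} (hb : PolyBdd b)
    (h : ∀ a l', l' <+: l a → len (l'.foldl (step a) (init a)) ≤ b a) :
    PTime fun a => (l a).foldl (step a) (init a) := by
  obtain ⟨p, q, hp⟩ := foldl_run hs
  have h1 : PTime fun a => (a, init a, l a) := by fun_prop
  obtain ⟨p₁, b₁, hb₁, hp₁⟩ := h1.exists_run
  have hN : PolyBdd fun a => len a + b a + len (l a) + 2 :=
    ((PolyBdd.len_self.add hb).add hl.polyBdd).add (.const 2)
  obtain ⟨N, hN⟩ := hN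
  have hq : PolyBdd fun a => (len (l a)) * q.eval (N.eval (len a)) :=
    hl.polyBdd.mul ⟨q.comp N, fun a => by rw [Polynomial.eval_comp]⟩
  have hNN : PolyBdd fun a : α => N.eval (len a) := ⟨N, fun _ => le_rfl⟩
  refine .of_polyBdd (.seq p₁ (.seq p (.seq .tail .head)))
    ((((((PolyBdd.const 5).add .len_self).add hb₁).add hb₁).add hq).add
      (((hNN.add hNN).add hNN).add hNN)) fun a => ?_
  obtain ⟨s, hs, hs'⟩ := hp₁ a
  obtain ⟨t, ht, ht'⟩ := hp a (N.eval (len a)) (l a) (init a) fun l' hl' => by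
    have := h a l' hl'
    have := hN a
    simp only at this
    omega
  refine ⟨_, .seq hs (.seq ht (.seq (.tail _) (.head _))), ?_⟩
  have h2 := hs.size_le
  have h3 : (l a).length + 1 ≤ len (l a) := length_le_len _
  have h4 := Nat.mul_le_mul_right (q.eval (N.eval (len a))) h3
  have h5 := h a _ (List.prefix_refl _)
  have h6 := hN a
  simp only at h6
  have h7 := len_pos (l a)
  simp only [Val.tail, Val.size]
  have e2 : len (List.foldl (step a) (init a) (l a)) =
    (enc (List.foldl (step a) (init a) (l a))).size := rfl
  have e3 : len a = (enc a).size := rfl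
  omega

end

end TreeMachine

namespace TreeMachine

open Enc

variable {α β γ δ : Type} [Enc α] [Enc β] [Enc γ] [Enc δ]

/-! ### Booleans -/

@[fun_prop]
theorem PTime.not {f : α → Bool} (hf : PTime f) : PTime fun a => !f a := by
  have : (fun a => !f a) = fun a => bif f a then false else true := by
    funext a; cases f a <;> rfl
  rw [this]; fun_prop

@[fun_prop]
theorem PTime.and {f g : α → Bool} (hf : PTime f) (hg : PTime g) : PTime fun a => f a && g a := by
  have : (fun a => f a && g a) = fun a => bif f a then g a else false := by
    funext a; cases f a <;> rfl
  rw [this]; fun_prop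

@[fun_prop]
theorem PTime.or {f g : α → Bool} (hf : PTime f) (hg : PTime g) : PTime fun a => f a || g a := by
  have : (fun a => f a || g a) = fun a => bif f a then true else g a := by
    funext a; cases f a <;> rfl
  rw [this]; fun_prop

@[fun_prop]
theorem PTime.xor {f g : α → Bool} (hf : PTime f) (hg : PTime g) :
    PTime fun a => Bool.xor (f a) (g a) := by
  have : (fun a => Bool.xor (f a) (g a)) = fun a => bif f a then !g a else g a := by
    funext a; cases f a <;> cases g a <;> rfl
  rw [this]; fun_prop

/-! ### Lists -/

@[simp]
theorem len_append (l m : List α) : len (l ++ m) + 1 = len l + len m := by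
  induction l with
  | nil => simp; omega
  | cons i l ih => simp; omega

@[simp]
theorem len_reverse (l : List α) : len l.reverse = len l := by
  induction l with
  | nil => rfl
  | cons i l ih =>
    have := len_append l.reverse [i]
    rw [List.reverse_cons]
    simp only [len_cons, len_nil] at *
    omega

theorem len_le_of_sublist {l m : List α} (h : l.Sublist m) : len l ≤ len m := by
  induction h with
  | slnil => rfl
  | cons _ _ ih => simp; omega
  | cons_cons _ _ ih => simp; omega

theorem len_le_of_mem {l : List α} {i : α} (h : i ∈ l) : len i ≤ len l := by
  have := len_le_of_sublist (List.singleton_sublist.2 h)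
  simp at this; omega

theorem len_list_le {l : List α} {B : ℕ} (h : ∀ i ∈ l, len i ≤ B) :
    len l ≤ 1 + l.length * (1 + B) := by
  induction l with
  | nil => simp
  | cons i l ih =>
    have h1 := ih fun j hj => h j (by simp [hj])
    have h2 := h i (by simp)
    rw [len_cons, List.length_cons, add_mul, one_mul]
    omega

@[fun_prop]
theorem PTime.reverse {l : α → List β} (hl : PTime l) : PTime fun a => (l a).reverse := by
  have := PTime.foldl (l := l) (init := fun _ => ([] : List β)) (step := fun _ acc i => i :: acc)
    hl (by fun_prop) (by fun_prop) hl.polyBdd fun a l' hl' => by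
      simpa [List.foldl_flip_cons_eq_append] using len_le_of_sublist hl'.sublist
  simpa [List.foldl_flip_cons_eq_append] using this

theorem PTime.foldr {ι σ : Type} [Enc ι] [Enc σ] {l : α → List ι} {init : α → σ}
    {step : α → ι → σ → σ} (hl : PTime l) (hi : PTime init)
    (hs : PTime fun x : α × σ × ι => step x.1 x.2.2 x.2.1) {b : α → ℕ} (hb : PolyBdd b)
    (h : ∀ a l', l' <:+ l a → len (l'.foldr (step a) (init a)) ≤ b a) :
    PTime fun a => (l a).foldr (step a) (init a) := by
  have := PTime.foldl (l := fun a => (l a).reverse) (init := init)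
    (step := fun a s i => step a i s) (by fun_prop) hi hs hb fun a l' hl' => by
      have := h a l'.reverse (by rwa [← List.reverse_prefix, List.reverse_reverse])
      simpa using this
  simpa using this

@[fun_prop]
theorem PTime.map {l : α → List β} {f : α → β → γ} (hl : PTime l)
    (hf : PTime fun x : α × β => f x.1 x.2) : PTime fun a => (l a).map (f a) := by
  obtain ⟨q, hq⟩ := hf.polyBdd
  have hb : PolyBdd fun a => 1 + len (l a) * (1 + q.eval (1 + len a + len (l a))) :=
    (PolyBdd.const 1).add (hl.polyBdd.mul ((PolyBdd.const 1).add
      (PolyBdd.comp (b := fun x : α × List β => q.eval (len x)) (f := fun a => (a, l a))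
        ⟨q, fun _ => le_rfl⟩ (PTime.polyBdd (by fun_prop)))))
  have := PTime.foldr (l := l) (init := fun _ => ([] : List γ))
    (step := fun a i acc => f a i :: acc) hl (by fun_prop) (by
      have := hf.comp (f := fun x : α × List γ × β => (x.1, x.2.2)) (by fun_prop)
      fun_prop) hb fun a l' hl' => by
        have e : ∀ m : List β, m.foldr (fun i acc => f a i :: acc) [] = m.map (f a) := fun m => by
          induction m <;> simp_all
        rw [e]
        refine (len_list_le (B := q.eval (1 + len a + len (l a))) ?_).trans ?_
        · intro i hi
          obtain ⟨j, hj, rfl⟩ := List.mem_map.1 hi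
          refine (hq (a, j)).trans (eval_mono q ?_)
          have := len_le_of_mem (hl'.subset hj)
          rw [len_pair]; omega
        · gcongr
          have := length_le_len (l a)
          have := hl'.length_le
          simp; omega
  convert this using 2 with a
  induction l a <;> simp_all

@[fun_prop]
theorem PTime.filter {l : α → List β} {p : α → β → Bool} (hl : PTime l)
    (hp : PTime fun x : α × β => p x.1 x.2) : PTime fun a => (l a).filter (p a) := by
  have e : ∀ a (m : List β),
      m.foldr (fun i acc => bif p a i then i :: acc else acc) [] = m.filter (p a) := fun a m => by
    induction m with
    | nil => rfl
    | cons i m ih => simp only [List.foldr_cons, ih, List.filter_cons]; cases p a i <;> rfl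
  have := PTime.foldr (l := l) (init := fun _ => ([] : List β))
    (step := fun a i acc => bif p a i then i :: acc else acc) hl (by fun_prop) (by
      have := hp.comp (f := fun x : α × List β × β => (x.1, x.2.2)) (by fun_prop)
      fun_prop) hl.polyBdd fun a l' hl' => by
        rw [e]
        exact len_le_of_sublist (List.filter_sublist.trans hl'.sublist)
  simpa only [e] using this

@[fun_prop]
theorem PTime.any {l : α → List β} {p : α → β → Bool} (hl : PTime l)
    (hp : PTime fun x : α × β => p x.1 x.2) : PTime fun a => (l a).any (p a) := by
  have := PTime.foldr (l := l) (init := fun _ => false)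
    (step := fun a i acc => p a i || acc) hl (by fun_prop) (by
      have := hp.comp (f := fun x : α × Bool × β => (x.1, x.2.2)) (by fun_prop)
      fun_prop) (.const 3) fun a l' hl' => len_bool_le _
  convert this using 2 with a
  induction l a <;> simp_all

@[fun_prop]
theorem PTime.all {l : α → List β} {p : α → β → Bool} (hl : PTime l)
    (hp : PTime fun x : α × β => p x.1 x.2) : PTime fun a => (l a).all (p a) := by
  have := PTime.foldr (l := l) (init := fun _ => true)
    (step := fun a i acc => p a i && acc) hl (by fun_prop) (by
      have := hp.comp (f := fun x : α × Bool × β => (x.1, x.2.2)) (by fun_prop)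
      fun_prop) (.const 3) fun a l' hl' => len_bool_le _
  convert this using 2 with a
  induction l a <;> simp_all

@[fun_prop]
theorem PTime.append {l m : α → List β} (hl : PTime l) (hm : PTime m) :
    PTime fun a => l a ++ m a := by
  have := PTime.foldr (l := l) (init := m) (step := fun _ i acc => i :: acc) hl hm (by fun_prop)
    (hl.polyBdd.add hm.polyBdd) fun a l' hl' => by
      have h1 := len_append l' (m a)
      have h2 := len_le_of_sublist hl'.sublist
      simp; omega
  simpa using this

@[fun_prop]
theorem PTime.flatMap {l : α → List β} {f : α → β → List γ} (hl : PTime l)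
    (hf : PTime fun x : α × β => f x.1 x.2) : PTime fun a => (l a).flatMap (f a) := by
  have e : ∀ m : List (List γ), m.foldr (fun i acc => i ++ acc) [] = m.flatten := fun m => by
    induction m <;> simp_all
  have h : PTime fun m : List (List γ) => m.flatten := by
    have := PTime.foldr (l := fun m : List (List γ) => m) (init := fun _ => ([] : List γ))
      (step := fun _ i acc => i ++ acc) (by fun_prop) (by fun_prop) (by fun_prop)
      .len_self fun a l' hl' => by
        refine le_trans ?_ (len_le_of_sublist hl'.sublist)
        rw [e]
        clear hl'
        induction l' with
        | nil => simp
        | cons i l ih =>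
          have := len_append i l.flatten
          simp only [List.flatten_cons, len_cons]; omega
    simpa only [e] using this
  have := h.comp (hl.map hf)
  simpa only [List.flatMap_def] using this

@[fun_prop]
theorem PTime.tail {l : α → List β} (hl : PTime l) : PTime fun a => (l a).tail := by
  have : (fun a => (l a).tail) = fun a => TreeMachine.elimList (l a) [] fun _ m => m := by
    funext a; cases l a <;> rfl
  rw [this]; fun_prop

@[fun_prop]
theorem PTime.isEmpty {l : α → List β} (hl : PTime l) : PTime fun a => (l a).isEmpty := by
  have : (fun a => (l a).isEmpty) = fun a => TreeMachine.elimList (l a) true fun _ _ => false := by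
    funext a; cases l a <;> rfl
  rw [this]; fun_prop

@[fun_prop]
theorem PTime.headD {l : α → List β} {d : α → β} (hl : PTime l) (hd : PTime d) :
    PTime fun a => (l a).headD (d a) := by
  have : (fun a => (l a).headD (d a)) = fun a => TreeMachine.elimList (l a) (d a) fun i _ => i := by
    funext a; cases l a <;> rfl
  rw [this]; fun_prop

/-! ### Binary arithmetic -/

/-- The number with the given binary digits, the least significant one first. -/
def ofBits (l : List Bool) : ℕ := l.foldr Nat.bit 0

@[simp] theorem ofBits_nil : ofBits [] = 0 := rfl

@[simp] theorem ofBits_cons (b : Bool) (l : List Bool) :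
    ofBits (b :: l) = 2 * ofBits l + b.toNat := by
  simp [ofBits, Nat.bit_val]

@[simp] theorem ofBits_bits (n : ℕ) : ofBits n.bits = n := by
  induction n using Nat.binaryRec' with
  | zero => simp
  | bit b n h ih => rw [Nat.bits_append_bit _ _ h, ofBits_cons, ih, Nat.bit_val]

/-- Remove the leading zeros. -/
def trimBits (l : List Bool) : List Bool :=
  l.foldr (fun b acc => bif acc.isEmpty && !b then [] else b :: acc) []

/-- The code of a number has no leading zeros. Digit-wise computations may produce some, and
removing them gives the code. -/
theorem bits_ofBits (l : List Bool) : (ofBits l).bits = trimBits l := by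
  induction l with
  | nil => rfl
  | cons b l ih =>
    have e : trimBits (b :: l) = bif (trimBits l).isEmpty && !b then [] else b :: trimBits l := rfl
    rw [e, ← ih, ofBits_cons, ← Nat.bit_val]
    by_cases h : ofBits l = 0
    · cases b <;> simp [h]
    · rw [Nat.bits_append_bit _ _ fun h' => absurd h' h]
      have : (ofBits l).bits.isEmpty = false := by
        rw [List.isEmpty_eq_false_iff]
        intro h'
        have := ofBits_bits (ofBits l)
        rw [h'] at this
        exact h (by simpa using this.symm)
      simp [this]

theorem trimBits_sublist (l : List Bool) : (trimBits l).Sublist l := by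
  induction l with
  | nil => exact List.Sublist.refl _
  | cons b l ih =>
    have e : trimBits (b :: l) = bif (trimBits l).isEmpty && !b then [] else b :: trimBits l := rfl
    rw [e]
    cases (trimBits l).isEmpty && !b
    · exact ih.cons_cons b
    · exact List.nil_sublist _

@[fun_prop]
theorem PTime.ofBits {l : α → List Bool} (hl : PTime l) : PTime fun a => ofBits (l a) := by
  have : PTime fun a => trimBits (l a) :=
    PTime.foldr hl (by fun_prop) (by fun_prop) hl.polyBdd fun a l' hl' =>
      len_le_of_sublist ((trimBits_sublist l').trans hl'.sublist)
  exact this.congr_enc (fun a => a) (fun _ => rfl) fun a => by rw [← bits_ofBits]; rfl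

@[fun_prop]
theorem PTime.bits {f : α → ℕ} (hf : PTime f) : PTime fun a => (f a).bits :=
  hf.congr_enc (fun a => a) (fun _ => rfl) fun _ => rfl

theorem len_nat_le (n : ℕ) : len n ≤ 1 + 4 * n.size := by
  have h : len n = len n.bits := rfl
  rw [h, ← Nat.size_eq_bits_len]
  refine (len_list_le (B := 3) fun b _ => len_bool_le b).trans (by omega)

theorem size_le_len (n : ℕ) : n.size ≤ len n := by
  have h : len n = len n.bits := rfl
  rw [h, ← Nat.size_eq_bits_len]
  have := length_le_len n.bits
  omega

/-- The carry (or, with `s = true`, the borrow) for one binary digit. -/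
def carry (s c x y : Bool) : Bool :=
  bif c then (Bool.xor x s) || y else (Bool.xor x s) && y

/-- Addition (or, with `s = true`, subtraction) of binary numbers, for as many digits as the clock
`k` has entries; the second component is the carry. -/
def ripple (s : Bool) : List Bool → Bool → List Bool → List Bool → List Bool × Bool
  | [], c, _, _ => ([], c)
  | _ :: k, c, l, m =>
    let r := ripple s k (carry s c (l.headD false) (m.headD false)) l.tail m.tail
    ((Bool.xor (Bool.xor (l.headD false) (m.headD false)) c) :: r.1, r.2)

theorem ofBits_eq (l : List Bool) : ofBits l = 2 * ofBits l.tail + (l.headD false).toNat := by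
  cases l <;> simp

theorem ripple_length (s : Bool) (k : List Bool) : ∀ c l m, (ripple s k c l m).1.length = k.length := by
  induction k with
  | nil => intros; rfl
  | cons b k ih => intros; simp [ripple, ih]

/-- Invariant of schoolbook addition: the outgoing carry has weight `2 ^ k.length`. The clock must
be as long as both numbers so that no digit is left over. -/
theorem ripple_add (k : List Bool) : ∀ c l m, l.length ≤ k.length → m.length ≤ k.length →
    ofBits (ripple false k c l m).1 + 2 ^ k.length * (ripple false k c l m).2.toNat =
      ofBits l + ofBits m + c.toNat := by
  induction k with
  | nil =>
    intro c l m hl hm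
    simp at hl hm
    simp [ripple, hl, hm]
  | cons b k ih =>
    intro c l m hl hm
    have := ih (carry false c (l.headD false) (m.headD false)) l.tail m.tail
      (by simp at *; omega) (by simp at *; omega)
    rw [ofBits_eq l, ofBits_eq m]
    simp only [ripple, ofBits_cons, List.length_cons, pow_succ]
    have e : (Bool.xor (Bool.xor (l.headD false) (m.headD false)) c).toNat +
        2 * (carry false c (l.headD false) (m.headD false)).toNat =
        (l.headD false).toNat + (m.headD false).toNat + c.toNat := by
      cases l.headD false <;> cases m.headD false <;> cases c <;> rfl
    linarith

theorem ripple_sub (k : List Bool) : ∀ c l m, l.length ≤ k.length → m.length ≤ k.length →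
    ofBits (ripple true k c l m).1 + ofBits m + c.toNat =
      ofBits l + 2 ^ k.length * (ripple true k c l m).2.toNat := by
  induction k with
  | nil =>
    intro c l m hl hm
    simp at hl hm
    simp [ripple, hl, hm]
  | cons b k ih =>
    intro c l m hl hm
    have := ih (carry true c (l.headD false) (m.headD false)) l.tail m.tail
      (by simp at *; omega) (by simp at *; omega)
    rw [ofBits_eq l, ofBits_eq m]
    simp only [ripple, ofBits_cons, List.length_cons, pow_succ]
    have e : (Bool.xor (Bool.xor (l.headD false) (m.headD false)) c).toNat +
        (m.headD false).toNat + c.toNat =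
        (l.headD false).toNat + 2 * (carry true c (l.headD false) (m.headD false)).toNat := by
      cases l.headD false <;> cases m.headD false <;> cases c <;> rfl
    linarith

/-- An iterative form of `ripple`, to which `PTime.foldl` applies; the digits accumulate in reverse
order. -/
theorem foldl_ripple (s : Bool) (k : List Bool) : ∀ c l m acc,
    k.foldl (fun (x : Bool × List Bool × List Bool × List Bool) (_ : Bool) =>
      (carry s x.1 (x.2.1.headD false) (x.2.2.1.headD false), x.2.1.tail, x.2.2.1.tail,
        (Bool.xor (Bool.xor (x.2.1.headD false) (x.2.2.1.headD false)) x.1) :: x.2.2.2))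
      (c, l, m, acc) =
    ((ripple s k c l m).2, l.drop k.length, m.drop k.length,
      (ripple s k c l m).1.reverse ++ acc) := by
  induction k with
  | nil => intros; simp [ripple]
  | cons b k ih =>
    intros
    simp only [List.foldl_cons, ih, ripple, List.length_cons, List.drop_tail, List.reverse_cons,
      List.append_assoc, List.singleton_append]

@[fun_prop]
theorem PTime.ripple {k l m : α → List Bool} (s c : Bool) (hk : PTime k) (hl : PTime l)
    (hm : PTime m) : PTime fun a => ripple s (k a) c (l a) (m a) := by
  have h := PTime.foldl (l := k) (init := fun a => (c, l a, m a, ([] : List Bool)))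
    (step := fun _ (x : Bool × List Bool × List Bool × List Bool) (_ : Bool) =>
      (carry s x.1 (x.2.1.headD false) (x.2.2.1.headD false), x.2.1.tail, x.2.2.1.tail,
        (Bool.xor (Bool.xor (x.2.1.headD false) (x.2.2.1.headD false)) x.1) :: x.2.2.2))
    hk (by fun_prop) (by unfold carry; fun_prop)
    ((((PolyBdd.const 7).add hl.polyBdd).add hm.polyBdd).add (hk.polyBdd.mul (.const 4)))
    fun a l' hl' => by
      rw [foldl_ripple]
      simp only [len_pair, List.append_nil, len_reverse]
      have h1 := len_bool_le (TreeMachine.ripple s l' c (l a) (m a)).2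
      have h2 := len_le_of_sublist (List.drop_sublist l'.length (l a))
      have h3 := len_le_of_sublist (List.drop_sublist l'.length (m a))
      have h4 := len_list_le (l := (TreeMachine.ripple s l' c (l a) (m a)).1) (B := 3)
        fun b _ => len_bool_le b
      rw [ripple_length] at h4
      have h5 := hl'.length_le
      have h6 := length_le_len (k a)
      omega
  have h2 : PTime fun x : Bool × List Bool × List Bool × List Bool => (x.2.2.2.reverse, x.1) := by
    fun_prop
  have := h2.comp h
  simpa only [foldl_ripple, List.append_nil, List.reverse_reverse, Prod.mk.eta] using this

@[fun_prop]
theorem PTime.add {f g : α → ℕ} (hf : PTime f) (hg : PTime g) : PTime fun a => f a + g a := by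
  -- The extra entry `true` only lengthens the clock; with the added digit the final carry is zero.
  have h : PTime fun a =>
      TreeMachine.ofBits (TreeMachine.ripple false ((f a).bits ++ ((g a).bits ++ [true])) false (f a).bits (g a).bits).1 := by
    fun_prop
  convert h using 2 with a
  have h1 := ripple_add ((f a).bits ++ ((g a).bits ++ [true])) false (f a).bits (g a).bits
    (by simp) (by simp; omega)
  simp only [ofBits_bits] at h1
  have h2 : f a + g a < 2 ^ ((f a).bits ++ ((g a).bits ++ [true])).length := by
    simp only [List.length_append, Nat.size_eq_bits_len, List.length_singleton]
    have h3 := (f a).lt_size_self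
    have h4 := (g a).lt_size_self
    rw [← add_assoc, pow_succ, pow_add]
    have h5 := Nat.one_le_two_pow (n := (f a).size)
    have h6 := Nat.one_le_two_pow (n := (g a).size)
    nlinarith
  cases hr : (TreeMachine.ripple false ((f a).bits ++ ((g a).bits ++ [true])) false (f a).bits (g a).bits).2
  · simp [hr] at h1; omega
  · simp only [hr, Bool.toNat_true, mul_one, Bool.toNat_false, add_zero] at h1; omega

@[fun_prop]
theorem PTime.sub {f g : α → ℕ} (hf : PTime f) (hg : PTime g) : PTime fun a => f a - g a := by
  -- A final borrow means `f a < g a`, where truncated subtraction gives zero.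
  have h : PTime fun a =>
      (fun r : List Bool × Bool => bif r.2 then 0 else TreeMachine.ofBits r.1)
        (TreeMachine.ripple true ((f a).bits ++ (g a).bits) false (f a).bits (g a).bits) := by
    fun_prop
  convert h using 2 with a
  have h1 := ripple_sub ((f a).bits ++ (g a).bits) false (f a).bits (g a).bits
    (by simp) (by simp)
  have h2 : ∀ l : List Bool, TreeMachine.ofBits l < 2 ^ l.length := fun l => by
    induction l with
    | nil => simp
    | cons b l ih => have := b.toNat_le; simp [pow_succ]; omega
  have h3 := h2 (TreeMachine.ripple true ((f a).bits ++ (g a).bits) false (f a).bits (g a).bits).1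
  rw [ripple_length] at h3
  simp only [ofBits_bits] at h1
  cases hr : (TreeMachine.ripple true ((f a).bits ++ (g a).bits) false (f a).bits (g a).bits).2
  · simp only [hr, Bool.toNat_false, mul_zero, add_zero, cond_false] at h1 ⊢; omega
  · simp only [hr, Bool.toNat_true, mul_one, Bool.toNat_false, add_zero, cond_true] at h1 ⊢; omega

/-- Equality is decidable in polynomial time. -/
class EncEq (α : Type) [Enc α] [BEq α] : Prop where
  pTime_beq : PTime fun p : α × α => p.1 == p.2

@[fun_prop]
theorem PTime.beq [BEq β] [EncEq β] {f g : α → β} (hf : PTime f) (hg : PTime g) :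
    PTime fun a => f a == g a :=
  (EncEq.pTime_beq (α := β)).comp (hf.prodMk hg)

@[fun_prop]
theorem PTime.ble {f g : α → ℕ} (hf : PTime f) (hg : PTime g) :
    PTime fun a => Nat.ble (f a) (g a) := by
  have h : PTime fun a => (f a - g a).bits.isEmpty := by fun_prop
  convert h using 2 with a
  rw [Bool.eq_iff_iff, List.isEmpty_iff, Nat.ble_eq, ← Nat.sub_eq_zero_iff_le]
  constructor
  · intro h; simp [h]
  · intro h
    have := ofBits_bits (f a - g a)
    rw [h] at this
    simpa using this.symm

instance : EncEq ℕ := ⟨by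
  have h : PTime fun p : ℕ × ℕ => Nat.ble p.1 p.2 && Nat.ble p.2 p.1 := by fun_prop
  convert h using 2 with p
  rw [Bool.eq_iff_iff]
  simp
  omega⟩

instance [BEq α] [BEq β] [EncEq α] [EncEq β] : EncEq (α × β) := ⟨by
  have h : PTime fun p : (α × β) × α × β => p.1.1 == p.2.1 && p.1.2 == p.2.2 := by fun_prop
  exact h⟩

@[fun_prop]
theorem PTime.contains [BEq β] [EncEq β] {l : α → List β} {f : α → β} (hl : PTime l)
    (hf : PTime f) : PTime fun a => (l a).contains (f a) := by
  have : (fun a => (l a).contains (f a)) = fun a => (l a).any fun i => f a == i := by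
    funext a; rw [List.any_beq]
  rw [this]; fun_prop

@[fun_prop]
theorem PTime.mul {f g : α → ℕ} (hf : PTime f) (hg : PTime g) : PTime fun a => f a * g a := by
  -- Horner's scheme: since the least significant digit comes first, the fold from the right doubles
  -- and adds from the most significant digit on.
  have e : ∀ (n : ℕ) (l : List Bool),
      l.foldr (fun b acc => (acc + acc) + bif b then n else 0) 0 = n * TreeMachine.ofBits l := by
    intro n l
    induction l with
    | nil => rfl
    | cons b l ih => rw [List.foldr_cons, ih]; cases b <;> simp <;> ring
  have h := PTime.foldr (l := fun a => (g a).bits) (init := fun _ => 0)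
    (step := fun a b acc => (acc + acc) + bif b then f a else 0) (by fun_prop) (by fun_prop)
    (by fun_prop) (((PolyBdd.const 1).add ((PolyBdd.const 4).mul hf.polyBdd)).add
      ((PolyBdd.const 4).mul hg.polyBdd)) fun a l' hl' => by
      rw [e]
      refine (len_nat_le _).trans ?_
      have h1 : TreeMachine.ofBits l' < 2 ^ l'.length := by
        clear hl'
        induction l' with
        | nil => simp
        | cons b l ih => have := b.toNat_le; simp [pow_succ]; omega
      have h2 : (f a * TreeMachine.ofBits l').size ≤ (f a).size + l'.length := by
        rw [Nat.size_le, pow_add]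
        exact Nat.mul_lt_mul'' (Nat.lt_size_self _) h1
      have h3 := size_le_len (f a)
      have h4 := size_le_len (g a)
      have h5 := hl'.length_le
      rw [Nat.size_eq_bits_len] at h5
      omega
  simpa [e] using h

end TreeMachine

/-! ### Numbering the entries of a list -/

namespace TreeMachine

open Enc

section

variable {α β γ δ : Type} [Enc α] [Enc β] [Enc γ] [Enc δ]

@[fun_prop]
theorem PTime.valCons {f g : α → Val} (hf : PTime f) (hg : PTime g) :
    PTime fun a => Val.cons (f a) (g a) :=
  (hf.prodMk hg).congr_enc (fun a => a) (fun _ => rfl) fun _ => rfl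

theorem foldl_zipIdx {β : Type} (l : List β) : ∀ (k : ℕ) (acc : List (β × ℕ)),
    l.foldl (fun (s : ℕ × List (β × ℕ)) i => (s.1 + 1, (i, s.1) :: s.2)) (k, acc) =
      (k + l.length, (l.zipIdx k).reverse ++ acc) := by
  induction l with
  | nil => simp
  | cons i l ih =>
    intro k acc
    simp only [List.foldl_cons, ih, List.length_cons, List.zipIdx_cons, List.reverse_cons,
      List.append_assoc, List.singleton_append, Prod.mk.injEq, and_true]
    omega

@[fun_prop]
theorem PTime.zipIdx {l : α → List β} (hl : PTime l) : PTime fun a => (l a).zipIdx := by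
  have key : ∀ n m : ℕ, n ≤ m → len n ≤ 1 + 4 * m := fun n m h =>
    (len_nat_le n).trans (by
      have := Nat.size_le.2 (n.lt_two_pow_self)
      omega)
  have h := PTime.foldl (l := l) (init := fun _ => (0, ([] : List (β × ℕ))))
    (step := fun _ s i => (s.1 + 1, (i, s.1) :: s.2)) hl (by fun_prop) (by fun_prop)
    (((PolyBdd.const 3).add ((PolyBdd.const 4).mul hl.polyBdd)).add
      (hl.polyBdd.mul ((PolyBdd.const 3).add ((PolyBdd.const 5).mul hl.polyBdd))))
    fun a l' hl' => by
      have h1 := hl'.length_le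
      have h2 := length_le_len (l a)
      rw [foldl_zipIdx, List.append_nil, len_pair, len_reverse]
      have h3 := len_list_le (l := l'.zipIdx) (B := 2 + 5 * len (l a)) fun p hp => by
        obtain ⟨b, k⟩ := p
        have h4 := List.mem_zipIdx hp
        have h5 : b ∈ l a := hl'.subset (by rw [h4.2.2]; simp)
        have h6 := len_le_of_mem h5
        have h7 := key k (len (l a)) (by omega)
        rw [len_pair]; omega
      have h8 := key (0 + l'.length) (len (l a)) (by omega)
      rw [List.length_zipIdx] at h3
      have h9 : l'.length * (1 + (2 + 5 * len (l a))) ≤ len (l a) * (3 + 5 * len (l a)) :=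
        Nat.mul_le_mul (by omega) (by omega)
      omega
  have h2 : PTime fun x : ℕ × List (β × ℕ) => x.2.reverse := by fun_prop
  simpa only [foldl_zipIdx, List.append_nil, List.reverse_reverse] using h2.comp h

end

end TreeMachine

namespace SFO

open TreeMachine TreeMachine.Enc

/-! ### The algorithm -/

/-- An edge is given by its number and its two ends. -/
abbrev Edge : Type := ℕ × ℕ × ℕ

/-- The requirement `(B, x, y)` asks to join `x` and `y` with the help of the pairs in `B`. -/
abbrev Req : Type := List (ℕ × ℕ) × ℕ × ℕ

/-- The ends of the edges in a list. -/
def endsOf (F : List Edge) : List (ℕ × ℕ) := F.map fun e => e.2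

/-- Both directions of the given pairs. -/
def sym (l : List (ℕ × ℕ)) : List (ℕ × ℕ) := l ++ l.map fun p => (p.2, p.1)

/-- The pairs `(u, v)` such that there is a directed path from `u` to `v`. -/
def closure (V : List ℕ) (arcs : List (ℕ × ℕ)) : List (ℕ × ℕ) :=
  arcs.foldl (fun T a => (V.flatMap fun u => V.map fun v => (u, v)).filter fun p =>
      T.contains p || (T.contains (p.1, a.1) && T.contains (a.2, p.2)))
    ((V.flatMap fun u => V.map fun v => (u, v)).filter fun p => p.1 == p.2)

/-- The pairs of nodes that are connected by `F` and the pairs of the requirement `r`. -/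
def reqTable (V : List ℕ) (F : List Edge) (r : Req) : List (ℕ × ℕ) :=
  closure V (sym (r.1 ++ endsOf F))

/-- All requirements are met by `F`. -/
def covers (V : List ℕ) (R : List Req) (F : List Edge) : Bool :=
  R.all fun r => (reqTable V F r).contains r.2

/-- The components of the ends of the requirements that are not met. -/
def candidates (V : List ℕ) (R : List Req) (F : List Edge) : List (List ℕ) :=
  R.flatMap fun r =>
    bif (reqTable V F r).contains r.2 then [] else
      [V.filter fun v => (reqTable V F r).contains (r.2.1, v),
        V.filter fun v => (reqTable V F r).contains (r.2.2, v)]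

/-- Inclusion of lists of nodes. -/
def incl (X Y : List ℕ) : Bool := X.all fun v => Y.contains v

/-- The minimal violated sets. -/
def active (V : List ℕ) (R : List Req) (F : List Edge) : List (List ℕ) :=
  (candidates V R F).filter fun X =>
    (candidates V R F).all fun Y => !incl Y X || incl X Y

/-- Some set contains `a` and not `b`. -/
def leaves (A : List (List ℕ)) (a b : ℕ) : Bool :=
  A.any fun X => X.contains a && !X.contains b

/-- Twice the increase of the duals that makes the edge tight. -/
def slack (A : List (List ℕ)) (p : Edge × ℕ) : ℕ :=
  bif leaves A p.1.2.1 p.1.2.2 && leaves A p.1.2.2 p.1.2.1 then p.2 else p.2 + p.2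

/-- The edges that leave some active set. -/
def crossing (A : List (List ℕ)) (res : List (Edge × ℕ)) : List (Edge × ℕ) :=
  res.filter fun p => leaves A p.1.2.1 p.1.2.2 || leaves A p.1.2.2 p.1.2.1

/-- The edges that become tight first. -/
def tightest (A : List (List ℕ)) (res : List (Edge × ℕ)) : List (Edge × ℕ) :=
  (crossing A res).filter fun p => (crossing A res).all fun q => Nat.ble (slack A p) (slack A q)

/-- Twice the cost that is left when the duals of the active sets grow by `d / 2`. -/
def reduceCost (A : List (List ℕ)) (d : ℕ) (q : Edge × ℕ) : ℕ :=
  q.2 + q.2 - (bif leaves A q.1.2.1 q.1.2.2 then d else 0) -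
    bif leaves A q.1.2.2 q.1.2.1 then d else 0

/-- Buy the edge `p`. -/
def buy (A : List (List ℕ)) (s : List (Edge × ℕ) × List Edge) (p : Edge × ℕ) :
    List (Edge × ℕ) × List Edge :=
  ((s.1.filter fun q => !(q.1 == p.1)).map fun q => (q.1, reduceCost A (slack A p) q), p.1 :: s.2)

/-- One step of the primal-dual algorithm.  The state consists of the edges that can still be bought,
with their reduced costs, and of the edges bought so far, the latest one first. -/
def grow (V : List ℕ) (R : List Req) (s : List (Edge × ℕ) × List Edge) :
    List (Edge × ℕ) × List Edge :=
  elimList (tightest (active V R s.2) s.1) s fun p _ => buy (active V R s.2) s p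

/-- Buy edges until all requirements are met. -/
def growAll (V : List ℕ) (R : List Req) (E : List (Edge × ℕ)) : List (Edge × ℕ) × List Edge :=
  E.foldl (fun s _ => grow V R s) (E, [])

/-- Delete the edges that are not needed, in the given order. -/
def prune (V : List ℕ) (R : List Req) (F : List Edge) : List Edge :=
  F.foldl (fun cur e => bif covers V R (cur.filter fun f => !(f == e)) then
    cur.filter fun f => !(f == e) else cur) F

/-- An approximately cheapest set of edges that meets the requirements. -/
def cheapCover (V : List ℕ) (R : List Req) (E : List (Edge × ℕ)) : List Edge :=
  prune V R (growAll V R E).2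

/-- The ends of the given pairs have to be joined. -/
def demands (P : List (ℕ × ℕ)) : List Req := P.map fun p => ([], p)

/-- The edges of `H` other than `e`. -/
def without (H : List Edge) (e : Edge) : List Edge := H.filter fun f => !(f == e)

/-- The pairs that are connected in `H` without the edge `e`. -/
def tableWithout (V : List ℕ) (H : List Edge) (e : Edge) : List (ℕ × ℕ) :=
  closure V (sym (endsOf (without H e)))

/-- Some pair needs a path through the edge `(a, b)` in this direction; `T` tells what is connected
without the edge. -/
def uses (P T : List (ℕ × ℕ)) (a b : ℕ) : Bool :=
  P.any fun p => T.contains (p.1, a) && T.contains (b, p.2)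

/-- The ends of an edge of `H` that is needed in both directions have to be joined by other edges. -/
def conflicts (V : List ℕ) (P : List (ℕ × ℕ)) (H : List Edge) : List Req :=
  (H.filter fun e => uses P (tableWithout V H e) e.2.1 e.2.2 &&
    uses P (tableWithout V H e) e.2.2 e.2.1).map fun e => (endsOf (without H e), e.2)

/-- The pairs, and both directions of the edges that are no bridges. -/
def orientReqs (V : List ℕ) (P : List (ℕ × ℕ)) (H : List Edge) : List (ℕ × ℕ) :=
  P ++ sym (endsOf (H.filter fun e => (tableWithout V H e).contains e.2))

/-- All pairs are connected by directed paths. -/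
def satisfied (V : List ℕ) (R arcs : List (ℕ × ℕ)) : Bool :=
  R.all fun p => (closure V arcs).contains p

/-- Choose a direction for the edge `e`, when the edges in `s.1` have their directions and the edges
in `s.2` are still undirected. -/
def orientStep (V : List ℕ) (R : List (ℕ × ℕ)) (s : List Edge × List Edge) (e : Edge) :
    List Edge × List Edge :=
  ((bif satisfied V R ((e.2.1, e.2.2) :: (endsOf s.1 ++ sym (endsOf s.2.tail))) then e
    else (e.1, e.2.2, e.2.1)) :: s.1, s.2.tail)

/-- Orient the edges one after the other. -/
def orient (V : List ℕ) (R : List (ℕ × ℕ)) (H : List Edge) : List Edge :=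
  (H.foldl (orientStep V R) ([], H)).1

/-- The edges with their numbers. -/
abbrev Numbered : Type := List (((ℕ × ℕ) × ℕ × ℕ) × ℕ)

/-- The edges with their costs, multiplied by the product of all denominators. -/
def scale (Z : Numbered) : List (Edge × ℕ) :=
  Z.map fun z => ((z.2, z.1.1),
    Z.foldl (fun c z' => c * bif z'.2 == z.2 then z'.1.2.1 else z'.1.2.2) 1)

/-- The answer as a tree: for each edge, its direction in `D`. -/
def writeAnswer (Z : Numbered) (D : List Edge) : Val :=
  .cons (enc ([] : List Edge)) (enc (Z.map fun z =>
    elimList (D.filter fun o => o.1 == z.2) (enc ([] : List Edge)) fun o _ => enc o.2))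

/-- The edges bought in the second phase. -/
def augmentation (V : List ℕ) (P : List (ℕ × ℕ)) (E : List (Edge × ℕ)) (H : List Edge) :
    List Edge :=
  cheapCover V (conflicts V P H) (E.filter fun q => !H.contains q.1)

/-- Orient the union of the edges bought in the two phases, if this is possible. -/
def finish (V : List ℕ) (P : List (ℕ × ℕ)) (Z : Numbered) (H F : List Edge) : Val :=
  bif covers V (demands P) H && covers V (conflicts V P H) F then
    writeAnswer Z (orient V (orientReqs V P (H ++ F)) (H ++ F))
  else enc ([] : List Edge)

/-- The approximation algorithm for numbered edges. -/
def solveNumbered (V : List ℕ) (P : List (ℕ × ℕ)) (Z : Numbered) : Val :=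
  finish V P Z (cheapCover V (demands P) (scale Z))
    (augmentation V P (scale Z) (cheapCover V (demands P) (scale Z)))

/-- The approximation algorithm. -/
def solve (x : List ℕ × List ((ℕ × ℕ) × ℕ × ℕ) × List (ℕ × ℕ)) : Val :=
  solveNumbered x.1 x.2.2 x.2.1.zipIdx

/-! ### The running time -/

section

variable {α : Type} [Enc α]

@[fun_prop]
theorem pTime_endsOf {F : α → List Edge} (hF : PTime F) : PTime fun a => endsOf (F a) := by
  unfold endsOf; fun_prop

@[fun_prop]
theorem pTime_sym {l : α → List (ℕ × ℕ)} (hl : PTime l) : PTime fun a => sym (l a) := by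
  unfold sym; fun_prop

theorem closure_sublist (V : List ℕ) (arcs : List (ℕ × ℕ)) :
    (closure V arcs).Sublist (V.flatMap fun u => V.map fun v => (u, v)) := by
  induction arcs using List.reverseRecOn with
  | nil => exact List.filter_sublist
  | append_singleton l a _ =>
    rw [closure, List.foldl_append]
    exact List.filter_sublist

@[fun_prop]
theorem pTime_closure {V : α → List ℕ} {l : α → List (ℕ × ℕ)} (hV : PTime V) (hl : PTime l) :
    PTime fun a => closure (V a) (l a) :=
  PTime.foldl hl (by fun_prop) (by fun_prop)
    (b := fun a => len ((V a).flatMap fun u => (V a).map fun v => (u, v)))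
    (PTime.polyBdd (by fun_prop)) fun a l' _ => len_le_of_sublist (closure_sublist (V a) l')

@[fun_prop]
theorem pTime_reqTable {V : α → List ℕ} {F : α → List Edge} {r : α → Req} (hV : PTime V)
    (hF : PTime F) (hr : PTime r) : PTime fun a => reqTable (V a) (F a) (r a) := by
  unfold reqTable; fun_prop

@[fun_prop]
theorem pTime_covers {V : α → List ℕ} {R : α → List Req} {F : α → List Edge} (hV : PTime V)
    (hR : PTime R) (hF : PTime F) : PTime fun a => covers (V a) (R a) (F a) := by
  unfold covers; fun_prop

@[fun_prop]
theorem pTime_candidates {V : α → List ℕ} {R : α → List Req} {F : α → List Edge} (hV : PTime V)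
    (hR : PTime R) (hF : PTime F) : PTime fun a => candidates (V a) (R a) (F a) := by
  unfold candidates; fun_prop

@[fun_prop]
theorem pTime_incl {X Y : α → List ℕ} (hX : PTime X) (hY : PTime Y) :
    PTime fun a => incl (X a) (Y a) := by
  unfold incl; fun_prop

@[fun_prop]
theorem pTime_active {V : α → List ℕ} {R : α → List Req} {F : α → List Edge} (hV : PTime V)
    (hR : PTime R) (hF : PTime F) : PTime fun a => active (V a) (R a) (F a) := by
  unfold active; fun_prop

@[fun_prop]
theorem pTime_leaves {A : α → List (List ℕ)} {u v : α → ℕ} (hA : PTime A)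
    (hu : PTime u) (hv : PTime v) : PTime fun a => leaves (A a) (u a) (v a) := by
  unfold leaves; fun_prop

@[fun_prop]
theorem pTime_slack {A : α → List (List ℕ)} {p : α → Edge × ℕ} (hA : PTime A) (hp : PTime p) :
    PTime fun a => slack (A a) (p a) := by
  unfold slack; fun_prop

@[fun_prop]
theorem pTime_crossing {A : α → List (List ℕ)} {l : α → List (Edge × ℕ)} (hA : PTime A)
    (hl : PTime l) : PTime fun a => crossing (A a) (l a) := by
  unfold crossing; fun_prop

@[fun_prop]
theorem pTime_tightest {A : α → List (List ℕ)} {l : α → List (Edge × ℕ)} (hA : PTime A)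
    (hl : PTime l) : PTime fun a => tightest (A a) (l a) := by
  unfold tightest; fun_prop

@[fun_prop]
theorem pTime_reduceCost {A : α → List (List ℕ)} {d : α → ℕ} {q : α → Edge × ℕ} (hA : PTime A)
    (hd : PTime d) (hq : PTime q) : PTime fun a => reduceCost (A a) (d a) (q a) := by
  unfold reduceCost; fun_prop

@[fun_prop]
theorem pTime_buy {A : α → List (List ℕ)} {s : α → List (Edge × ℕ) × List Edge}
    {p : α → Edge × ℕ} (hA : PTime A) (hs : PTime s) (hp : PTime p) :
    PTime fun a => buy (A a) (s a) (p a) := by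
  unfold buy; fun_prop

@[fun_prop]
theorem pTime_grow {V : α → List ℕ} {R : α → List Req} {s : α → List (Edge × ℕ) × List Edge}
    (hV : PTime V) (hR : PTime R) (hs : PTime s) : PTime fun a => grow (V a) (R a) (s a) := by
  unfold grow; fun_prop

/-- Bounds for the state of the primal-dual algorithm after `k` steps. -/
structure GrowBound (E : List (Edge × ℕ)) (k : ℕ) (s : List (Edge × ℕ) × List Edge) : Prop where
  length_fst : s.1.length ≤ E.length
  length_snd : s.2.length ≤ k
  mem_fst : ∀ q ∈ s.1, q.1 ∈ E.map Prod.fst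
  size_le : ∀ q ∈ s.1, q.2.size ≤ len E + k
  mem_snd : ∀ e ∈ s.2, e ∈ E.map Prod.fst

theorem mem_of_mem_tightest {A : List (List ℕ)} {l : List (Edge × ℕ)} {p : Edge × ℕ}
    (h : p ∈ tightest A l) : p ∈ l :=
  List.mem_of_mem_filter (List.mem_of_mem_filter h)

theorem grow_eq (V : List ℕ) (R : List Req) (s : List (Edge × ℕ) × List Edge) :
    (tightest (active V R s.2) s.1 = [] ∧ grow V R s = s) ∨
      ∃ p ∈ tightest (active V R s.2) s.1, grow V R s = buy (active V R s.2) s p := by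
  unfold grow
  cases h : tightest (active V R s.2) s.1 with
  | nil => exact .inl ⟨rfl, rfl⟩
  | cons p l => exact .inr ⟨p, by simp, rfl⟩

theorem GrowBound.grow {E : List (Edge × ℕ)} {k : ℕ} {s : List (Edge × ℕ) × List Edge}
    (h : GrowBound E k s) (V : List ℕ) (R : List Req) : GrowBound E (k + 1) (grow V R s) := by
  rcases grow_eq V R s with ⟨-, e⟩ | ⟨p, hp, e⟩ <;> rw [e]
  · exact ⟨h.1, by have := h.2; omega, h.3, fun q hq => by have := h.4 q hq; omega, h.5⟩
  · refine ⟨?_, by simpa [buy] using h.2, ?_, ?_, ?_⟩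
    · simpa [buy] using (List.length_filter_le _ _).trans h.1
    · intro q hq
      obtain ⟨q', hq', rfl⟩ := List.mem_map.1 hq
      exact h.3 q' (List.mem_of_mem_filter hq')
    · intro q hq
      obtain ⟨q', hq', rfl⟩ := List.mem_map.1 hq
      have h1 := Nat.size_le.1 (h.4 q' (List.mem_of_mem_filter hq'))
      -- A reduced cost is at most twice the previous cost, which is one more binary digit per step.
      -- As there is one step per edge, all costs stay polynomially long.
      rw [Nat.size_le, ← add_assoc, pow_succ]
      simp only [reduceCost]
      omega
    · intro e he
      rcases List.mem_cons.1 he with rfl | he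
      · exact h.3 p (mem_of_mem_tightest hp)
      · exact h.5 e he

theorem growBound_foldl (V : List ℕ) (R : List Req) (E l : List (Edge × ℕ)) :
    GrowBound E l.length (l.foldl (fun s _ => grow V R s) (E, [])) := by
  induction l using List.reverseRecOn with
  | nil =>
    refine ⟨le_rfl, le_rfl, fun q hq => List.mem_map_of_mem hq, fun q hq => ?_, by simp⟩
    have h1 := size_le_len q.2
    have h2 : len q ≤ len E := len_le_of_mem hq
    have h3 : len q = 1 + len q.1 + len q.2 := rfl
    change q.2.size ≤ len E + 0
    omega
  | append_singleton l a ih =>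
    rw [List.foldl_append, List.length_append]
    exact ih.grow V R

theorem GrowBound.len_le {E : List (Edge × ℕ)} {k : ℕ} {s : List (Edge × ℕ) × List Edge}
    (h : GrowBound E k s) (hk : k ≤ len E) :
    len s ≤ 3 + len E * (1 + (2 + 9 * len E)) + len E * (1 + len E) := by
  have key : ∀ e ∈ E.map Prod.fst, len e ≤ len E := fun e he => by
    obtain ⟨q, hq, rfl⟩ := List.mem_map.1 he
    have h2 := len_le_of_mem hq
    have h3 : len q = 1 + len q.1 + len q.2 := rfl
    omega
  have h1 := len_list_le (l := s.1) (B := 2 + 9 * len E) fun q hq => by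
    have h3 : len q = 1 + len q.1 + len q.2 := rfl
    have h4 := key _ (h.3 q hq)
    have h5 := h.4 q hq
    have h6 := len_nat_le q.2
    omega
  have h2 := len_list_le (l := s.2) (B := len E) fun e he => key e (h.5 e he)
  have h3 : len s = 1 + len s.1 + len s.2 := rfl
  have h4 := length_le_len E
  have h5 := Nat.mul_le_mul_right (1 + (2 + 9 * len E)) (h.1.trans (show E.length ≤ len E by omega))
  have h6 := Nat.mul_le_mul_right (1 + len E) (h.2.trans hk)
  omega

@[fun_prop]
theorem pTime_growAll {V : α → List ℕ} {R : α → List Req} {E : α → List (Edge × ℕ)}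
    (hV : PTime V) (hR : PTime R) (hE : PTime E) : PTime fun a => growAll (V a) (R a) (E a) := by
  refine PTime.foldl hE (by fun_prop) (by fun_prop)
    (((PolyBdd.const 3).add (hE.polyBdd.mul ((PolyBdd.const 1).add ((PolyBdd.const 2).add
      ((PolyBdd.const 9).mul hE.polyBdd))))).add (hE.polyBdd.mul ((PolyBdd.const 1).add hE.polyBdd)))
    fun a l' hl' => (growBound_foldl (V a) (R a) (E a) l').len_le ?_
  have := length_le_len (E a)
  have := hl'.length_le
  omega

theorem foldl_prune_sublist (V : List ℕ) (R : List Req) (F l : List Edge) :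
    (l.foldl (fun cur e => bif covers V R (cur.filter fun f => !(f == e)) then
      cur.filter fun f => !(f == e) else cur) F).Sublist F := by
  induction l using List.reverseRecOn with
  | nil => exact List.Sublist.refl _
  | append_singleton l a ih =>
    rw [List.foldl_append, List.foldl_cons, List.foldl_nil, cond_eq_ite]
    split
    · exact List.filter_sublist.trans ih
    · exact ih

@[fun_prop]
theorem pTime_prune {V : α → List ℕ} {R : α → List Req} {F : α → List Edge} (hV : PTime V)
    (hR : PTime R) (hF : PTime F) : PTime fun a => prune (V a) (R a) (F a) :=
  PTime.foldl hF hF (by fun_prop) hF.polyBdd fun a l' _ =>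
    len_le_of_sublist (foldl_prune_sublist (V a) (R a) (F a) l')

@[fun_prop]
theorem pTime_cheapCover {V : α → List ℕ} {R : α → List Req} {E : α → List (Edge × ℕ)}
    (hV : PTime V) (hR : PTime R) (hE : PTime E) :
    PTime fun a => cheapCover (V a) (R a) (E a) := by
  unfold cheapCover; fun_prop

@[fun_prop]
theorem pTime_demands {P : α → List (ℕ × ℕ)} (hP : PTime P) : PTime fun a => demands (P a) := by
  unfold demands; fun_prop

@[fun_prop]
theorem pTime_without {H : α → List Edge} {e : α → Edge} (hH : PTime H) (he : PTime e) :
    PTime fun a => without (H a) (e a) := by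
  unfold without; fun_prop

@[fun_prop]
theorem pTime_tableWithout {V : α → List ℕ} {H : α → List Edge} {e : α → Edge} (hV : PTime V)
    (hH : PTime H) (he : PTime e) : PTime fun a => tableWithout (V a) (H a) (e a) := by
  unfold tableWithout; fun_prop

@[fun_prop]
theorem pTime_uses {P T : α → List (ℕ × ℕ)} {u v : α → ℕ} (hP : PTime P) (hT : PTime T)
    (hu : PTime u) (hv : PTime v) : PTime fun a => uses (P a) (T a) (u a) (v a) := by
  unfold uses; fun_prop

@[fun_prop]
theorem pTime_conflicts {V : α → List ℕ} {P : α → List (ℕ × ℕ)} {H : α → List Edge}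
    (hV : PTime V) (hP : PTime P) (hH : PTime H) :
    PTime fun a => conflicts (V a) (P a) (H a) := by
  unfold conflicts; fun_prop

@[fun_prop]
theorem pTime_orientReqs {V : α → List ℕ} {P : α → List (ℕ × ℕ)} {H : α → List Edge}
    (hV : PTime V) (hP : PTime P) (hH : PTime H) :
    PTime fun a => orientReqs (V a) (P a) (H a) := by
  unfold orientReqs; fun_prop

@[fun_prop]
theorem pTime_satisfied {V : α → List ℕ} {R l : α → List (ℕ × ℕ)} (hV : PTime V)
    (hR : PTime R) (hl : PTime l) : PTime fun a => satisfied (V a) (R a) (l a) := by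
  unfold satisfied; fun_prop

theorem foldl_orientStep_snd (V : List ℕ) (R : List (ℕ × ℕ)) (l : List Edge) :
    ∀ s, (l.foldl (orientStep V R) s).2 = s.2.drop l.length := by
  induction l with
  | nil => simp
  | cons e l ih => intro s; simp [ih, orientStep]

theorem len_foldl_orientStep_fst (V : List ℕ) (R : List (ℕ × ℕ)) (l : List Edge) :
    ∀ s, len (l.foldl (orientStep V R) s).1 + 1 = len s.1 + len l := by
  induction l with
  | nil => simp
  | cons e l ih =>
    intro s
    rw [List.foldl_cons, ih, orientStep, len_cons, len_cons]
    have h1 : len e = 1 + len e.1 + (1 + len e.2.1 + len e.2.2) := rfl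
    have h2 : len ((e.1, e.2.2, e.2.1) : Edge) = 1 + len e.1 + (1 + len e.2.2 + len e.2.1) := rfl
    cases satisfied V R ((e.2.1, e.2.2) :: (endsOf s.1 ++ sym (endsOf s.2.tail))) <;>
      simp only [cond_true, cond_false] <;> omega

@[fun_prop]
theorem pTime_orient {V : α → List ℕ} {R : α → List (ℕ × ℕ)} {H : α → List Edge} (hV : PTime V)
    (hR : PTime R) (hH : PTime H) : PTime fun a => orient (V a) (R a) (H a) := by
  have h : PTime fun a => (H a).foldl (orientStep (V a) (R a)) ([], H a) := by
    refine PTime.foldl hH (by fun_prop) (by unfold orientStep; fun_prop)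
      (((PolyBdd.const 1).add hH.polyBdd).add hH.polyBdd) fun a l' hl' => ?_
    have h1 := len_foldl_orientStep_fst (V a) (R a) l' ([], H a)
    have h2 := len_le_of_sublist (List.drop_sublist l'.length (H a))
    have h3 := len_le_of_sublist hl'.sublist
    have h4 : ∀ s : List Edge × List Edge, len s = 1 + len s.1 + len s.2 := fun _ => rfl
    rw [h4, foldl_orientStep_snd]
    simp only [len_nil] at h1
    simp only
    omega
  unfold orient
  fun_prop

/-- Bit lengths add up under multiplication, so the product of all denominators is polynomially long
although its value may be exponential. -/
theorem size_foldl_mul {β : Type} [Enc β] (f : β → ℕ) (hf : ∀ b, (f b).size ≤ len b) (l : List β) :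
    ∀ c : ℕ, (l.foldl (fun c b => c * f b) c).size ≤ c.size + len l := by
  induction l with
  | nil => simp
  | cons b l ih =>
    intro c
    have h1 := ih (c * f b)
    have h2 : (c * f b).size ≤ c.size + (f b).size := by
      rw [Nat.size_le, pow_add]
      exact Nat.mul_lt_mul'' (Nat.lt_size_self _) (Nat.lt_size_self _)
    have h3 := hf b
    simp only [List.foldl_cons, len_cons]
    omega

@[fun_prop]
theorem pTime_scale {Z : α → Numbered} (hZ : PTime Z) : PTime fun a => scale (Z a) := by
  have h : PTime fun x : α × (((ℕ × ℕ) × ℕ × ℕ) × ℕ) =>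
      (Z x.1).foldl (fun c z' => c * bif z'.2 == x.2.2 then z'.1.2.1 else z'.1.2.2) 1 := by
    have hZ' : PTime fun x : α × (((ℕ × ℕ) × ℕ × ℕ) × ℕ) => Z x.1 := by fun_prop
    refine PTime.foldl hZ' (by fun_prop) (by fun_prop)
      ((PolyBdd.const 1).add ((PolyBdd.const 4).mul ((PolyBdd.const 1).add hZ'.polyBdd)))
      fun a l' hl' => (len_nat_le _).trans ?_
    have h1 := size_foldl_mul
      (fun z' : ((ℕ × ℕ) × ℕ × ℕ) × ℕ => bif z'.2 == a.2.2 then z'.1.2.1 else z'.1.2.2) (fun z' => by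
        have h2 : len z' = 1 + (1 + len z'.1.1 + (1 + len z'.1.2.1 + len z'.1.2.2)) + len z'.2 := rfl
        have h3 := size_le_len z'.1.2.1
        have h4 := size_le_len z'.1.2.2
        cases z'.2 == a.2.2 <;> simp only [cond_true, cond_false] <;> omega) l' 1
    have h2 := len_le_of_sublist hl'.sublist
    rw [Nat.size_one] at h1
    omega
  unfold scale
  fun_prop

@[fun_prop]
theorem pTime_writeAnswer {Z : α → Numbered} {D : α → List Edge} (hZ : PTime Z) (hD : PTime D) :
    PTime fun a => writeAnswer (Z a) (D a) := by
  unfold writeAnswer; fun_prop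

@[fun_prop]
theorem pTime_augmentation {V : α → List ℕ} {P : α → List (ℕ × ℕ)} {E : α → List (Edge × ℕ)}
    {H : α → List Edge} (hV : PTime V) (hP : PTime P) (hE : PTime E) (hH : PTime H) :
    PTime fun a => augmentation (V a) (P a) (E a) (H a) := by
  unfold augmentation; fun_prop

@[fun_prop]
theorem pTime_finish {V : α → List ℕ} {P : α → List (ℕ × ℕ)} {Z : α → Numbered}
    {H F : α → List Edge} (hV : PTime V) (hP : PTime P) (hZ : PTime Z) (hH : PTime H)
    (hF : PTime F) : PTime fun a => finish (V a) (P a) (Z a) (H a) (F a) := by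
  unfold finish; fun_prop

@[fun_prop]
theorem pTime_solveNumbered {V : α → List ℕ} {P : α → List (ℕ × ℕ)} {Z : α → Numbered}
    (hV : PTime V) (hP : PTime P) (hZ : PTime Z) :
    PTime fun a => solveNumbered (V a) (P a) (Z a) := by
  unfold solveNumbered; fun_prop

theorem pTime_solve : PTime solve := by
  unfold solve; fun_prop

end

end SFO

/-! ### Covering uncrossable families -/

namespace SFO

section

variable {α ι : Type} [DecidableEq α]

/-- Exactly one of the two nodes lies in `X`. -/
def Crosses (X : Finset α) (p : α × α) : Prop := ¬(p.1 ∈ X ↔ p.2 ∈ X)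

instance (X : Finset α) (p : α × α) : Decidable (Crosses X p) := by
  unfold Crosses; infer_instance

/-- The edges of `J` that cross `X`. -/
def cut (ends : ι → α × α) (J : Finset ι) (X : Finset α) : Finset ι :=
  J.filter fun e => Crosses X (ends e)

/-- Of any two sets of the family, either the intersection and the union or the two differences
belong to the family. -/
def Uncrossable (𝓕 : Finset α → Prop) : Prop :=
  ∀ X Y, 𝓕 X → 𝓕 Y → (𝓕 (X ∩ Y) ∧ 𝓕 (X ∪ Y)) ∨ (𝓕 (X \ Y) ∧ 𝓕 (Y \ X))

/-- Submodularity of the cut function. It holds edge by edge and depends only on where the two ends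
lie relative to `X` and `Y`; the inequality for the two differences has the same proof. -/
theorem card_cut_inter_add_card_cut_union (ends : ι → α × α) (J : Finset ι) (X Y : Finset α) :
    (cut ends J (X ∩ Y)).card + (cut ends J (X ∪ Y)).card ≤
      (cut ends J X).card + (cut ends J Y).card := by
  simp only [cut, Finset.card_filter, ← Finset.sum_add_distrib]
  refine Finset.sum_le_sum fun e _ => ?_
  by_cases h1 : (ends e).1 ∈ X <;> by_cases h2 : (ends e).2 ∈ X <;>
    by_cases h3 : (ends e).1 ∈ Y <;> by_cases h4 : (ends e).2 ∈ Y <;>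
    simp [Crosses, h1, h2, h3, h4]

theorem card_cut_sdiff_add_card_cut_sdiff (ends : ι → α × α) (J : Finset ι) (X Y : Finset α) :
    (cut ends J (X \ Y)).card + (cut ends J (Y \ X)).card ≤
      (cut ends J X).card + (cut ends J Y).card := by
  simp only [cut, Finset.card_filter, ← Finset.sum_add_distrib]
  refine Finset.sum_le_sum fun e _ => ?_
  by_cases h1 : (ends e).1 ∈ X <;> by_cases h2 : (ends e).2 ∈ X <;>
    by_cases h3 : (ends e).1 ∈ Y <;> by_cases h4 : (ends e).2 ∈ Y <;>
    simp [Crosses, h1, h2, h3, h4]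

/-- Among the sets with a property there is one that is minimal under inclusion. -/
theorem exists_minimal_finset {p : Finset α → Prop} (h : ∃ X, p X) :
    ∃ X, p X ∧ ∀ Y, p Y → Y ⊆ X → Y = X := by
  obtain ⟨X, hX, hm⟩ := WellFounded.has_min
    (wellFounded_lt : WellFounded ((· < ·) : Finset α → Finset α → Prop)) {X | p X} h
  exact ⟨X, hX, fun Y hY hYX => by
    by_contra hne
    exact hm Y hY (lt_of_le_of_ne hYX hne)⟩

theorem card_filter_mem_le_one {𝒜 : Finset (Finset α)}
    (hd : ∀ Y ∈ 𝒜, ∀ Z ∈ 𝒜, Y ≠ Z → Disjoint Y Z) (p : α) :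
    (𝒜.filter fun Z => p ∈ Z).card ≤ 1 := by
  refine Finset.card_le_one.2 fun Y hY Z hZ => ?_
  rw [Finset.mem_filter] at hY hZ
  by_contra hne
  exact Finset.disjoint_left.1 (hd Y hY.1 Z hZ.1 hne) hY.2 hZ.2

/-- If `J` is a minimal cover of an uncrossable family, and every set of the family contains some
set of a disjoint collection `𝒜` whose members are not split by the family, then the members of `𝒜`
have at most two edges of `J` on average. -/
theorem sum_card_cut_le [DecidableEq ι] (ends : ι → α × α) (J : Finset ι) :
    ∀ (𝓕 : Finset α → Prop) (𝒜 : Finset (Finset α)), Uncrossable 𝓕 →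
      (∀ X, 𝓕 X → (cut ends J X).Nonempty) →
      (∀ e ∈ J, ∃ S, 𝓕 S ∧ cut ends J S = {e}) →
      (∀ Z ∈ 𝒜, Z.Nonempty) →
      (∀ Y ∈ 𝒜, ∀ Z ∈ 𝒜, Y ≠ Z → Disjoint Y Z) →
      (∀ X, 𝓕 X → ∀ Z ∈ 𝒜, Z ⊆ X ∨ Disjoint Z X) →
      (∀ X, 𝓕 X → ∃ Z ∈ 𝒜, Z ⊆ X) →
      ∑ Z ∈ 𝒜, (cut ends J Z).card ≤ 2 * 𝒜.card := by
  induction hn : J.card generalizing J with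
  | zero =>
    intro 𝓕 𝒜 _ _ _ _ _ _ _
    simp [Finset.card_eq_zero.1 hn, cut]
  | succ n ih =>
    intro 𝓕 𝒜 hu hc hw hne hd ha hm
    obtain ⟨e₀, he₀⟩ : J.Nonempty := Finset.card_pos.1 (by omega)
    -- The induction removes the only edge `e` that crosses an inclusion-minimal set `S` among the
    -- sets crossed exactly once.
    obtain ⟨S, ⟨hS, hS1⟩, hSmin⟩ := exists_minimal_finset
      (p := fun S => 𝓕 S ∧ (cut ends J S).card = 1)
      (let ⟨S, h1, h2⟩ := hw e₀ he₀; ⟨S, h1, by simp [h2]⟩)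
    obtain ⟨e, hSe⟩ := Finset.card_eq_one.1 hS1
    have heS : e ∈ cut ends J S := by simp [hSe]
    have heJ : e ∈ J := (Finset.mem_filter.1 heS).1
    have hpos : ∀ X, 𝓕 X → 1 ≤ (cut ends J X).card := fun X hX => Finset.card_pos.2 (hc X hX)
    -- No other edge has an end in `S`. It would have both ends there; uncross `S` with a set `T`
    -- that only `f` crosses. The two resulting sets have cuts of total size at most 2, hence
    -- exactly one edge each, so minimality of `S` gives `S ⊆ T` or `S` disjoint from `T`. Either
    -- way `f` does not cross `T`.
    have hout : ∀ f ∈ J, f ≠ e → (ends f).1 ∉ S ∧ (ends f).2 ∉ S := by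
      intro f hf hfe
      have h1 : f ∉ cut ends J S := by simp [hSe, hfe]
      have h2 : (ends f).1 ∈ S ↔ (ends f).2 ∈ S := by
        by_contra h; exact h1 (Finset.mem_filter.2 ⟨hf, h⟩)
      by_contra h3
      have h4 : (ends f).1 ∈ S ∧ (ends f).2 ∈ S := by tauto
      obtain ⟨T, hT, hTf⟩ := hw f hf
      have h5 : ¬((ends f).1 ∈ T ↔ (ends f).2 ∈ T) :=
        (Finset.mem_filter.1 (show f ∈ cut ends J T by simp [hTf])).2
      have h6 : (cut ends J T).card = 1 := by simp [hTf]
      rcases hu S T hS hT with ⟨hi, hun⟩ | ⟨hst, hts⟩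
      · have h7 := card_cut_inter_add_card_cut_union ends J S T
        have h8 := hpos _ hi
        have h9 := hpos _ hun
        have h10 := hSmin _ ⟨hi, by omega⟩ Finset.inter_subset_left
        rw [Finset.inter_eq_left] at h10
        exact h5 ⟨fun _ => h10 h4.2, fun _ => h10 h4.1⟩
      · have h7 := card_cut_sdiff_add_card_cut_sdiff ends J S T
        have h8 := hpos _ hst
        have h9 := hpos _ hts
        have h10 := hSmin _ ⟨hst, by omega⟩ Finset.sdiff_subset
        rw [Finset.sdiff_eq_self_iff_disjoint, Finset.disjoint_left] at h10
        exact h5 ⟨fun h => absurd h (h10 h4.1), fun h => absurd h (h10 h4.2)⟩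
    obtain ⟨p, q, hp, hq, hpq⟩ : ∃ p q, p ∈ S ∧ q ∉ S ∧
        ∀ X, Crosses X (ends e) ↔ ¬(p ∈ X ↔ q ∈ X) := by
      have h1 : ¬((ends e).1 ∈ S ↔ (ends e).2 ∈ S) := (Finset.mem_filter.1 heS).2
      by_cases h : (ends e).1 ∈ S
      · exact ⟨_, (ends e).2, h, by tauto, fun X => Iff.rfl⟩
      · exact ⟨(ends e).2, (ends e).1, by tauto, h, fun X => by unfold Crosses; tauto⟩
    have hcut : ∀ X, (p ∈ X ↔ q ∈ X) → cut ends (J.erase e) X = cut ends J X := by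
      intro X hX
      ext f
      simp only [cut, Finset.mem_filter, Finset.mem_erase]
      constructor
      · tauto
      · rintro ⟨h1, h2⟩
        exact ⟨⟨fun h => by rw [h, hpq] at h2; exact h2 hX, h1⟩, h2⟩
    -- Deleting `e` is paired with keeping only the sets that do not separate its ends `p ∈ S` and
    -- `q ∉ S`. The new family is uncrossable, and `J - e` is a minimal cover of it.
    set 𝓖 : Finset α → Prop := fun X => 𝓕 X ∧ (p ∈ X ↔ q ∈ X) with h𝓖
    have hu' : Uncrossable 𝓖 := by
      rintro X Y ⟨hX, hX'⟩ ⟨hY, hY'⟩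
      rcases hu X Y hX hY with ⟨h1, h2⟩ | ⟨h1, h2⟩
      · exact .inl ⟨⟨h1, by simp only [Finset.mem_inter]; tauto⟩,
          ⟨h2, by simp only [Finset.mem_union]; tauto⟩⟩
      · exact .inr ⟨⟨h1, by simp only [Finset.mem_sdiff]; tauto⟩,
          ⟨h2, by simp only [Finset.mem_sdiff]; tauto⟩⟩
    have hc' : ∀ X, 𝓖 X → (cut ends (J.erase e) X).Nonempty := fun X hX => by
      rw [hcut X hX.2]; exact hc X hX.1
    have hw' : ∀ f ∈ J.erase e, ∃ T, 𝓖 T ∧ cut ends (J.erase e) T = {f} := by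
      intro f hf
      rw [Finset.mem_erase] at hf
      obtain ⟨T, hT, hTf⟩ := hw f hf.2
      have h1 : p ∈ T ↔ q ∈ T := by
        by_contra h
        have h2 : e ∈ cut ends J T := Finset.mem_filter.2 ⟨heJ, (hpq T).2 h⟩
        rw [hTf, Finset.mem_singleton] at h2
        exact hf.1 h2.symm
      exact ⟨T, ⟨hT, h1⟩, by rw [hcut T h1, hTf]⟩
    set 𝒜₀ := 𝒜.filter fun Z => Z ⊆ S with h𝒜₀
    set 𝒜₁ := 𝒜.filter fun Z => ¬Z ⊆ S with h𝒜₁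
    have hsub₁ : ∀ Z ∈ 𝒜₁, Z ∈ 𝒜 := fun Z hZ => (Finset.mem_filter.1 hZ).1
    have hd₁ : ∀ Y ∈ 𝒜₁, ∀ Z ∈ 𝒜₁, Y ≠ Z → Disjoint Y Z := fun Y hY Z hZ =>
      hd Y (hsub₁ Y hY) Z (hsub₁ Z hZ)
    have hcard : 𝒜₀.card + 𝒜₁.card = 𝒜.card := Finset.card_filter_add_card_filter_not _
    have h𝒜₀pos : 1 ≤ 𝒜₀.card := by
      obtain ⟨Z, hZ, hZS⟩ := hm S hS
      exact Finset.card_pos.2 ⟨Z, Finset.mem_filter.2 ⟨hZ, hZS⟩⟩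
    have hsum : ∑ Z ∈ 𝒜₀, (cut ends J Z).card + ∑ Z ∈ 𝒜₁, (cut ends J Z).card =
        ∑ Z ∈ 𝒜, (cut ends J Z).card := Finset.sum_filter_add_sum_filter_not _ _ _
    -- Inside `S` the only end of an edge is the end `p` of `e`, and at most one of the disjoint
    -- members contains it.
    have hsum₀ : ∑ Z ∈ 𝒜₀, (cut ends J Z).card ≤ 1 := by
      calc ∑ Z ∈ 𝒜₀, (cut ends J Z).card ≤ ∑ Z ∈ 𝒜₀, if p ∈ Z then 1 else 0 := by
            refine Finset.sum_le_sum fun Z hZ => ?_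
            have hZS := (Finset.mem_filter.1 hZ).2
            have h1 : ∀ f ∈ cut ends J Z, f = e ∧ p ∈ Z := by
              intro f hf
              obtain ⟨hfJ, hfZ⟩ := Finset.mem_filter.1 hf
              by_cases hfe : f = e
              · subst hfe
                rw [hpq] at hfZ
                have : q ∉ Z := fun h => hq (hZS h)
                exact ⟨rfl, by tauto⟩
              · have h2 := hout f hfJ hfe
                exact absurd ⟨fun h => absurd (hZS h) h2.1, fun h => absurd (hZS h) h2.2⟩ hfZ
            split_ifs with h
            · exact Finset.card_le_one.2 fun a ha b hb => (h1 a ha).1.trans (h1 b hb).1.symm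
            · rw [Nat.le_zero, Finset.card_eq_zero, Finset.eq_empty_iff_forall_notMem]
              exact fun f hf => h (h1 f hf).2
        _ ≤ 1 := by
            rw [← Finset.card_filter]
            exact card_filter_mem_le_one (fun Y hY Z hZ =>
              hd Y (Finset.mem_filter.1 hY).1 Z (Finset.mem_filter.1 hZ).1) p
    -- Members not inside `S` are disjoint from `S`, so `e` crosses only the one that contains `q`,
    -- if there is one.
    have hsum₁ : ∑ Z ∈ 𝒜₁, (cut ends J Z).card ≤
        ∑ Z ∈ 𝒜₁, (cut ends (J.erase e) Z).card + (𝒜₁.filter fun Z => q ∈ Z).card := by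
      rw [Finset.card_filter, ← Finset.sum_add_distrib]
      refine Finset.sum_le_sum fun Z hZ => ?_
      have hZ' := Finset.mem_filter.1 hZ
      have hpZ : p ∉ Z := fun h =>
        Finset.disjoint_left.1 ((ha S hS Z hZ'.1).resolve_left hZ'.2) h hp
      split_ifs with h
      · have h1 : cut ends (J.erase e) Z = (cut ends J Z).erase e := by
          rw [cut, cut, Finset.filter_erase]
        rw [h1]
        have := Finset.pred_card_le_card_erase (s := cut ends J Z) (a := e)
        omega
      · rw [hcut Z (by tauto), add_zero]
    have hq1 := card_filter_mem_le_one hd₁ q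
    -- A remaining set with no member of `𝒜₁` inside can contain only members lying in `S`, so `X \
    -- S` is not in the family and `X ∩ S` is. Only `e` can cross `X ∩ S`, at `p`; hence `p ∈ X` and
    -- therefore `q ∈ X`.
    have hkey : ∀ X, 𝓖 X → (∀ Z ∈ 𝒜₁, ¬Z ⊆ X) → q ∈ X ∧ ∀ Z ∈ 𝒜₁, q ∉ Z := by
      rintro X ⟨hX, hpX⟩ hno
      have hXS : ∀ Z ∈ 𝒜, Z ⊆ X → Z ⊆ S := fun Z hZ hZX => by
        by_contra h
        exact hno Z (Finset.mem_filter.2 ⟨hZ, h⟩) hZX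
      have hqX : q ∈ X := by
        rcases hu X S hX hS with ⟨h1, -⟩ | ⟨h1, -⟩
        · obtain ⟨f, hf⟩ := hc _ h1
          obtain ⟨hfJ, hf'⟩ := Finset.mem_filter.1 hf
          by_cases hfe : f = e
          · rw [hfe, hpq] at hf'
            simp only [Finset.mem_inter] at hf'
            tauto
          · have h2 := hout f hfJ hfe
            simp only [Crosses, Finset.mem_inter] at hf'
            tauto
        · obtain ⟨Z, hZ, hZX⟩ := hm _ h1
          obtain ⟨z, hz⟩ := hne Z hZ
          have h2 := hXS Z hZ (hZX.trans Finset.sdiff_subset) hz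
          exact absurd h2 (Finset.mem_sdiff.1 (hZX hz)).2
      refine ⟨hqX, fun Z hZ hqZ => ?_⟩
      rcases ha X hX Z (hsub₁ Z hZ) with h | h
      · exact hno Z hZ h
      · exact Finset.disjoint_left.1 h hqZ hqX
    have hJ' : (J.erase e).card = n := by rw [Finset.card_erase_of_mem heJ, hn]; rfl
    -- If `𝒜₁` still meets the last hypothesis, the sum is at most `1 + 1 + 2 * 𝒜₁.card`, and `𝒜₀`
    -- has at least one member.
    by_cases hall : ∀ X, 𝓖 X → ∃ Z ∈ 𝒜₁, Z ⊆ X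
    · have h1 := ih (J.erase e) hJ' 𝓖 𝒜₁ hu' hc' hw' (fun Z hZ => hne Z (hsub₁ Z hZ)) hd₁
        (fun X hX Z hZ => ha X hX.1 Z (hsub₁ Z hZ)) hall
      omega
    -- Otherwise a minimal exceptional set `N` takes the place of the lost members. It contains `q`,
    -- so no member of `𝒜₁` does and `e` adds nothing there. The induction bound includes at least
    -- one edge crossing `N`; this pays for the one edge counted inside `S`.
    · obtain ⟨N, ⟨hN, hNno⟩, hNmin⟩ := exists_minimal_finset
        (p := fun X => 𝓖 X ∧ ∀ Z ∈ 𝒜₁, ¬Z ⊆ X) (by push Not at hall; exact hall)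
      have hNmin' : ∀ Y, 𝓖 Y → Y ⊆ N → Y = N := fun Y hY hYN =>
        hNmin Y ⟨hY, fun Z hZ hZY => hNno Z hZ (hZY.trans hYN)⟩ hYN
      obtain ⟨hqN, hqno⟩ := hkey N hN hNno
      have hNmem : N ∉ 𝒜₁ := fun h => hNno N h subset_rfl
      have hNd : ∀ Z ∈ 𝒜₁, Disjoint Z N := fun Z hZ =>
        (ha N hN.1 Z (hsub₁ Z hZ)).resolve_left (hNno Z hZ)
      have haN : ∀ X, 𝓖 X → N ⊆ X ∨ Disjoint N X := by
        intro X hX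
        rcases hu' N X hN hX with ⟨h, -⟩ | ⟨h, -⟩
        · exact .inl (Finset.inter_eq_left.1 (hNmin' _ h Finset.inter_subset_left))
        · exact .inr (Finset.sdiff_eq_self_iff_disjoint.1 (hNmin' _ h Finset.sdiff_subset))
      have h1 := ih (J.erase e) hJ' 𝓖 (insert N 𝒜₁) hu' hc' hw'
        (by
          intro Z hZ
          rcases Finset.mem_insert.1 hZ with rfl | hZ
          · exact ⟨q, hqN⟩
          · exact hne Z (hsub₁ Z hZ))
        (by
          intro Y hY Z hZ hYZ
          rcases Finset.mem_insert.1 hY with h1 | h1 <;>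
            rcases Finset.mem_insert.1 hZ with h2 | h2
          · exact absurd (h1.trans h2.symm) hYZ
          · exact h1 ▸ (hNd Z h2).symm
          · exact h2 ▸ hNd Y h1
          · exact hd₁ Y h1 Z h2 hYZ)
        (by
          intro X hX Z hZ
          rcases Finset.mem_insert.1 hZ with rfl | hZ
          · exact haN X hX
          · exact ha X hX.1 Z (hsub₁ Z hZ))
        (by
          intro X hX
          by_cases h : ∃ Z ∈ 𝒜₁, Z ⊆ X
          · obtain ⟨Z, hZ, hZX⟩ := h
            exact ⟨Z, Finset.mem_insert_of_mem hZ, hZX⟩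
          · push Not at h
            have h2 := (hkey X hX h).1
            exact ⟨N, Finset.mem_insert_self _ _, (haN X hX).resolve_right fun h3 =>
              Finset.disjoint_left.1 h3 hqN h2⟩)
      rw [Finset.sum_insert hNmem, Finset.card_insert_of_notMem hNmem] at h1
      have h2 := Finset.card_pos.2 (hc' N hN)
      have h3 : (𝒜₁.filter fun Z => q ∈ Z).card = 0 := by
        rw [Finset.card_eq_zero, Finset.filter_eq_empty_iff]
        exact hqno
      omega

end

end SFO

namespace SFO

/-! ### Connectivity -/

/-- There is a directed path from `u` to `v`. -/
def Reach (l : List (ℕ × ℕ)) (u v : ℕ) : Prop := Relation.ReflTransGen (fun a b => (a, b) ∈ l) u v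

/-- There is an undirected path between `u` and `v`. -/
def Conn (l : List (ℕ × ℕ)) (u v : ℕ) : Prop := Reach (sym l) u v

theorem Reach.refl (l : List (ℕ × ℕ)) (u : ℕ) : Reach l u u := Relation.ReflTransGen.refl

theorem Reach.trans {l : List (ℕ × ℕ)} {u v w : ℕ} (h : Reach l u v) (h' : Reach l v w) :
    Reach l u w := Relation.ReflTransGen.trans h h'

theorem Reach.of_mem {l : List (ℕ × ℕ)} {u v : ℕ} (h : (u, v) ∈ l) : Reach l u v :=
  Relation.ReflTransGen.single h

theorem Reach.mono' {l m : List (ℕ × ℕ)} {u v : ℕ} (h : Reach l u v)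
    (hlm : ∀ a b, (a, b) ∈ l → Reach m a b) : Reach m u v := by
  induction h with
  | refl => exact .refl _ _
  | tail _ h ih => exact ih.trans (hlm _ _ h)

theorem Reach.mono {l m : List (ℕ × ℕ)} {u v : ℕ} (h : Reach l u v) (hlm : l ⊆ m) : Reach m u v :=
  h.mono' fun _ _ h => .of_mem (hlm h)

theorem Reach.exists_leaving {l : List (ℕ × ℕ)} {u v : ℕ} (h : Reach l u v) (p : ℕ → Prop)
    (hu : p u) (hv : ¬p v) : ∃ a b, (a, b) ∈ l ∧ p a ∧ ¬p b := by
  induction h with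
  | refl => exact absurd hu hv
  | @tail b c _ h ih =>
    by_cases hb : p b
    · exact ⟨b, c, h, hb, hv⟩
    · exact ih hb

/-- One use of the new arc is enough: cut a path before the first and after the last use. This is
the recurrence by which `closure` updates its table. -/
theorem reach_cons_iff {l : List (ℕ × ℕ)} {a b u v : ℕ} :
    Reach ((a, b) :: l) u v ↔ Reach l u v ∨ Reach l u a ∧ Reach l b v := by
  constructor
  · intro h
    induction h with
    | refl => exact .inl (.refl _ _)
    | @tail c d _ h ih =>
      rcases List.mem_cons.1 h with h | h
      · obtain ⟨rfl, rfl⟩ := Prod.mk.inj h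
        rcases ih with ih | ih
        · exact .inr ⟨ih, .refl _ _⟩
        · exact .inr ⟨ih.1, .refl _ _⟩
      · rcases ih with ih | ih
        · exact .inl (ih.trans (.of_mem h))
        · exact .inr ⟨ih.1, ih.2.trans (.of_mem h)⟩
  · have h0 : l ⊆ (a, b) :: l := List.subset_cons_self _ _
    rintro (h | ⟨h1, h2⟩)
    · exact h.mono h0
    · exact ((h1.mono h0).trans (.of_mem (by simp))).trans (h2.mono h0)

theorem mem_sym {l : List (ℕ × ℕ)} {a b : ℕ} : (a, b) ∈ sym l ↔ (a, b) ∈ l ∨ (b, a) ∈ l := by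
  simp [sym]

theorem Conn.refl (l : List (ℕ × ℕ)) (u : ℕ) : Conn l u u := Reach.refl _ u

theorem Conn.trans {l : List (ℕ × ℕ)} {u v w : ℕ} (h : Conn l u v) (h' : Conn l v w) :
    Conn l u w := Reach.trans h h'

theorem Conn.symm {l : List (ℕ × ℕ)} {u v : ℕ} (h : Conn l u v) : Conn l v u := by
  induction h with
  | refl => exact .refl _ _
  | tail _ h ih => exact Reach.trans (.of_mem (mem_sym.2 (mem_sym.1 h).symm)) ih

theorem Conn.of_mem {l : List (ℕ × ℕ)} {u v : ℕ} (h : (u, v) ∈ l) : Conn l u v :=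
  Reach.of_mem (mem_sym.2 (.inl h))

theorem Conn.mono' {l m : List (ℕ × ℕ)} {u v : ℕ} (h : Conn l u v)
    (hlm : ∀ a b, (a, b) ∈ l → Conn m a b) : Conn m u v :=
  Reach.mono' h fun a b h => (mem_sym.1 h).elim (hlm a b) fun h => (hlm b a h).symm

theorem Conn.mono {l m : List (ℕ × ℕ)} {u v : ℕ} (h : Conn l u v) (hlm : l ⊆ m) : Conn m u v :=
  h.mono' fun _ _ h => .of_mem (hlm h)

theorem Conn.exists_crosses {l : List (ℕ × ℕ)} {x : ℕ × ℕ} (h : Conn l x.1 x.2) {X : Finset ℕ}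
    (hX : Crosses X x) : ∃ p ∈ l, Crosses X p := by
  obtain ⟨a, b, hab, h1⟩ : ∃ a b, (a, b) ∈ sym l ∧ ¬(a ∈ X ↔ b ∈ X) := by
    by_cases h1 : x.1 ∈ X
    · obtain ⟨a, b, h2, h3⟩ := Reach.exists_leaving h (· ∈ X) h1 (by unfold Crosses at hX; tauto)
      exact ⟨a, b, h2, by tauto⟩
    · obtain ⟨a, b, h2, h3⟩ := Reach.exists_leaving h (· ∉ X) h1 (by unfold Crosses at hX; tauto)
      exact ⟨a, b, h2, by tauto⟩
  rcases mem_sym.1 hab with h2 | h2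
  · exact ⟨_, h2, h1⟩
  · exact ⟨_, h2, fun h3 => h1 h3.symm⟩

theorem conn_cons_iff {l : List (ℕ × ℕ)} {a b u v : ℕ} : Conn ((a, b) :: l) u v ↔
    Conn l u v ∨ (Conn l u a ∧ Conn l b v) ∨ (Conn l u b ∧ Conn l a v) := by
  have h : Conn ((a, b) :: l) u v ↔ Reach ((a, b) :: (b, a) :: sym l) u v := by
    constructor <;> refine fun h => Reach.mono h fun p hp => ?_ <;> obtain ⟨c, d⟩ := p <;>
      simp only [mem_sym, List.mem_cons, Prod.mk.injEq] at hp ⊢ <;> tauto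
  rw [h, reach_cons_iff, reach_cons_iff, reach_cons_iff, reach_cons_iff]
  constructor
  · rintro ((h | h) | ⟨h1 | h1, h2 | h2⟩)
    · exact .inl h
    · exact .inr (.inr h)
    · exact .inr (.inl ⟨h1, h2⟩)
    · exact .inl (h1.trans h2.2)
    · exact .inl (h1.1.trans h2)
    · exact .inr (.inr ⟨h1.1, h2.2⟩)
  · rintro (h | h | h)
    · exact .inl (.inl h)
    · exact .inr ⟨.inl h.1, .inl h.2⟩
    · exact .inl (.inr h)

/-- All nodes of the pairs belong to `V`. -/
def Within (V : List ℕ) (l : List (ℕ × ℕ)) : Prop := ∀ p ∈ l, p.1 ∈ V ∧ p.2 ∈ V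

theorem Within.mono {V : List ℕ} {l m : List (ℕ × ℕ)} (h : Within V m) (hlm : l ⊆ m) :
    Within V l := fun p hp => h p (hlm hp)

theorem Within.append {V : List ℕ} {l m : List (ℕ × ℕ)} (hl : Within V l) (hm : Within V m) :
    Within V (l ++ m) := fun p hp => (List.mem_append.1 hp).elim (hl p) (hm p)

theorem Within.sym {V : List ℕ} {l : List (ℕ × ℕ)} (h : Within V l) : Within V (sym l) := by
  rintro ⟨a, b⟩ hp
  rcases mem_sym.1 hp with h1 | h1
  · exact h _ h1
  · exact (h _ h1).symm

theorem mem_closure {V : List ℕ} {l : List (ℕ × ℕ)} (hl : Within V l) {u v : ℕ} :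
    (u, v) ∈ closure V l ↔ u ∈ V ∧ v ∈ V ∧ Reach l u v := by
  have hpairs : ∀ u v, (u, v) ∈ (V.flatMap fun u => V.map fun v => (u, v)) ↔ u ∈ V ∧ v ∈ V := by
    simp
  induction l using List.reverseRecOn generalizing u v with
  | nil =>
    have h : Reach [] u v ↔ u = v :=
      ⟨fun h => by cases h with
        | refl => rfl
        | tail _ h => simp at h, fun h => h ▸ .refl _ _⟩
    rw [closure, List.foldl_nil, List.mem_filter, hpairs, h]
    simp [and_assoc]
  | append_singleton l a ih =>
    have hl' : Within V l := hl.mono (by simp)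
    have ha : a.1 ∈ V ∧ a.2 ∈ V := hl a (by simp)
    have h1 : Reach (l ++ [a]) u v ↔ Reach ((a.1, a.2) :: l) u v := by
      constructor <;> exact fun h => h.mono (by intro p; simp; tauto)
    have h2 : closure V (l ++ [a]) = (V.flatMap fun u => V.map fun v => (u, v)).filter fun p =>
      (closure V l).contains p ||
        ((closure V l).contains (p.1, a.1) && (closure V l).contains (a.2, p.2)) := by
      rw [closure, List.foldl_append]; rfl
    rw [h2, h1, reach_cons_iff, List.mem_filter, hpairs]
    simp only [Bool.or_eq_true, Bool.and_eq_true, List.contains_iff_mem]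
    have e : ∀ u v, (u, v) ∈ closure V l ↔ u ∈ V ∧ v ∈ V ∧ Reach l u v := fun u v => ih hl'
    rw [e, e, e]
    tauto

theorem mem_closure_sym {V : List ℕ} {l : List (ℕ × ℕ)} (hl : Within V l) {u v : ℕ} :
    (u, v) ∈ closure V (sym l) ↔ u ∈ V ∧ v ∈ V ∧ Conn l u v := mem_closure hl.sym

/-! ### Violated sets -/

theorem mem_endsOf {F : List Edge} {p : ℕ × ℕ} : p ∈ endsOf F ↔ ∃ e ∈ F, e.2 = p := by
  simp [endsOf]

theorem endsOf_subset {F G : List Edge} (h : F ⊆ G) : endsOf F ⊆ endsOf G := List.map_subset _ h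

theorem endsOf_append (F G : List Edge) : endsOf (F ++ G) = endsOf F ++ endsOf G := List.map_append

/-- All nodes of the requirements belong to `V`. -/
def ReqsWithin (V : List ℕ) (R : List Req) : Prop := ∀ r ∈ R, Within V (r.2 :: r.1)

/-- All requirements are met by `F`. -/
def Meets (R : List Req) (F : List Edge) : Prop :=
  ∀ r ∈ R, Conn (r.1 ++ endsOf F) r.2.1 r.2.2

/-- The set `X` shows that some requirement is not met by `F`. -/
def Violated (R : List Req) (F : List Edge) (X : Finset ℕ) : Prop :=
  ∃ r ∈ R, Crosses X r.2 ∧ ∀ p ∈ r.1 ++ endsOf F, ¬Crosses X p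

theorem Meets.mono {R : List Req} {F G : List Edge} (h : Meets R F) (hFG : F ⊆ G) : Meets R G :=
  fun r hr => (h r hr).mono (by
    have := endsOf_subset hFG
    intro p hp
    simp only [List.mem_append] at hp ⊢
    exact hp.imp_right (@this p))

section

variable {V : List ℕ} {R : List Req} {F : List Edge}

theorem contains_reqTable {r : Req} (hr : Within V (r.2 :: r.1)) (hF : Within V (endsOf F))
    {u v : ℕ} : (reqTable V F r).contains (u, v) = true ↔
      u ∈ V ∧ v ∈ V ∧ Conn (r.1 ++ endsOf F) u v := by
  rw [List.contains_iff_mem, reqTable, mem_closure_sym]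
  exact (hr.mono (by simp)).append hF

theorem contains_reqTable_self {r : Req} (hr : Within V (r.2 :: r.1)) (hF : Within V (endsOf F)) :
    (reqTable V F r).contains r.2 = true ↔ Conn (r.1 ++ endsOf F) r.2.1 r.2.2 := by
  have := hr r.2 (by simp)
  rw [show r.2 = (r.2.1, r.2.2) from rfl, contains_reqTable hr hF]
  tauto

theorem covers_iff (hR : ReqsWithin V R) (hF : Within V (endsOf F)) :
    covers V R F = true ↔ Meets R F := by
  rw [covers, List.all_eq_true]
  exact forall₂_congr fun r hr => contains_reqTable_self (hR r hr) hF

/-- The component of `x`. -/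
def component (V : List ℕ) (F : List Edge) (r : Req) (x : ℕ) : List ℕ :=
  V.filter fun v => (reqTable V F r).contains (x, v)

theorem mem_component {r : Req} (hr : Within V (r.2 :: r.1)) (hF : Within V (endsOf F))
    {x v : ℕ} (hx : x ∈ V) : v ∈ component V F r x ↔ v ∈ V ∧ Conn (r.1 ++ endsOf F) x v := by
  rw [component, List.mem_filter, contains_reqTable hr hF]
  tauto

theorem component_not_crosses {r : Req} (hr : Within V (r.2 :: r.1)) (hF : Within V (endsOf F))
    {x : ℕ} (hx : x ∈ V) : ∀ p ∈ r.1 ++ endsOf F, ¬Crosses (component V F r x).toFinset p := by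
  intro p hp
  have h1 := ((hr.mono (by simp)).append hF : Within V (r.1 ++ endsOf F)) p hp
  have h2 : Conn (r.1 ++ endsOf F) p.1 p.2 := .of_mem hp
  simp only [Crosses, List.mem_toFinset, mem_component hr hF hx, not_not]
  exact ⟨fun h => ⟨h1.2, h.2.trans h2⟩, fun h => ⟨h1.1, h.2.trans h2.symm⟩⟩

theorem component_subset {r : Req} (hr : Within V (r.2 :: r.1)) (hF : Within V (endsOf F))
    {x : ℕ} (hx : x ∈ V) {X : Finset ℕ} (hxX : x ∈ X)
    (hX : ∀ p ∈ r.1 ++ endsOf F, ¬Crosses X p) : (component V F r x).toFinset ⊆ X := by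
  intro v hv
  rw [List.mem_toFinset, mem_component hr hF hx] at hv
  by_contra h
  obtain ⟨p, hp, hp'⟩ := hv.2.exists_crosses (x := (x, v)) (X := X) (by simp [Crosses, hxX, h])
  exact hX p hp hp'

theorem mem_candidates (hR : ReqsWithin V R) (hF : Within V (endsOf F)) {C : List ℕ} :
    C ∈ candidates V R F ↔ ∃ r ∈ R, ¬Conn (r.1 ++ endsOf F) r.2.1 r.2.2 ∧
      (C = component V F r r.2.1 ∨ C = component V F r r.2.2) := by
  rw [candidates, List.mem_flatMap]
  refine exists_congr fun r => and_congr_right fun hr => ?_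
  rw [← contains_reqTable_self (hR r hr) hF]
  cases (reqTable V F r).contains r.2 <;> simp [component]

theorem violated_of_mem_candidates (hR : ReqsWithin V R) (hF : Within V (endsOf F)) {C : List ℕ}
    (hC : C ∈ candidates V R F) : Violated R F C.toFinset := by
  obtain ⟨r, hr, h1, h2⟩ := (mem_candidates hR hF).1 hC
  have h3 := hR r hr r.2 (by simp)
  refine ⟨r, hr, ?_, ?_⟩
  · rcases h2 with rfl | rfl
    · simp only [Crosses, List.mem_toFinset, mem_component (hR r hr) hF h3.1]
      exact fun h => h1 (h.1 ⟨h3.1, .refl _ _⟩).2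
    · simp only [Crosses, List.mem_toFinset, mem_component (hR r hr) hF h3.2]
      exact fun h => h1 (h.2 ⟨h3.2, .refl _ _⟩).2.symm
  · rcases h2 with rfl | rfl
    · exact component_not_crosses (hR r hr) hF h3.1
    · exact component_not_crosses (hR r hr) hF h3.2

/-- A violated set contains one end of an unmet requirement and cannot split the component of that
end. So the possibly exponentially many violated sets are represented by two candidates per unmet
requirement. -/
theorem exists_candidate_subset (hR : ReqsWithin V R) (hF : Within V (endsOf F)) {X : Finset ℕ}
    (hX : Violated R F X) : ∃ C ∈ candidates V R F, C.toFinset ⊆ X := by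
  obtain ⟨r, hr, h1, h2⟩ := hX
  have h3 := hR r hr r.2 (by simp)
  have h4 : ¬Conn (r.1 ++ endsOf F) r.2.1 r.2.2 := fun h => by
    obtain ⟨p, hp, hp'⟩ := h.exists_crosses h1
    exact h2 p hp hp'
  by_cases h5 : r.2.1 ∈ X
  · exact ⟨_, (mem_candidates hR hF).2 ⟨r, hr, h4, .inl rfl⟩,
      component_subset (hR r hr) hF h3.1 h5 h2⟩
  · exact ⟨_, (mem_candidates hR hF).2 ⟨r, hr, h4, .inr rfl⟩,
      component_subset (hR r hr) hF h3.2 (by unfold Crosses at h1; tauto) h2⟩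

/-! ### Minimal violated sets -/

theorem incl_iff {X Y : List ℕ} : incl X Y = true ↔ X.toFinset ⊆ Y.toFinset := by
  simp [incl, Finset.subset_iff]

/-- The minimal violated sets. -/
def activeSets (V : List ℕ) (R : List Req) (F : List Edge) : Finset (Finset ℕ) :=
  ((active V R F).map List.toFinset).toFinset

theorem mem_activeSets {Z : Finset ℕ} :
    Z ∈ activeSets V R F ↔ ∃ X ∈ active V R F, X.toFinset = Z := by
  simp [activeSets]

theorem mem_active {X : List ℕ} : X ∈ active V R F ↔ X ∈ candidates V R F ∧
    ∀ Y ∈ candidates V R F, Y.toFinset ⊆ X.toFinset → X.toFinset ⊆ Y.toFinset := by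
  rw [active, List.mem_filter, List.all_eq_true]
  refine and_congr_right fun _ => forall₂_congr fun Y _ => ?_
  rw [← incl_iff, ← incl_iff]
  cases incl Y X <;> simp

theorem violated_of_mem_activeSets (hR : ReqsWithin V R) (hF : Within V (endsOf F))
    {Z : Finset ℕ} (hZ : Z ∈ activeSets V R F) : Violated R F Z := by
  obtain ⟨X, hX, rfl⟩ := mem_activeSets.1 hZ
  exact violated_of_mem_candidates hR hF (mem_active.1 hX).1

theorem activeSets_minimal (hR : ReqsWithin V R) (hF : Within V (endsOf F))
    {Z : Finset ℕ} (hZ : Z ∈ activeSets V R F) {Y : Finset ℕ} (hY : Violated R F Y)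
    (hYZ : Y ⊆ Z) : Y = Z := by
  obtain ⟨X, hX, rfl⟩ := mem_activeSets.1 hZ
  obtain ⟨C, hC, hCY⟩ := exists_candidate_subset hR hF hY
  exact hYZ.antisymm (((mem_active.1 hX).2 C hC (hCY.trans hYZ)).trans hCY)

theorem exists_activeSet_subset (hR : ReqsWithin V R) (hF : Within V (endsOf F)) {X : Finset ℕ}
    (hX : Violated R F X) : ∃ Z ∈ activeSets V R F, Z ⊆ X := by
  obtain ⟨C, hC, hCX⟩ := exists_candidate_subset hR hF hX
  obtain ⟨_, ⟨⟨Y, hY, rfl⟩, hYX⟩, hmin⟩ := exists_minimal_finset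
    (p := fun Z : Finset ℕ => (∃ Y ∈ candidates V R F, Y.toFinset = Z) ∧ Z ⊆ X)
    ⟨_, ⟨C, hC, rfl⟩, hCX⟩
  refine ⟨_, mem_activeSets.2 ⟨Y, mem_active.2 ⟨hY, fun W hW hWY => ?_⟩, rfl⟩, hYX⟩
  exact (hmin _ ⟨⟨W, hW, rfl⟩, hWY.trans hYX⟩ hWY).ge

theorem Violated.nonempty {X : Finset ℕ} (h : Violated R F X) : X.Nonempty := by
  obtain ⟨r, _, h1, _⟩ := h
  by_contra h2
  rw [Finset.not_nonempty_iff_eq_empty] at h2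
  simp [Crosses, h2] at h1

/-- By uncrossing, `Z ∩ X` or `Z \ X` is violated; it lies in `Z`, so it equals `Z` by minimality.
-/
theorem subset_or_disjoint_of_mem_activeSets (hR : ReqsWithin V R) (hF : Within V (endsOf F))
    (hu : Uncrossable (Violated R F)) {X : Finset ℕ} (hX : Violated R F X) {Z : Finset ℕ}
    (hZ : Z ∈ activeSets V R F) : Z ⊆ X ∨ Disjoint Z X := by
  rcases hu Z X (violated_of_mem_activeSets hR hF hZ) hX with ⟨h, -⟩ | ⟨h, -⟩
  · exact .inl (Finset.inter_eq_left.1 (activeSets_minimal hR hF hZ h Finset.inter_subset_left))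
  · exact .inr (Finset.sdiff_eq_self_iff_disjoint.1
      (activeSets_minimal hR hF hZ h Finset.sdiff_subset))

theorem disjoint_of_mem_activeSets (hR : ReqsWithin V R) (hF : Within V (endsOf F))
    (hu : Uncrossable (Violated R F)) : ∀ Y ∈ activeSets V R F, ∀ Z ∈ activeSets V R F,
      Y ≠ Z → Disjoint Y Z := by
  intro Y hY Z hZ hne
  have h1 := violated_of_mem_activeSets hR hF hY
  exact (subset_or_disjoint_of_mem_activeSets hR hF hu
    (violated_of_mem_activeSets hR hF hZ) hY).resolve_left fun h =>
      hne (activeSets_minimal hR hF hZ h1 h)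

theorem leaves_iff {a b : ℕ} : leaves (active V R F) a b = true ↔
    ∃ Z ∈ activeSets V R F, a ∈ Z ∧ b ∉ Z := by
  simp [leaves, mem_activeSets]

/-! ### Degrees of the minimal violated sets -/

/-- The number of sets of `A` that `e` leaves at one of its ends. -/
def weight (A : List (List ℕ)) (e : Edge) : ℕ :=
  (leaves A e.2.1 e.2.2).toNat + (leaves A e.2.2 e.2.1).toNat

/-- The active sets are disjoint, so at most one contains `a`, and the Boolean test already counts
them. -/
theorem card_filter_leaves (hR : ReqsWithin V R) (hF : Within V (endsOf F))
    (hu : Uncrossable (Violated R F)) (a b : ℕ) :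
    ((activeSets V R F).filter fun Z => a ∈ Z ∧ b ∉ Z).card =
      (leaves (active V R F) a b).toNat := by
  have h1 : ((activeSets V R F).filter fun Z => a ∈ Z ∧ b ∉ Z).card ≤ 1 :=
    (Finset.card_le_card (Finset.monotone_filter_right _ fun _ _ h => h.1)).trans
      (card_filter_mem_le_one (disjoint_of_mem_activeSets hR hF hu) a)
  cases h : leaves (active V R F) a b with
  | true =>
    obtain ⟨Z, hZ, h2⟩ := leaves_iff.1 h
    have : 0 < ((activeSets V R F).filter fun Z => a ∈ Z ∧ b ∉ Z).card :=
      Finset.card_pos.2 ⟨Z, Finset.mem_filter.2 ⟨hZ, h2⟩⟩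
    simp; omega
  | false =>
    rw [Bool.toNat_false, Finset.card_eq_zero, Finset.filter_eq_empty_iff]
    intro Z hZ h2
    rw [leaves_iff.2 ⟨Z, hZ, h2⟩] at h
    exact absurd h (by simp)

theorem weight_eq (hR : ReqsWithin V R) (hF : Within V (endsOf F))
    (hu : Uncrossable (Violated R F)) (e : Edge) :
    weight (active V R F) e = ((activeSets V R F).filter fun Z => Crosses Z e.2).card := by
  rw [weight, ← card_filter_leaves hR hF hu, ← card_filter_leaves hR hF hu,
    ← Finset.card_union_of_disjoint]
  · congr 1
    ext Z
    simp only [Finset.mem_union, Finset.mem_filter]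
    unfold Crosses
    tauto
  · rw [Finset.disjoint_filter]
    tauto

theorem sum_weight_eq (hR : ReqsWithin V R) (hF : Within V (endsOf F))
    (hu : Uncrossable (Violated R F)) (J : Finset Edge) :
    ∑ e ∈ J, weight (active V R F) e =
      ∑ Z ∈ activeSets V R F, (cut (fun e : Edge => e.2) J Z).card := by
  simp only [weight_eq hR hF hu, cut, Finset.card_filter]
  exact Finset.sum_comm

theorem Violated.exists_edge {X : Finset ℕ} (h : Violated R F X) {J : List Edge} (hJ : Meets R J) :
    ∃ e ∈ J, e ∉ F ∧ Crosses X e.2 := by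
  obtain ⟨r, hr, h1, h2⟩ := h
  obtain ⟨p, hp, hp'⟩ := (hJ r hr).exists_crosses h1
  rcases List.mem_append.1 hp with h3 | h3
  · exact absurd hp' (h2 p (by simp [h3]))
  · obtain ⟨e, he, rfl⟩ := mem_endsOf.1 h3
    exact ⟨e, he, fun h => h2 e.2 (List.mem_append_right _ (mem_endsOf.2 ⟨e, h, rfl⟩)) hp', hp'⟩

/-- The lower bound on any solution: each active set must be crossed by one of its edges that has
not been bought yet. -/
theorem card_activeSets_le (hR : ReqsWithin V R) (hF : Within V (endsOf F))
    (hu : Uncrossable (Violated R F)) {J : List Edge} (hJ : Meets R J) :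
    (activeSets V R F).card ≤ ∑ e ∈ J.toFinset.filter (· ∉ F), weight (active V R F) e := by
  rw [sum_weight_eq hR hF hu, Finset.card_eq_sum_ones]
  refine Finset.sum_le_sum fun Z hZ => Finset.card_pos.2 ?_
  obtain ⟨e, h1, h2, h3⟩ := (violated_of_mem_activeSets hR hF hZ).exists_edge hJ
  exact ⟨e, by simp [cut, h1, h2, h3]⟩

/-- The upper bound for a minimal solution: `sum_card_cut_le` applied to the edges of `J` that are
not in `F`. -/
theorem sum_weight_le (hR : ReqsWithin V R) (hF : Within V (endsOf F))
    (hu : Uncrossable (Violated R F)) {J : List Edge} (hJ : Meets R J)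
    (hJV : Within V (endsOf J)) (hmin : ∀ e ∈ J, e ∉ F → ¬Meets R (F ++ without J e)) :
    ∑ e ∈ J.toFinset.filter (· ∉ F), weight (active V R F) e ≤ 2 * (activeSets V R F).card := by
  rw [sum_weight_eq hR hF hu]
  have hne : ∀ X, Violated R F X →
      (cut (fun e : Edge => e.2) (J.toFinset.filter (· ∉ F)) X).Nonempty := fun X hX => by
    obtain ⟨e, h1, h2, h3⟩ := hX.exists_edge hJ
    exact ⟨e, by simp [cut, h1, h2, h3]⟩
  refine sum_card_cut_le _ _ (Violated R F) _ hu hne ?_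
    (fun Z hZ => (violated_of_mem_activeSets hR hF hZ).nonempty)
    (disjoint_of_mem_activeSets hR hF hu)
    (fun X hX Z hZ => subset_or_disjoint_of_mem_activeSets hR hF hu hX hZ)
    fun X hX => exists_activeSet_subset hR hF hX
  intro e he
  rw [Finset.mem_filter, List.mem_toFinset] at he
  have hsub : without J e ⊆ J := List.filter_subset_self _
  have hFJ : Within V (endsOf (F ++ without J e)) := by
    rw [endsOf_append]
    exact hF.append (hJV.mono (endsOf_subset hsub))
  have h1 := hmin e he.1 he.2
  unfold Meets at h1
  push Not at h1
  obtain ⟨r, hr, h1⟩ := h1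
  have h3 := hR r hr r.2 (by simp)
  have h4 := component_not_crosses (hR r hr) hFJ h3.1
  -- The witness set of `e`: without `e` some requirement fails, and the component of one of its
  -- ends is crossed by no edge of `F` and by no edge of `J` except `e`.
  have h5 : Violated R F (component V (F ++ without J e) r r.2.1).toFinset := by
    refine ⟨r, hr, ?_, fun p hp => h4 p ?_⟩
    · simp only [Crosses, List.mem_toFinset, mem_component (hR r hr) hFJ h3.1]
      exact fun h => h1 (h.1 ⟨h3.1, .refl _ _⟩).2
    · rw [endsOf_append]
      simp only [List.mem_append] at hp ⊢
      tauto
  refine ⟨_, h5, ?_⟩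
  have h6 : ∀ f ∈ cut (fun e : Edge => e.2) (J.toFinset.filter (· ∉ F))
      (component V (F ++ without J e) r r.2.1).toFinset, f = e := by
    intro f hf
    simp only [cut, Finset.mem_filter, List.mem_toFinset] at hf
    by_contra hfe
    refine h4 f.2 (List.mem_append_right _ (mem_endsOf.2 ⟨f, ?_, rfl⟩)) hf.2
    simp [without, hf.1.1, hfe]
  obtain ⟨f, hf⟩ := hne _ h5
  exact Finset.eq_singleton_iff_unique_mem.2 ⟨h6 f hf ▸ hf, h6⟩

end

end SFO

namespace SFO

/-! ### Analysis of the primal-dual algorithm -/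

/-- The total cost of the edges that belong to `J`. -/
def wsum (l : List (Edge × ℕ)) (J : List Edge) : ℕ := (l.map fun q => if q.1 ∈ J then q.2 else 0).sum

/-- As `p` is tightest, the subtractions in `reduceCost` never truncate. -/
theorem reduceCost_add {A : List (List ℕ)} {res : List (Edge × ℕ)} {p q : Edge × ℕ}
    (hp : p ∈ tightest A res) (hq : q ∈ res) :
    reduceCost A (slack A p) q + slack A p * weight A q.1 = 2 * q.2 := by
  have h1 : q ∈ crossing A res → slack A p ≤ slack A q := fun h => by
    have := (List.mem_filter.1 hp).2
    rw [List.all_eq_true] at this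
    exact Nat.le_of_ble_eq_true (this q h)
  simp only [crossing, List.mem_filter, hq, true_and] at h1
  revert h1
  generalize slack A p = d
  unfold slack reduceCost weight
  cases leaves A q.1.2.1 q.1.2.2 <;> cases leaves A q.1.2.2 q.1.2.1 <;> simp <;> omega

theorem slack_mul_weight {A : List (List ℕ)} {res : List (Edge × ℕ)} {p : Edge × ℕ}
    (hp : p ∈ tightest A res) : slack A p * weight A p.1 = 2 * p.2 := by
  have h1 := (List.mem_filter.1 (List.mem_of_mem_filter hp)).2
  revert h1
  unfold slack weight
  cases leaves A p.1.2.1 p.1.2.2 <;> cases leaves A p.1.2.2 p.1.2.1 <;> simp <;> omega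

/-- Splitting of the cost function: twice the old cost is the new cost plus a multiple of the
weight. The bought edge is tight, so nothing of its cost is lost when it leaves the list. -/
theorem wsum_buy_add {A : List (List ℕ)} {s : List (Edge × ℕ) × List Edge} {p : Edge × ℕ}
    (hp : p ∈ tightest A s.1) (hs : (s.1.map Prod.fst).Nodup) (J : List Edge) :
    wsum (buy A s p).1 J +
      slack A p * (s.1.map fun q => if q.1 ∈ J then weight A q.1 else 0).sum = 2 * wsum s.1 J := by
  have hmem := mem_of_mem_tightest hp
  have key : ∀ l : List (Edge × ℕ), l ⊆ s.1 →
      wsum ((l.filter fun q => !(q.1 == p.1)).map fun q => (q.1, reduceCost A (slack A p) q)) J +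
      slack A p * (l.map fun q => if q.1 ∈ J then weight A q.1 else 0).sum = 2 * wsum l J := by
    intro l
    induction l with
    | nil => intro _; rfl
    | cons q l ih =>
      intro hl
      have hq : q ∈ s.1 := hl (by simp)
      have h1 := ih fun x hx => hl (by simp [hx])
      have h2 := reduceCost_add hp hq
      have h3 : q.1 = p.1 → q = p := fun h => List.inj_on_of_nodup_map hs hq hmem h
      have h4 := slack_mul_weight hp
      rw [List.filter_cons]
      simp only [wsum, List.map_cons, List.sum_cons, mul_add] at h1 ⊢
      by_cases h5 : q.1 = p.1
      · obtain rfl := h3 h5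
        simp only [BEq.rfl, Bool.not_true, Bool.false_eq_true, if_false]
        by_cases h6 : q.1 ∈ J
        · simp only [h6, if_true]; linarith
        · simp only [h6, if_false]; linarith
      · rw [if_pos (by simpa using h5)]
        simp only [List.map_cons, List.sum_cons]
        by_cases h6 : q.1 ∈ J
        · simp only [h6, if_true]; linarith
        · simp only [h6, if_false]; linarith
  exact key s.1 (List.Subset.refl _)

/-- The edges of `E` are split into those that were bought and those that were not. -/
structure Splits (E : List Edge) (s : List (Edge × ℕ) × List Edge) : Prop where
  nodup_fst : (s.1.map Prod.fst).Nodup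
  nodup_snd : s.2.Nodup
  mem_fst : ∀ e, e ∈ s.1.map Prod.fst ↔ e ∈ E ∧ e ∉ s.2
  snd_subset : s.2 ⊆ E

theorem Splits.grow {E : List Edge} {s : List (Edge × ℕ) × List Edge} (h : Splits E s)
    (V : List ℕ) (R : List Req) : Splits E (grow V R s) := by
  rcases grow_eq V R s with ⟨-, e⟩ | ⟨p, hp, e⟩ <;> rw [e]
  · exact h
  · have hp1 := (h.mem_fst p.1).1 (List.mem_map_of_mem (mem_of_mem_tightest hp))
    have e1 : (buy (active V R s.2) s p).1.map Prod.fst =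
        (s.1.map Prod.fst).filter fun f => !(f == p.1) := by
      rw [buy, List.map_map, List.filter_map]; rfl
    refine ⟨?_, ?_, fun f => ?_, ?_⟩
    · rw [e1]; exact h.nodup_fst.filter _
    · exact List.nodup_cons.2 ⟨hp1.2, h.nodup_snd⟩
    · rw [e1, List.mem_filter, h.mem_fst]
      simp [buy]
      tauto
    · exact List.cons_subset.2 ⟨hp1.1, h.snd_subset⟩

theorem snd_suffix_iterate_grow (V : List ℕ) (R : List Req) (k : ℕ) :
    ∀ s, s.2 <:+ ((grow V R)^[k] s).2 := by
  induction k with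
  | zero => intro s; exact List.suffix_refl _
  | succ k ih =>
    intro s
    refine List.IsSuffix.trans ?_ (ih (grow V R s))
    rcases grow_eq V R s with ⟨-, e⟩ | ⟨p, hp, e⟩ <;> rw [e]
    exact List.suffix_cons _ _

theorem sum_map_weight {E : List Edge} {s : List (Edge × ℕ) × List Edge} (h : Splits E s)
    {J : List Edge} (hJ : J ⊆ E) (w : Edge → ℕ) :
    (s.1.map fun q => if q.1 ∈ J then w q.1 else 0).sum =
      ∑ e ∈ J.toFinset.filter (· ∉ s.2), w e := by
  have h1 : (s.1.map fun q => if q.1 ∈ J then w q.1 else 0) =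
      (s.1.map Prod.fst).map fun e => if e ∈ J then w e else 0 := by
    rw [List.map_map]; rfl
  rw [h1, ← List.sum_toFinset _ h.nodup_fst, ← Finset.sum_filter]
  refine Finset.sum_congr ?_ fun _ _ => rfl
  ext e
  simp only [Finset.mem_filter, List.mem_toFinset, h.mem_fst]
  constructor
  · tauto
  · exact fun ⟨h1, h2⟩ => ⟨⟨hJ h1, h2⟩, h1⟩

section

variable {V : List ℕ} {R : List Req} {E : List Edge}

/-- Local-ratio argument, backwards from the last step, when `J` has no cost left. With `d` the
slack and `A` the active sets, one step charges `J` at most `2 * d * A.card` by `sum_weight_le` and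
charges `K` at least `d * A.card` by `card_activeSets_le`. So the ratio 2 for the reduced costs
carries over to the costs before the step. -/
theorem wsum_le_of_minimal (hR : ReqsWithin V R) (hE : Within V (endsOf E))
    (hu : ∀ F, Uncrossable (Violated R F)) {J K : List Edge} (hJ : Meets R J) (hJE : J ⊆ E)
    (hK : Meets R K) (hKE : K ⊆ E) (k : ℕ) : ∀ s, Splits E s → J ⊆ ((grow V R)^[k] s).2 →
      (∀ F, s.2 <:+ F → F <:+ ((grow V R)^[k] s).2 → ∀ e ∈ J, e ∉ F →
        ¬Meets R (F ++ without J e)) →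
      wsum s.1 J ≤ 2 * wsum s.1 K := by
  induction k with
  | zero =>
    intro s hs hJs _
    have h1 : ∀ q ∈ s.1, q.1 ∉ J := fun q hq h =>
      ((hs.mem_fst q.1).1 (List.mem_map_of_mem hq)).2 (hJs h)
    have h2 : wsum s.1 J = 0 := by
      rw [wsum, List.sum_eq_zero]
      intro x hx
      obtain ⟨q, hq, rfl⟩ := List.mem_map.1 hx
      simp [h1 q hq]
    omega
  | succ k ih =>
    intro s hs hJs hmin
    rw [Function.iterate_succ_apply] at hJs hmin
    have h0 := snd_suffix_iterate_grow V R k (grow V R s)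
    rcases grow_eq V R s with ⟨-, e⟩ | ⟨p, hp, e⟩
    · rw [e] at hJs hmin
      exact ih s hs hJs hmin
    · have hsuf : s.2 <:+ (grow V R s).2 := by rw [e]; exact List.suffix_cons _ _
      have h1 := ih (grow V R s) (hs.grow V R) hJs fun F hF => hmin F (hsuf.trans hF)
      have hF : Within V (endsOf s.2) := hE.mono (endsOf_subset hs.snd_subset)
      have h2 := sum_weight_le hR hF (hu s.2) hJ (hE.mono (endsOf_subset hJE))
        (hmin s.2 (List.suffix_refl _) (hsuf.trans h0))
      have h3 := card_activeSets_le hR hF (hu s.2) hK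
      have h4 := wsum_buy_add hp hs.nodup_fst J
      have h5 := wsum_buy_add hp hs.nodup_fst K
      rw [sum_map_weight hs hJE] at h4
      rw [sum_map_weight hs hKE] at h5
      rw [e] at h1
      have h6 := Nat.mul_le_mul_left (slack (active V R s.2) p)
        (h2.trans (Nat.mul_le_mul_left 2 h3))
      linarith

theorem exists_mem_tightest {A : List (List ℕ)} {res : List (Edge × ℕ)} {q : Edge × ℕ}
    (hq : q ∈ crossing A res) : tightest A res ≠ [] := by
  obtain ⟨p, hp, hmin⟩ := (crossing A res).toFinset.exists_min_image (slack A)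
    ⟨q, List.mem_toFinset.2 hq⟩
  refine List.ne_nil_of_mem (a := p) (List.mem_filter.2 ⟨List.mem_toFinset.1 hp, ?_⟩)
  rw [List.all_eq_true]
  exact fun x hx => Nat.ble_eq_true_of_le (hmin x (List.mem_toFinset.2 hx))

/-- While a requirement is unmet, `K` has an unbought edge that crosses an active set, so some edge
is bought. Hence as many steps as there are edges suffice. -/
theorem meets_iterate_grow (hR : ReqsWithin V R) (hE : Within V (endsOf E)) {K : List Edge}
    (hK : Meets R K) (hKE : K ⊆ E) (k : ℕ) : ∀ s, Splits E s → s.1.length ≤ k →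
      Meets R ((grow V R)^[k] s).2 := by
  have key : ∀ s, Splits E s → ¬Meets R s.2 → (grow V R s).1.length < s.1.length := by
    intro s hs hm
    have hF : Within V (endsOf s.2) := hE.mono (endsOf_subset hs.snd_subset)
    have h1 : ∃ X, Violated R s.2 X := by
      unfold Meets at hm
      push Not at hm
      obtain ⟨r, hr, h1⟩ := hm
      exact ⟨_, violated_of_mem_candidates hR hF ((mem_candidates hR hF).2 ⟨r, hr, h1, .inl rfl⟩)⟩
    obtain ⟨X, hX⟩ := h1
    obtain ⟨Z, hZ, -⟩ := exists_activeSet_subset hR hF hX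
    obtain ⟨e, he, heF, hc⟩ := (violated_of_mem_activeSets hR hF hZ).exists_edge hK
    obtain ⟨q, hq, rfl⟩ := List.mem_map.1 ((hs.mem_fst e).2 ⟨hKE he, heF⟩)
    have h2 : q ∈ crossing (active V R s.2) s.1 := by
      refine List.mem_filter.2 ⟨hq, ?_⟩
      rw [Bool.or_eq_true, leaves_iff, leaves_iff]
      unfold Crosses at hc
      by_cases h : q.1.2.1 ∈ Z
      · exact .inl ⟨Z, hZ, by tauto⟩
      · exact .inr ⟨Z, hZ, by tauto⟩
    rcases grow_eq V R s with ⟨h3, -⟩ | ⟨p, hp, e⟩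
    · exact absurd h3 (exists_mem_tightest h2)
    · rw [e]
      simp only [buy, List.length_map]
      exact List.length_filter_lt_length_iff_exists.2 ⟨p, mem_of_mem_tightest hp, by simp⟩
  induction k with
  | zero =>
    intro s hs hk
    by_contra h
    have := key s hs h
    omega
  | succ k ih =>
    intro s hs hk
    by_cases h : Meets R s.2
    · exact h.mono (snd_suffix_iterate_grow V R (k + 1) s).subset
    · have := key s hs h
      exact ih _ (hs.grow V R) (by omega)

end

/-! ### Analysis of the reverse deletion -/

theorem mem_without {J : List Edge} {e f : Edge} : f ∈ without J e ↔ f ∈ J ∧ f ≠ e := by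
  simp [without]

/-- Delete `e` if it is not needed. -/
def pruneStep (V : List ℕ) (R : List Req) (cur : List Edge) (e : Edge) : List Edge :=
  bif covers V R (without cur e) then without cur e else cur

theorem prune_eq (V : List ℕ) (R : List Req) (F : List Edge) :
    prune V R F = F.foldl (pruneStep V R) F := rfl

section

variable {V : List ℕ} {R : List Req}

theorem pruneStep_cases (V : List ℕ) (R : List Req) (cur : List Edge) (e : Edge) :
    (covers V R (without cur e) = true ∧ pruneStep V R cur e = without cur e) ∨
      (covers V R (without cur e) = false ∧ pruneStep V R cur e = cur) := by
  unfold pruneStep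
  cases h : covers V R (without cur e) <;> simp

theorem foldl_pruneStep_sublist (l : List Edge) : ∀ cur,
    (l.foldl (pruneStep V R) cur).Sublist cur := by
  induction l with
  | nil => exact fun _ => List.Sublist.refl _
  | cons e l ih =>
    intro cur
    refine (ih _).trans ?_
    rcases pruneStep_cases V R cur e with ⟨-, h⟩ | ⟨-, h⟩ <;> rw [h]
    exact List.filter_sublist

theorem mem_foldl_pruneStep {f : Edge} (l : List Edge) : ∀ cur, f ∈ cur → f ∉ l →
    f ∈ l.foldl (pruneStep V R) cur := by
  induction l with
  | nil => exact fun _ h _ => h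
  | cons e l ih =>
    intro cur h1 h2
    rw [List.mem_cons, not_or] at h2
    refine ih _ ?_ h2.2
    rcases pruneStep_cases V R cur e with ⟨-, h⟩ | ⟨-, h⟩ <;> rw [h]
    · exact mem_without.2 ⟨h1, h2.1⟩
    · exact h1

theorem covers_foldl_pruneStep (l : List Edge) : ∀ cur, covers V R cur = true →
    covers V R (l.foldl (pruneStep V R) cur) = true := by
  induction l with
  | nil => exact fun _ h => h
  | cons e l ih =>
    intro cur h1
    refine ih _ ?_
    rcases pruneStep_cases V R cur e with ⟨h2, h⟩ | ⟨-, h⟩ <;> rw [h] <;> assumption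

/-- The purchases are listed latest first, so `F'` is what had been bought at some earlier moment.
When `e` is examined, the entries behind it, hence all of `F'`, are still present, and so is the
final result. If `F'` and the result without `e` met the requirements, so would the current list
without `e`, and `e` would have been deleted. -/
theorem prune_minimal (hR : ReqsWithin V R) {F : List Edge} (hF : Within V (endsOf F))
    (hnd : F.Nodup) {F' : List Edge} (hF' : F' <:+ F) {e : Edge} (he : e ∈ prune V R F)
    (heF' : e ∉ F') : ¬Meets R (F' ++ without (prune V R F) e) := by
  rw [prune_eq] at *
  obtain ⟨pre, post, rfl⟩ := List.append_of_mem ((foldl_pruneStep_sublist F F).subset he)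
  have hsub : F' ⊆ post := by
    rcases List.suffix_or_suffix_of_suffix hF'
      (show e :: post <:+ pre ++ e :: post from List.suffix_append _ _) with h | h
    · rcases List.suffix_cons_iff.1 h with h | h
      · rw [h] at heF'; simp at heF'
      · exact h.subset
    · exact absurd (h.subset (by simp)) heF'
  set F := pre ++ e :: post
  set cur := pre.foldl (pruneStep V R) F with hcur
  have hfin : F.foldl (pruneStep V R) F = post.foldl (pruneStep V R) (pruneStep V R cur e) := by
    rw [hcur, ← List.foldl_cons, ← List.foldl_append]
  rw [hfin] at he ⊢
  have he' := (foldl_pruneStep_sublist post _).subset he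
  have hcurF : cur ⊆ F := (foldl_pruneStep_sublist pre F).subset
  rcases pruneStep_cases V R cur e with ⟨-, h⟩ | ⟨h1, h⟩
  · rw [h] at he'
    exact absurd rfl (mem_without.1 he').2
  · intro hm
    have h2 : Meets R (without cur e) := by
      refine hm.mono fun f hf => ?_
      rw [mem_without]
      rcases List.mem_append.1 hf with hf | hf
      · have hfe : f ≠ e := fun h => heF' (h ▸ hf)
        refine ⟨mem_foldl_pruneStep _ _ ?_ fun hpre => ?_, hfe⟩
        · exact List.mem_append_right _ (List.mem_cons_of_mem _ (hsub hf))
        · exact (List.nodup_append.1 hnd).2.2 f hpre f (List.mem_cons_of_mem _ (hsub hf)) rfl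
      · have h3 := mem_without.1 hf
        have h4 := (foldl_pruneStep_sublist post _).subset h3.1
        rw [h] at h4
        exact ⟨h4, h3.2⟩
    have h5 : Within V (endsOf (without cur e)) :=
      hF.mono (endsOf_subset (List.Subset.trans (List.filter_subset_self _) hcurF))
    rw [← covers_iff hR h5, h1] at h2
    exact absurd h2 (by simp)

variable {E : List (Edge × ℕ)}

theorem growAll_eq (V : List ℕ) (R : List Req) (E : List (Edge × ℕ)) :
    growAll V R E = (grow V R)^[E.length] (E, []) := by
  rw [growAll, List.foldl_const]

theorem splits_growAll (V : List ℕ) (R : List Req) (hnd : (E.map Prod.fst).Nodup) :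
    Splits (E.map Prod.fst) (E, []) ∧ Splits (E.map Prod.fst) (growAll V R E) := by
  have h0 : Splits (E.map Prod.fst) (E, []) := ⟨hnd, List.nodup_nil, by simp, by simp⟩
  refine ⟨h0, ?_⟩
  rw [growAll_eq]
  generalize E.length = k
  induction k with
  | zero => exact h0
  | succ k ih => rw [Function.iterate_succ_apply']; exact ih.grow V R

theorem cheapCover_subset (V : List ℕ) (R : List Req) (hnd : (E.map Prod.fst).Nodup) :
    cheapCover V R E ⊆ E.map Prod.fst :=
  List.Subset.trans (foldl_pruneStep_sublist _ _).subset (splits_growAll V R hnd).2.snd_subset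

theorem cheapCover_nodup (V : List ℕ) (R : List Req) (hnd : (E.map Prod.fst).Nodup) :
    (cheapCover V R E).Nodup :=
  (splits_growAll V R hnd).2.nodup_snd.sublist (foldl_pruneStep_sublist _ _)

theorem meets_cheapCover (hR : ReqsWithin V R) (hE : Within V (endsOf (E.map Prod.fst)))
    (hnd : (E.map Prod.fst).Nodup) {K : List Edge} (hK : Meets R K) (hKE : K ⊆ E.map Prod.fst) :
    Meets R (cheapCover V R E) := by
  have h1 := splits_growAll V R hnd
  have h2 : Meets R (growAll V R E).2 := by
    rw [growAll_eq]
    exact meets_iterate_grow hR hE hK hKE _ _ h1.1 le_rfl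
  have h3 := hE.mono (endsOf_subset h1.2.snd_subset)
  rw [← covers_iff hR (hE.mono (endsOf_subset (cheapCover_subset V R hnd)))]
  exact covers_foldl_pruneStep _ _ ((covers_iff hR h3).2 h2)

theorem wsum_cheapCover_le (hR : ReqsWithin V R) (hE : Within V (endsOf (E.map Prod.fst)))
    (hnd : (E.map Prod.fst).Nodup) (hu : ∀ F, Uncrossable (Violated R F)) {K : List Edge}
    (hK : Meets R K) (hKE : K ⊆ E.map Prod.fst) :
    wsum E (cheapCover V R E) ≤ 2 * wsum E K := by
  have h1 := splits_growAll V R hnd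
  refine wsum_le_of_minimal hR hE hu (meets_cheapCover hR hE hnd hK hKE)
    (cheapCover_subset V R hnd) hK hKE E.length (E, []) h1.1 ?_ ?_
  · rw [← growAll_eq]
    exact (foldl_pruneStep_sublist _ _).subset
  · rw [← growAll_eq]
    intro F _ hF e he heF
    exact prune_minimal hR (hE.mono (endsOf_subset h1.2.snd_subset)) h1.2.nodup_snd hF he heF

end

end SFO

namespace SFO

/-! ### The two families of violated sets are uncrossable -/

theorem violated_iff {R : List Req} {F : List Edge} {X : Finset ℕ} :
    Violated R F X ↔ Violated R [] X ∧ ∀ p ∈ endsOf F, ¬Crosses X p := by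
  constructor
  · rintro ⟨r, hr, h1, h2⟩
    exact ⟨⟨r, hr, h1, fun p hp => h2 p (by
      simp only [endsOf, List.map_nil, List.append_nil] at hp
      exact List.mem_append_left _ hp)⟩, fun p hp => h2 p (List.mem_append_right _ hp)⟩
  · rintro ⟨⟨r, hr, h1, h2⟩, h3⟩
    exact ⟨r, hr, h1, fun p hp => (List.mem_append.1 hp).elim
      (fun h => h2 p (List.mem_append_left _ h)) (h3 p)⟩

theorem not_crosses_combine {X Y : Finset ℕ} {p : ℕ × ℕ} (hX : ¬Crosses X p) (hY : ¬Crosses Y p) :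
    ¬Crosses (X ∩ Y) p ∧ ¬Crosses (X ∪ Y) p ∧ ¬Crosses (X \ Y) p ∧ ¬Crosses (Y \ X) p := by
  simp only [Crosses, Finset.mem_inter, Finset.mem_union, Finset.mem_sdiff] at *
  tauto

/-- Sets not crossed by `F` are closed under intersection, union and difference, so buying edges
preserves uncrossability. -/
theorem Uncrossable.violated {R : List Req} (h : Uncrossable (Violated R [])) (F : List Edge) :
    Uncrossable (Violated R F) := by
  intro X Y hX hY
  rw [violated_iff] at hX hY
  have h1 := fun p hp => not_crosses_combine (hX.2 p hp) (hY.2 p hp)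
  rcases h X Y hX.1 hY.1 with h | h
  · exact .inl ⟨violated_iff.2 ⟨h.1, fun p hp => (h1 p hp).1⟩,
      violated_iff.2 ⟨h.2, fun p hp => (h1 p hp).2.1⟩⟩
  · exact .inr ⟨violated_iff.2 ⟨h.1, fun p hp => (h1 p hp).2.2.1⟩,
      violated_iff.2 ⟨h.2, fun p hp => (h1 p hp).2.2.2⟩⟩

theorem violated_demands_iff {P : List (ℕ × ℕ)} {X : Finset ℕ} :
    Violated (demands P) [] X ↔ ∃ p ∈ P, Crosses X p := by
  simp [Violated, demands, endsOf]

theorem uncrossable_demands (P : List (ℕ × ℕ)) (F : List Edge) :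
    Uncrossable (Violated (demands P) F) := by
  refine Uncrossable.violated ?_ F
  intro X Y hX hY
  simp only [violated_demands_iff] at *
  obtain ⟨p, hp, h1⟩ := hX
  obtain ⟨q, hq, h2⟩ := hY
  -- Only the positions of the four ends relative to `X` and `Y` matter, which leaves a finite
  -- check.
  have h : ((Crosses (X ∩ Y) p ∨ Crosses (X ∩ Y) q) ∧ (Crosses (X ∪ Y) p ∨ Crosses (X ∪ Y) q)) ∨
      ((Crosses (X \ Y) p ∨ Crosses (X \ Y) q) ∧ (Crosses (Y \ X) p ∨ Crosses (Y \ X) q)) := by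
    by_cases a1 : p.1 ∈ X <;> by_cases a2 : p.2 ∈ X <;> by_cases a3 : p.1 ∈ Y <;>
      by_cases a4 : p.2 ∈ Y <;> by_cases b1 : q.1 ∈ X <;> by_cases b2 : q.2 ∈ X <;>
      by_cases b3 : q.1 ∈ Y <;> by_cases b4 : q.2 ∈ Y <;>
      simp_all [Crosses]
  rcases h with ⟨h3 | h3, h4 | h4⟩ | ⟨h3 | h3, h4 | h4⟩
  · exact .inl ⟨⟨p, hp, h3⟩, ⟨p, hp, h4⟩⟩
  · exact .inl ⟨⟨p, hp, h3⟩, ⟨q, hq, h4⟩⟩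
  · exact .inl ⟨⟨q, hq, h3⟩, ⟨p, hp, h4⟩⟩
  · exact .inl ⟨⟨q, hq, h3⟩, ⟨q, hq, h4⟩⟩
  · exact .inr ⟨⟨p, hp, h3⟩, ⟨p, hp, h4⟩⟩
  · exact .inr ⟨⟨p, hp, h3⟩, ⟨q, hq, h4⟩⟩
  · exact .inr ⟨⟨q, hq, h3⟩, ⟨p, hp, h4⟩⟩
  · exact .inr ⟨⟨q, hq, h3⟩, ⟨q, hq, h4⟩⟩

/-- The edge `e` of `H` is needed in both directions. -/
def Conflict (P : List (ℕ × ℕ)) (H : List Edge) (e : Edge) : Prop :=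
  (∃ p ∈ P, Conn (endsOf (without H e)) p.1 e.2.1 ∧ Conn (endsOf (without H e)) e.2.2 p.2) ∧
    ∃ p ∈ P, Conn (endsOf (without H e)) p.1 e.2.2 ∧ Conn (endsOf (without H e)) e.2.1 p.2

theorem without_subset (H : List Edge) (e : Edge) : without H e ⊆ H := List.filter_subset_self _

section

variable {V : List ℕ} {P : List (ℕ × ℕ)} {H : List Edge}

theorem contains_tableWithout (hH : Within V (endsOf H)) {e : Edge} {u v : ℕ} (hu : u ∈ V)
    (hv : v ∈ V) :
    (tableWithout V H e).contains (u, v) = true ↔ Conn (endsOf (without H e)) u v := by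
  rw [List.contains_iff_mem, tableWithout,
    mem_closure_sym (hH.mono (endsOf_subset (without_subset H e)))]
  tauto

theorem uses_iff (hP : Within V P) (hH : Within V (endsOf H)) {e : Edge} {a b : ℕ} (ha : a ∈ V)
    (hb : b ∈ V) : uses P (tableWithout V H e) a b = true ↔
      ∃ p ∈ P, Conn (endsOf (without H e)) p.1 a ∧ Conn (endsOf (without H e)) b p.2 := by
  rw [uses, List.any_eq_true]
  refine exists_congr fun p => and_congr_right fun hp => ?_
  rw [Bool.and_eq_true, contains_tableWithout hH (hP p hp).1 ha,
    contains_tableWithout hH hb (hP p hp).2]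

theorem mem_conflicts (hP : Within V P) (hH : Within V (endsOf H)) {r : Req} :
    r ∈ conflicts V P H ↔ ∃ e ∈ H, Conflict P H e ∧ r = (endsOf (without H e), e.2) := by
  rw [conflicts, List.mem_map]
  simp only [List.mem_filter, Bool.and_eq_true]
  refine exists_congr fun e => ?_
  constructor
  · rintro ⟨⟨he, h1⟩, h2⟩
    have he' := hH e.2 (mem_endsOf.2 ⟨e, he, rfl⟩)
    rw [uses_iff hP hH he'.1 he'.2, uses_iff hP hH he'.2 he'.1] at h1
    exact ⟨he, h1, h2.symm⟩
  · rintro ⟨he, h1, h2⟩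
    have he' := hH e.2 (mem_endsOf.2 ⟨e, he, rfl⟩)
    rw [uses_iff hP hH he'.1 he'.2, uses_iff hP hH he'.2 he'.1]
    exact ⟨⟨he, h1⟩, h2.symm⟩

theorem reqsWithin_demands (hP : Within V P) : ReqsWithin V (demands P) := by
  intro r hr
  obtain ⟨p, hp, rfl⟩ := List.mem_map.1 hr
  intro q hq
  rw [List.mem_singleton.1 hq]
  exact hP p hp

theorem reqsWithin_conflicts (hP : Within V P) (hH : Within V (endsOf H)) :
    ReqsWithin V (conflicts V P H) := by
  intro r hr
  obtain ⟨e, he, -, rfl⟩ := (mem_conflicts hP hH).1 hr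
  refine hH.mono (List.cons_subset.2 ⟨mem_endsOf.2 ⟨e, he, rfl⟩, endsOf_subset (without_subset H e)⟩)

theorem violated_conflicts_iff (hP : Within V P) (hH : Within V (endsOf H)) {X : Finset ℕ} :
    Violated (conflicts V P H) [] X ↔
      ∃ e ∈ H, Conflict P H e ∧ Crosses X e.2 ∧ ∀ f ∈ H, f ≠ e → ¬Crosses X f.2 := by
  constructor
  · rintro ⟨r, hr, h1, h2⟩
    obtain ⟨e, he, h3, rfl⟩ := (mem_conflicts hP hH).1 hr
    exact ⟨e, he, h3, h1, fun f hf hfe => h2 f.2 (List.mem_append_left _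
      (mem_endsOf.2 ⟨f, mem_without.2 ⟨hf, hfe⟩, rfl⟩))⟩
  · rintro ⟨e, he, h3, h1, h2⟩
    refine ⟨_, (mem_conflicts hP hH).2 ⟨e, he, h3, rfl⟩, h1, fun p hp => ?_⟩
    rcases List.mem_append.1 hp with h | h
    · obtain ⟨f, hf, rfl⟩ := mem_endsOf.1 h
      rw [mem_without] at hf
      exact h2 f hf.1 hf.2
    · simp [endsOf] at h

theorem uncrossable_conflicts (hP : Within V P) (hH : Within V (endsOf H)) (F : List Edge) :
    Uncrossable (Violated (conflicts V P H) F) := by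
  refine Uncrossable.violated ?_ F
  intro X Y hX hY
  simp only [violated_conflicts_iff hP hH] at *
  obtain ⟨e, he, hec, h1, h2⟩ := hX
  obtain ⟨f, hf, hfc, h3, h4⟩ := hY
  -- Among the edges of `H`, only `e` and `f` cross `X` or `Y`. Thus a set combined from `X` and `Y`
  -- is violated as soon as exactly one of these two edges crosses it.
  have key : ∀ W : Finset ℕ, (∀ p, ¬Crosses X p → ¬Crosses Y p → ¬Crosses W p) →
      (Crosses W e.2 ∧ (f = e ∨ ¬Crosses W f.2)) ∨ (Crosses W f.2 ∧ (f = e ∨ ¬Crosses W e.2)) →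
      ∃ e ∈ H, Conflict P H e ∧ Crosses W e.2 ∧ ∀ f ∈ H, f ≠ e → ¬Crosses W f.2 := by
    intro W hW h
    rcases h with ⟨h5, h6⟩ | ⟨h5, h6⟩
    · refine ⟨e, he, hec, h5, fun g hg hge => ?_⟩
      by_cases hgf : g = f
      · subst hgf; exact h6.resolve_left hge
      · exact hW _ (h2 g hg hge) (h4 g hg hgf)
    · refine ⟨f, hf, hfc, h5, fun g hg hgf => ?_⟩
      by_cases hge : g = e
      · subst hge; exact h6.resolve_left fun h => hgf h.symm
      · exact hW _ (h2 g hg hge) (h4 g hg hgf)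
  have k1 := key (X ∩ Y) fun p hp hq => (not_crosses_combine hp hq).1
  have k2 := key (X ∪ Y) fun p hp hq => (not_crosses_combine hp hq).2.1
  have k3 := key (X \ Y) fun p hp hq => (not_crosses_combine hp hq).2.2.1
  have k4 := key (Y \ X) fun p hp hq => (not_crosses_combine hp hq).2.2.2
  suffices h : ((Crosses (X ∩ Y) e.2 ∧ (f = e ∨ ¬Crosses (X ∩ Y) f.2) ∨
      Crosses (X ∩ Y) f.2 ∧ (f = e ∨ ¬Crosses (X ∩ Y) e.2)) ∧
      (Crosses (X ∪ Y) e.2 ∧ (f = e ∨ ¬Crosses (X ∪ Y) f.2) ∨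
      Crosses (X ∪ Y) f.2 ∧ (f = e ∨ ¬Crosses (X ∪ Y) e.2))) ∨
      ((Crosses (X \ Y) e.2 ∧ (f = e ∨ ¬Crosses (X \ Y) f.2) ∨
      Crosses (X \ Y) f.2 ∧ (f = e ∨ ¬Crosses (X \ Y) e.2)) ∧
      (Crosses (Y \ X) e.2 ∧ (f = e ∨ ¬Crosses (Y \ X) f.2) ∨
      Crosses (Y \ X) f.2 ∧ (f = e ∨ ¬Crosses (Y \ X) e.2))) from
    h.imp (And.imp k1 k2) (And.imp k3 k4)
  clear k1 k2 k3 k4 key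
  by_cases hfe : f = e
  · subst hfe
    clear h2 h4
    by_cases a1 : f.2.1 ∈ X <;> by_cases a2 : f.2.2 ∈ X <;> by_cases a3 : f.2.1 ∈ Y <;>
      by_cases a4 : f.2.2 ∈ Y <;> simp_all [Crosses]
  · have h5 := h2 f hf hfe
    have h6 := h4 e he fun h => hfe h.symm
    clear h2 h4
    simp only [hfe, false_or]
    by_cases a1 : e.2.1 ∈ X <;> by_cases a2 : e.2.2 ∈ X <;> by_cases a3 : e.2.1 ∈ Y <;>
      by_cases a4 : e.2.2 ∈ Y <;> by_cases b1 : f.2.1 ∈ X <;> by_cases b2 : f.2.2 ∈ X <;>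
      by_cases b3 : f.2.1 ∈ Y <;> by_cases b4 : f.2.2 ∈ Y <;>
      simp_all [Crosses]

/-! ### Every solution meets the requirements of both phases -/

variable {K : List Edge} {D : Edge → ℕ × ℕ}

theorem meets_demands_of_reach (hD : ∀ e ∈ K, D e = e.2 ∨ D e = e.2.swap)
    (hK : ∀ p ∈ P, Reach (K.map D) p.1 p.2) : Meets (demands P) K := by
  intro r hr
  obtain ⟨p, hp, rfl⟩ := List.mem_map.1 hr
  refine (hK p hp).mono fun x hx => ?_
  obtain ⟨e, he, rfl⟩ := List.mem_map.1 hx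
  have h1 : e.2 ∈ endsOf K := mem_endsOf.2 ⟨e, he, rfl⟩
  rcases hD e he with h | h <;> rw [h]
  · exact mem_sym.2 (.inl h1)
  · exact mem_sym.2 (.inr h1)

/-- Let `L` consist of `H - e` and `K \ H`. All edges of `K` other than `e` have their ends joined
in `L`. If the ends of `e` were not, the path of one pair would leave the `L`-component of `e.2.1`
and the path of another would enter it, both along the single arc `D e`. -/
theorem meets_conflicts_of_reach (hP : Within V P) (hH : Within V (endsOf H))
    (hD : ∀ e ∈ K, D e = e.2 ∨ D e = e.2.swap) (hK : ∀ p ∈ P, Reach (K.map D) p.1 p.2) :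
    Meets (conflicts V P H) (K.filter fun e => !H.contains e) := by
  intro r hr
  obtain ⟨e, he, ⟨⟨p, hp, h1, h2⟩, ⟨q, hq, h3, h4⟩⟩, rfl⟩ := (mem_conflicts hP hH).1 hr
  simp only
  set L := endsOf (without H e) ++ endsOf (K.filter fun e => !H.contains e) with hL
  have hw : ∀ {u v}, Conn (endsOf (without H e)) u v → Conn L u v := fun h =>
    h.mono (List.subset_append_left _ _)
  by_contra hno
  have key : ∀ g ∈ K, g ≠ e → Conn L (D g).1 (D g).2 := by
    intro g hg hge
    have h5 : g.2 ∈ L := by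
      by_cases hgH : g ∈ H
      · exact List.mem_append_left _ (mem_endsOf.2 ⟨g, mem_without.2 ⟨hgH, hge⟩, rfl⟩)
      · exact List.mem_append_right _ (mem_endsOf.2 ⟨g, by simp [hg, hgH], rfl⟩)
    have h6 : Conn L g.2.1 g.2.2 := .of_mem h5
    rcases hD g hg with h | h <;> rw [h]
    · exact h6
    · exact h6.symm
  obtain ⟨c, d, hcd, hc, hd⟩ := (hK p hp).exists_leaving (fun z => Conn L e.2.1 z) (hw h1).symm
    fun h => hno (h.trans (hw h2).symm)
  obtain ⟨g, hg, hgcd⟩ := List.mem_map.1 hcd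
  have hge : g = e := by
    by_contra hne
    have := key g hg hne
    rw [hgcd] at this
    exact hd (hc.trans this)
  obtain ⟨c', d', hcd', hc', hd'⟩ := (hK q hq).exists_leaving (fun z => ¬Conn L e.2.1 z)
    (fun h => hno (h.trans (hw h3))) fun h => h (hw h4)
  obtain ⟨g', hg', hgcd'⟩ := List.mem_map.1 hcd'
  have hge' : g' = e := by
    by_contra hne
    have := key g' hg' hne
    rw [hgcd'] at this
    exact hc' ((not_not.1 hd').trans this.symm)
  rw [hge] at hgcd
  rw [hge', hgcd] at hgcd'
  obtain ⟨rfl, rfl⟩ := Prod.mk.inj hgcd'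
  exact hc' hc

end

/-! ### Orientations -/

/-- The edge `e` with its ends exchanged. -/
def flip (e : Edge) : Edge := (e.1, e.2.2, e.2.1)

/-- If two nodes lie on a cycle through the edge between them, then they lie on a cycle without
bridges. -/
theorem conn_without_bridges {H : List Edge} {e : Edge} (he : e ∈ H)
    (hc : Conn (endsOf (without H e)) e.2.1 e.2.2) (B : List Edge) (heB : e ∉ B)
    (hB : ∀ f ∈ B, ¬Conn (endsOf (without H f)) f.2.1 f.2.2) :
    Conn (endsOf ((without H e).filter fun f => !B.contains f)) e.2.1 e.2.2 := by
  induction B with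
  | nil => exact hc.mono (endsOf_subset (by intro f hf; simpa using hf))
  | cons f B ih =>
    rw [List.mem_cons, not_or] at heB
    have h1 := ih heB.2 fun g hg => hB g (List.mem_cons_of_mem _ hg)
    set L := (without H e).filter fun g => !(f :: B).contains g with hL
    have h2 : Conn ((f.2.1, f.2.2) :: endsOf L) e.2.1 e.2.2 := by
      refine h1.mono fun p hp => ?_
      obtain ⟨g, hg, rfl⟩ := mem_endsOf.1 hp
      by_cases hgf : g = f
      · simp [hgf]
      · refine List.mem_cons_of_mem _ (mem_endsOf.2 ⟨g, ?_, rfl⟩)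
        simp only [hL, List.mem_filter, List.contains_cons, Bool.not_or, Bool.and_eq_true] at hg ⊢
        exact ⟨hg.1, by simpa using hgf, hg.2⟩
    have hLf : L ⊆ without H f := fun g hg => by
      simp only [hL, List.mem_filter, mem_without, List.contains_cons, Bool.not_or,
        Bool.and_eq_true] at hg
      exact mem_without.2 ⟨hg.1.1, by simpa using hg.2.1⟩
    have hLc : ∀ {u v}, Conn (endsOf L) u v → Conn (endsOf (without H f)) u v := fun h =>
      h.mono (endsOf_subset hLf)
    have hec : Conn (endsOf (without H f)) e.2.1 e.2.2 :=
      .of_mem (mem_endsOf.2 ⟨e, mem_without.2 ⟨he, heB.1⟩, rfl⟩)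
    have hfb := hB f (by simp)
    -- A path through `f`, closed up by `e`, would join the ends of `f` without `f`, which is a
    -- bridge.
    rcases conn_cons_iff.1 h2 with h | ⟨h, h'⟩ | ⟨h, h'⟩
    · exact h
    · exact absurd (((hLc h).symm.trans hec).trans (hLc h').symm) hfb
    · exact absurd (((hLc h').trans hec.symm).trans (hLc h)) hfb

theorem reach_of_not_reach_cons {N : List (ℕ × ℕ)} {a b u v : ℕ}
    (h : Reach ((b, a) :: (a, b) :: N) u v) (hn : ¬Reach ((a, b) :: N) u v) :
    Reach N u b ∧ Reach N a v := by
  simp only [reach_cons_iff] at h hn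
  push Not at hn
  rcases h with h | ⟨h1, h2⟩
  · exact absurd h (by tauto)
  · have h3 : Reach N u b := by
      rcases h1 with h1 | ⟨h1, -⟩
      · exact h1
      · exact absurd h2 (by
          rintro (h2 | ⟨-, h2⟩)
          · exact hn.1 (h1.trans h2)
          · exact hn.2 h1 h2)
    refine ⟨h3, ?_⟩
    rcases h2 with h2 | ⟨-, h2⟩
    · exact h2
    · exact absurd (h3.trans h2) hn.1

/-- One of the two directions of the edge `e` can be chosen, when some of the edges have been
directed already. -/
theorem exists_direction {R N : List (ℕ × ℕ)} {H : List Edge} {e : Edge} (he : e ∈ H)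
    (hR : ∀ f ∈ H, Conn (endsOf (without H f)) f.2.1 f.2.2 →
      (f.2.1, f.2.2) ∈ R ∧ (f.2.2, f.2.1) ∈ R)
    (hconf : ¬Conn (endsOf (without H e)) e.2.1 e.2.2 → ¬Conflict R H e)
    (hN : N ⊆ sym (endsOf (without H e)))
    (hN' : ∀ p ∈ endsOf (without H e), (p.1, p.2) ∈ N ∨ (p.2, p.1) ∈ N)
    (hM : ∀ r ∈ R, Reach ((e.2.1, e.2.2) :: (e.2.2, e.2.1) :: N) r.1 r.2) :
    (∀ r ∈ R, Reach ((e.2.1, e.2.2) :: N) r.1 r.2) ∨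
      ∀ r ∈ R, Reach ((e.2.2, e.2.1) :: N) r.1 r.2 := by
  by_contra hcon
  rw [not_or] at hcon
  obtain ⟨h1, h2⟩ := hcon
  push Not at h1 h2
  obtain ⟨r, hr, h1⟩ := h1
  obtain ⟨s, hs, h2⟩ := h2
  obtain ⟨i, a, b⟩ := e
  simp only at *
  -- The requirement that fails with `(a, b)` must use `(b, a)`, and conversely for `s`.
  have hr1 := reach_of_not_reach_cons ((hM r hr).mono (by intro p; simp; tauto)) h1
  have hs1 := reach_of_not_reach_cons (hM s hs) h2
  have hNc : ∀ {u v}, Reach N u v → Conn (endsOf (without H (i, a, b))) u v := fun h => h.mono hN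
  have hba : ¬Reach N b a := fun h =>
    h1 (((hr1.1.trans h).trans hr1.2).mono (List.subset_cons_self _ _))
  have hab : ¬Reach N a b := fun h =>
    h2 (((hs1.1.trans h).trans hs1.2).mono (List.subset_cons_self _ _))
  by_cases hc : Conn (endsOf (without H (i, a, b))) a b
  · classical
    have hnb := conn_without_bridges he hc
      (H.filter fun f => !decide (Conn (endsOf (without H f)) f.2.1 f.2.2)) (by simp [hc])
      (by intro f hf; simpa using (List.mem_filter.1 hf).2)
    -- An undirected path of non-bridges from `b` to `a` leaves the set of nodes reachable from `b`.
    -- The edge at which it does is already directed inwards, from `d` to `c`; being a non-bridge,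
    -- it also contributes the requirement `(c, d)`.
    obtain ⟨c, d, hcd, hc1, hd1⟩ := Reach.exists_leaving hnb.symm (fun z => Reach N b z)
      (.refl _ _) hba
    have h3 : ((c, d) ∈ R) ∧ ((c, d) ∈ N ∨ (d, c) ∈ N) := by
      have h4 : ∀ p ∈ endsOf ((without H (i, a, b)).filter fun f => !(H.filter fun f =>
          !decide (Conn (endsOf (without H f)) f.2.1 f.2.2)).contains f),
          ((p.1, p.2) ∈ R ∧ (p.2, p.1) ∈ R) ∧ ((p.1, p.2) ∈ N ∨ (p.2, p.1) ∈ N) := by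
        intro p hp
        obtain ⟨f, hf, rfl⟩ := mem_endsOf.1 hp
        obtain ⟨hf1, hf2⟩ := List.mem_filter.1 hf
        have hfH := (mem_without.1 hf1).1
        refine ⟨hR f hfH ?_, hN' f.2 (mem_endsOf.2 ⟨f, hf1, rfl⟩)⟩
        simpa [hfH] using hf2
      rcases mem_sym.1 hcd with h | h
      · have := h4 _ h; exact ⟨this.1.1, this.2⟩
      · have := h4 _ h; exact ⟨this.1.2, this.2.symm⟩
    have h5 : (d, c) ∈ N := h3.2.resolve_left fun h => hd1 (hc1.trans (.of_mem h))
    have h6 := hM _ h3.1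
    simp only [reach_cons_iff] at h6
    -- With `e` undirected, a path from `c` to `d` can only traverse it from `b` to `a`. Then `a`,
    -- `d`, `c`, `b` are reached in this order within `N`, contradicting `hab`.
    have h7 : Reach N c b ∧ Reach N a d := by
      rcases h6 with (h6 | h6) | ⟨h6 | h6, h8 | h8⟩
      · exact absurd (hc1.trans h6) hd1
      · exact h6
      · exact absurd h8 hd1
      · exact absurd (hc1.trans h6) hba
      · exact absurd h8 hd1
      · exact ⟨h6.1, h8.2⟩
    exact hab ((h7.2.trans (.of_mem h5)).trans h7.1)
  · exact hconf hc ⟨⟨s, hs, hNc hs1.1, hNc hs1.2⟩, ⟨r, hr, hNc hr1.1, hNc hr1.2⟩⟩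

theorem satisfied_iff {V : List ℕ} {R l : List (ℕ × ℕ)} (hR : Within V R) (hl : Within V l) :
    satisfied V R l = true ↔ ∀ r ∈ R, Reach l r.1 r.2 := by
  rw [satisfied, List.all_eq_true]
  refine forall₂_congr fun r hr => ?_
  rw [List.contains_iff_mem, show r = (r.1, r.2) from rfl, mem_closure hl]
  have := hR r hr
  tauto

/-- `o` is the edge `e` with one of its directions. -/
def Orients (o e : Edge) : Prop := o = e ∨ o = flip e

theorem mem_endsOf_append_sym {O L : List Edge} {u v : ℕ} :
    (u, v) ∈ endsOf O ++ sym (endsOf L) ↔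
      (u, v) ∈ endsOf O ∨ (u, v) ∈ endsOf L ∨ (v, u) ∈ endsOf L := by
  rw [List.mem_append, mem_sym]

theorem orient_spec {V : List ℕ} {R : List (ℕ × ℕ)} {H : List Edge} (hnd : H.Nodup)
    (hH : Within V (endsOf H)) (hRV : Within V R) (hconn : ∀ r ∈ R, Conn (endsOf H) r.1 r.2)
    (hR : ∀ f ∈ H, Conn (endsOf (without H f)) f.2.1 f.2.2 →
      (f.2.1, f.2.2) ∈ R ∧ (f.2.2, f.2.1) ∈ R)
    (hconf : ∀ f ∈ H, ¬Conn (endsOf (without H f)) f.2.1 f.2.2 → ¬Conflict R H f) :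
    (∀ o ∈ orient V R H, ∃ f ∈ H, Orients o f) ∧
      (orient V R H).map Prod.fst = (H.map Prod.fst).reverse ∧
      ∀ r ∈ R, Reach (endsOf (orient V R H)) r.1 r.2 := by
  -- Invariant: the edges in `pre` have received the directions in `O`, those in `rest` are
  -- undirected, and all requirements are met in this mixed graph.
  have key : ∀ rest pre O, H = pre ++ rest → (∀ o ∈ O, ∃ f ∈ pre, Orients o f) →
      (∀ f ∈ pre, ∃ o ∈ O, Orients o f) → O.map Prod.fst = (pre.map Prod.fst).reverse →
      (∀ r ∈ R, Reach (endsOf O ++ sym (endsOf rest)) r.1 r.2) →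
      (∀ o ∈ (rest.foldl (orientStep V R) (O, rest)).1, ∃ f ∈ H, Orients o f) ∧
      (rest.foldl (orientStep V R) (O, rest)).1.map Prod.fst = (H.map Prod.fst).reverse ∧
      ∀ r ∈ R, Reach (endsOf (rest.foldl (orientStep V R) (O, rest)).1) r.1 r.2 := by
    intro rest
    induction rest with
    | nil =>
      intro pre O hpre hO _ hmap hreach
      rw [List.append_nil] at hpre
      rw [hpre]
      refine ⟨hO, hmap, fun r hr => (hreach r hr).mono ?_⟩
      simp [sym, endsOf]
    | cons e rest ih =>
      intro pre O hpre hO hO' hmap hreach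
      have he : e ∈ H := by rw [hpre]; simp
      have hnd' := hpre ▸ hnd
      have hrest : ∀ f ∈ rest, f ∈ without H e := fun f hf => mem_without.2 ⟨by rw [hpre]; simp [hf],
        fun h => (List.nodup_cons.1 (List.nodup_append.1 hnd').2.1).1 (h ▸ hf)⟩
      have hpre' : ∀ f ∈ pre, f ∈ without H e := fun f hf => mem_without.2 ⟨by rw [hpre]; simp [hf],
        fun h => (List.nodup_append.1 hnd').2.2 f hf e (by simp) h⟩
      have hN : endsOf O ++ sym (endsOf rest) ⊆ sym (endsOf (without H e)) := by
        rintro ⟨u, v⟩ huv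
        rw [mem_sym]
        rcases mem_endsOf_append_sym.1 huv with h | h | h
        · obtain ⟨o, ho, ho2⟩ := mem_endsOf.1 h
          obtain ⟨f, hf, rfl | rfl⟩ := hO o ho
          · exact .inl (mem_endsOf.2 ⟨o, hpre' o hf, ho2⟩)
          · obtain ⟨rfl, rfl⟩ := Prod.mk.inj ho2
            exact .inr (mem_endsOf.2 ⟨f, hpre' f hf, rfl⟩)
        · exact .inl (endsOf_subset hrest h)
        · exact .inr (endsOf_subset hrest h)
      have hN' : ∀ p ∈ endsOf (without H e), (p.1, p.2) ∈ endsOf O ++ sym (endsOf rest) ∨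
          (p.2, p.1) ∈ endsOf O ++ sym (endsOf rest) := by
        intro p hp
        obtain ⟨f, hf, rfl⟩ := mem_endsOf.1 hp
        rw [mem_without, hpre, List.mem_append, List.mem_cons] at hf
        simp only [mem_endsOf_append_sym]
        rcases hf with ⟨hf | hf | hf, hfe⟩
        · obtain ⟨o, ho, rfl | rfl⟩ := hO' f hf
          · exact .inl (.inl (mem_endsOf.2 ⟨o, ho, rfl⟩))
          · exact .inr (.inl (mem_endsOf.2 ⟨_, ho, rfl⟩))
        · exact absurd hf hfe
        · exact .inl (.inr (.inl (mem_endsOf.2 ⟨f, hf, rfl⟩)))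
      have hM : ∀ r ∈ R, Reach ((e.2.1, e.2.2) :: (e.2.2, e.2.1) ::
          (endsOf O ++ sym (endsOf rest))) r.1 r.2 := by
        refine fun r hr => (hreach r hr).mono ?_
        rintro ⟨u, v⟩ huv
        simp only [List.mem_cons, mem_endsOf_append_sym, Prod.mk.injEq]
        rcases mem_endsOf_append_sym.1 huv with h | h | h
        · exact .inr (.inr (.inl h))
        · rcases List.mem_cons.1 h with h | h
          · exact .inl (Prod.mk.inj h)
          · exact .inr (.inr (.inr (.inl h)))
        · rcases List.mem_cons.1 h with h | h
          · exact .inr (.inl (Prod.mk.inj h).symm)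
          · exact .inr (.inr (.inr (.inr h)))
      have hdir := exists_direction he hR (hconf e he) hN hN' hM
      have hwit : Within V ((e.2.1, e.2.2) :: (endsOf O ++ sym (endsOf rest))) := by
        refine List.forall_mem_cons.2 ⟨hH e.2 (mem_endsOf.2 ⟨e, he, rfl⟩), ?_⟩
        exact Within.mono (hH.mono (endsOf_subset (without_subset H e))).sym hN
      obtain ⟨o, ho, hoe, hor⟩ : ∃ o, orientStep V R (O, e :: rest) e = (o :: O, rest) ∧
          Orients o e ∧ ∀ r ∈ R, Reach (endsOf (o :: O) ++ sym (endsOf rest)) r.1 r.2 := by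
        cases hs : satisfied V R ((e.2.1, e.2.2) :: (endsOf O ++ sym (endsOf rest))) with
        | true =>
          refine ⟨e, ?_, .inl rfl, (satisfied_iff hRV hwit).1 hs⟩
          simp only [orientStep, List.tail_cons, hs, cond_true]
        | false =>
          refine ⟨flip e, ?_, .inr rfl, hdir.resolve_left fun h => ?_⟩
          · simp only [orientStep, List.tail_cons, hs, cond_false, flip]
          · rw [(satisfied_iff hRV hwit).2 h] at hs
            exact absurd hs (by simp)
      rw [List.foldl_cons, ho]
      refine ih (pre ++ [e]) (o :: O) (by simp [hpre]) ?_ ?_ ?_ hor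
      · intro x hx
        rcases List.mem_cons.1 hx with rfl | hx
        · exact ⟨e, by simp, hoe⟩
        · obtain ⟨f, hf, h⟩ := hO x hx
          exact ⟨f, by simp [hf], h⟩
      · intro f hf
        rcases List.mem_append.1 hf with hf | hf
        · obtain ⟨x, hx, h⟩ := hO' f hf
          exact ⟨x, by simp [hx], h⟩
        · rw [List.mem_singleton.1 hf]
          exact ⟨o, by simp, hoe⟩
      · rw [List.map_cons, hmap, List.map_append, List.reverse_append]
        rcases hoe with rfl | rfl <;> simp [flip]
  exact key H [] [] rfl (by simp) (by simp) rfl fun r hr => by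
    simpa [endsOf, Conn] using hconn r hr

/-- The union of a solution of the first phase and one of the second phase can be oriented. -/
theorem orient_phases {V : List ℕ} {P : List (ℕ × ℕ)} {H F : List Edge} (hnd : (H ++ F).Nodup)
    (hP : Within V P) (hV : Within V (endsOf (H ++ F))) (hH : Meets (demands P) H)
    (hF : Meets (conflicts V P H) F) :
    (∀ o ∈ orient V (orientReqs V P (H ++ F)) (H ++ F), ∃ f ∈ H ++ F, Orients o f) ∧
      (orient V (orientReqs V P (H ++ F)) (H ++ F)).map Prod.fst =
        ((H ++ F).map Prod.fst).reverse ∧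
      ∀ p ∈ P, Reach (endsOf (orient V (orientReqs V P (H ++ F)) (H ++ F))) p.1 p.2 := by
  have hHV : Within V (endsOf H) := hV.mono (endsOf_subset (List.subset_append_left _ _))
  have hPconn : ∀ p ∈ P, Conn (endsOf H) p.1 p.2 := fun p hp =>
    (hH ([], p) (List.mem_map_of_mem hp)).mono (by simp)
  have hends : ∀ f ∈ H ++ F, f.2.1 ∈ V ∧ f.2.2 ∈ V := fun f hf => hV f.2 (mem_endsOf.2 ⟨f, hf, rfl⟩)
  have hbr : ∀ f ∈ H ++ F, ((tableWithout V (H ++ F) f).contains f.2 = true ↔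
      Conn (endsOf (without (H ++ F) f)) f.2.1 f.2.2) := fun f hf =>
    contains_tableWithout hV (hends f hf).1 (hends f hf).2
  have hmem : ∀ {u v}, (u, v) ∈ orientReqs V P (H ++ F) ↔ (u, v) ∈ P ∨
      ∃ f ∈ H ++ F, Conn (endsOf (without (H ++ F) f)) f.2.1 f.2.2 ∧
        ((u, v) = f.2 ∨ (v, u) = f.2) := by
    intro u v
    rw [orientReqs, List.mem_append, mem_sym, mem_endsOf, mem_endsOf]
    refine or_congr_right ⟨?_, ?_⟩
    · rintro (⟨f, hf, h⟩ | ⟨f, hf, h⟩) <;> rw [List.mem_filter] at hf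
      · exact ⟨f, hf.1, (hbr f hf.1).1 hf.2, .inl h.symm⟩
      · exact ⟨f, hf.1, (hbr f hf.1).1 hf.2, .inr h.symm⟩
    · rintro ⟨f, hf, h1, h | h⟩
      · exact .inl ⟨f, List.mem_filter.2 ⟨hf, (hbr f hf).2 h1⟩, h.symm⟩
      · exact .inr ⟨f, List.mem_filter.2 ⟨hf, (hbr f hf).2 h1⟩, h.symm⟩
  have hall : ∀ r ∈ orientReqs V P (H ++ F), r ∈ P ∨ ∃ f ∈ H ++ F,
      Conn (endsOf (without (H ++ F) f)) f.2.1 f.2.2 ∧ (r = f.2 ∨ r.swap = f.2) :=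
    fun r hr => hmem.1 hr
  have h := orient_spec (V := V) (R := orientReqs V P (H ++ F)) (H := H ++ F) hnd hV ?_ ?_ ?_ ?_
  · exact ⟨h.1, h.2.1, fun p hp => h.2.2 p (List.mem_append_left _ hp)⟩
  · refine hP.append (hV.mono (endsOf_subset (List.filter_subset_self _))).sym
  · intro r hr
    rcases hall r hr with h | ⟨f, hf, -, h⟩
    · exact (hPconn r h).mono (endsOf_subset (List.subset_append_left _ _))
    · have h1 : Conn (endsOf (H ++ F)) f.2.1 f.2.2 := .of_mem (mem_endsOf.2 ⟨f, hf, rfl⟩)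
      rcases h with h | h
      · rw [h]; exact h1
      · rw [← h] at h1; exact h1.symm
  · intro f hf hc
    exact ⟨hmem.2 (.inr ⟨f, hf, hc, .inl rfl⟩), hmem.2 (.inr ⟨f, hf, hc, .inr rfl⟩)⟩
  -- A conflict at a bridge `e` of the union is traced back to a conflict of `H`. Requirements that
  -- come from non-bridges are connected without `e`, so both requirements involved are pairs of
  -- `P`.
  · intro e he hbridge ⟨⟨r, hr, hr1, hr2⟩, ⟨s, hs, hs1, hs2⟩⟩
    set U := endsOf (without (H ++ F) e) with hU
    have hPmem : ∀ r ∈ orientReqs V P (H ++ F), ¬Conn U r.1 r.2 → r ∈ P := by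
      intro r hr hn
      rcases hall r hr with h | ⟨f, hf, hc, h⟩
      · exact h
      · exfalso
        have h1 : Conn U f.2.1 f.2.2 := by
          by_cases hfe : f = e
          · rw [hfe] at hc; exact absurd hc hbridge
          · exact .of_mem (mem_endsOf.2 ⟨f, mem_without.2 ⟨hf, hfe⟩, rfl⟩)
        rcases h with h | h
        · exact hn (by rw [h]; exact h1)
        · rw [← h] at h1; exact hn h1.symm
    have hrn : ¬Conn U r.1 r.2 := fun h => hbridge ((hr1.symm.trans h).trans hr2.symm)
    have hsn : ¬Conn U s.1 s.2 := fun h => hbridge ((hs2.trans h.symm).trans hs1)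
    have hrP := hPmem r hr hrn
    have hsP := hPmem s hs hsn
    have hsubU : endsOf (without H e) ⊆ U := endsOf_subset fun f hf => by
      rw [mem_without] at hf ⊢
      exact ⟨List.mem_append_left _ hf.1, hf.2⟩
    have hexp : ∀ p ∈ P, Conn (endsOf (without H e)) p.1 p.2 ∨
        (Conn (endsOf (without H e)) p.1 e.2.1 ∧ Conn (endsOf (without H e)) e.2.2 p.2) ∨
        (Conn (endsOf (without H e)) p.1 e.2.2 ∧ Conn (endsOf (without H e)) e.2.1 p.2) := by
      intro p hp
      refine conn_cons_iff.1 ((hPconn p hp).mono fun x hx => ?_)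
      obtain ⟨f, hf, rfl⟩ := mem_endsOf.1 hx
      by_cases hfe : f = e
      · simp [hfe]
      · exact List.mem_cons_of_mem _ (mem_endsOf.2 ⟨f, mem_without.2 ⟨hf, hfe⟩, rfl⟩)
    -- `H` alone connects all pairs, so a bridge that a pair needs belongs to `H`.
    have heH : e ∈ H := by
      by_contra h
      refine hrn ((hPconn r hrP).mono (endsOf_subset fun f hf => ?_))
      exact mem_without.2 ⟨List.mem_append_left _ hf, fun h' => h (h' ▸ hf)⟩
    have hc : Conflict P H e := by
      refine ⟨⟨r, hrP, ?_⟩, ⟨s, hsP, ?_⟩⟩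
      · rcases hexp r hrP with h | h | h
        · exact absurd (h.mono hsubU) hrn
        · exact h
        · exact absurd (hr1.symm.trans (h.1.mono hsubU)) hbridge
      · rcases hexp s hsP with h | h | h
        · exact absurd (h.mono hsubU) hsn
        · exact absurd ((h.1.mono hsubU).symm.trans hs1) hbridge
        · exact h
    -- The second phase joined the ends of this conflict edge by other edges, so `e` is no bridge
    -- after all.
    have h1 := hF _ ((mem_conflicts hP hHV).2 ⟨e, heH, hc, rfl⟩)
    refine hbridge (h1.mono fun x hx => ?_)
    rcases List.mem_append.1 hx with hx | hx
    · exact hsubU hx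
    · obtain ⟨f, hf, rfl⟩ := mem_endsOf.1 hx
      refine mem_endsOf.2 ⟨f, mem_without.2 ⟨List.mem_append_right _ hf, ?_⟩, rfl⟩
      rintro rfl
      exact (List.nodup_append.1 hnd).2.2 f heH f hf rfl

end SFO

namespace SFO

open TreeMachine TreeMachine.Enc

/-! ### From instances to lists of numbers -/

theorem wsum_append_le (E : List (Edge × ℕ)) (H F : List Edge) :
    wsum E (H ++ F) ≤ wsum E H + wsum (E.filter fun q => !H.contains q.1) F := by
  induction E with
  | nil => rfl
  | cons q E ih =>
    simp only [wsum, List.map_cons, List.sum_cons, List.filter_cons] at ih ⊢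
    by_cases h1 : q.1 ∈ H <;> by_cases h2 : q.1 ∈ F <;> simp [h1, h2] at ih ⊢ <;> omega

theorem wsum_filter_le (E : List (Edge × ℕ)) (H K : List Edge) :
    wsum (E.filter fun q => !H.contains q.1) (K.filter fun e => !H.contains e) ≤ wsum E K := by
  induction E with
  | nil => rfl
  | cons q E ih =>
    simp only [wsum, List.map_cons, List.sum_cons, List.filter_cons] at ih ⊢
    by_cases h1 : q.1 ∈ H <;> by_cases h2 : q.1 ∈ K <;> simp [h1, h2] at ih ⊢ <;> omega

section

variable {V : List ℕ} {P : List (ℕ × ℕ)} {E : List (Edge × ℕ)}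

theorem filter_keys (E : List (Edge × ℕ)) (H : List Edge) :
    (E.filter fun q => !H.contains q.1).map Prod.fst =
      (E.map Prod.fst).filter fun e => !H.contains e := by
  rw [List.filter_map]; rfl

theorem mem_augmentation (hnd : (E.map Prod.fst).Nodup) {H : List Edge} {e : Edge}
    (he : e ∈ augmentation V P E H) : e ∈ E.map Prod.fst ∧ e ∉ H := by
  have h1 := cheapCover_subset V (conflicts V P H) (E := E.filter fun q => !H.contains q.1)
    (by rw [filter_keys]; exact hnd.filter _) he
  rw [filter_keys, List.mem_filter] at h1
  simpa using h1

theorem nodup_phases (hnd : (E.map Prod.fst).Nodup) (R : List Req) :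
    (cheapCover V R E ++ augmentation V P E (cheapCover V R E)).Nodup := by
  refine List.nodup_append.2 ⟨cheapCover_nodup V R hnd,
    cheapCover_nodup V _ (by rw [filter_keys]; exact hnd.filter _), ?_⟩
  rintro e he _ hf rfl
  exact (mem_augmentation hnd hf).2 he

/-- If there is a solution, then the two phases meet their requirements, at a cost of at most four
times the cost of that solution. -/
theorem phases_spec (hP : Within V P) (hE : Within V (endsOf (E.map Prod.fst)))
    (hnd : (E.map Prod.fst).Nodup) {K : List Edge} (hKE : K ⊆ E.map Prod.fst)
    {D : Edge → ℕ × ℕ} (hD : ∀ e ∈ K, D e = e.2 ∨ D e = e.2.swap)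
    (hK : ∀ p ∈ P, Reach (K.map D) p.1 p.2) {H : List Edge}
    (hH : H = cheapCover V (demands P) E) :
    Meets (demands P) H ∧ Meets (conflicts V P H) (augmentation V P E H) ∧
      wsum E (H ++ augmentation V P E H) ≤ 4 * wsum E K := by
  have hR := reqsWithin_demands hP
  have h1 := meets_demands_of_reach hD hK
  have hHE : H ⊆ E.map Prod.fst := by rw [hH]; exact cheapCover_subset V _ hnd
  have hHV := hE.mono (endsOf_subset hHE)
  have hR' := reqsWithin_conflicts hP hHV
  have h2 := meets_conflicts_of_reach hP hHV hD hK
  have hnd' : ((E.filter fun q => !H.contains q.1).map Prod.fst).Nodup := by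
    rw [filter_keys]; exact hnd.filter _
  have hE' : Within V (endsOf ((E.filter fun q => !H.contains q.1).map Prod.fst)) := by
    rw [filter_keys]; exact hE.mono (endsOf_subset (List.filter_subset_self _))
  have hKE' : K.filter (fun e => !H.contains e) ⊆
      (E.filter fun q => !H.contains q.1).map Prod.fst := by
    rw [filter_keys]
    intro e he
    rw [List.mem_filter] at he ⊢
    exact ⟨hKE he.1, he.2⟩
  have h3 := wsum_cheapCover_le hR hE hnd (uncrossable_demands P) h1 hKE
  have h4 := wsum_cheapCover_le hR' hE' hnd' (uncrossable_conflicts hP hHV) h2 hKE'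
  have h5 := wsum_append_le E H (augmentation V P E H)
  have h6 := wsum_filter_le E H K
  refine ⟨?_, meets_cheapCover hR' hE' hnd' h2 hKE', ?_⟩
  · rw [hH]; exact meets_cheapCover hR hE hnd h1 hKE
  · rw [← hH] at h3
    rw [augmentation] at h5 ⊢
    omega

end

namespace Input

variable (I : Input)

/-- The two ends of an edge, as numbers. -/
def endVals (e : Fin I.m) : ℕ × ℕ := ((I.ends e).1, (I.ends e).2)

/-- The edge `e` with its number. -/
def edgeOf (e : Fin I.m) : Edge := (e, I.endVals e)

/-- The list of nodes. -/
def nodeList : List ℕ := (List.finRange I.n).map fun v : Fin I.n => (v : ℕ)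

/-- The list of edges with their costs. -/
def edgeList : List ((ℕ × ℕ) × ℕ × ℕ) :=
  (List.finRange I.m).map fun e => (I.endVals e, (I.cost e).num, (I.cost e).den)

/-- The list of pairs. -/
def pairList : List (ℕ × ℕ) := I.pairs.map fun p => ((p.1 : ℕ), (p.2 : ℕ))

/-- The edges with their costs multiplied by the product of all denominators. -/
def scaled : List (Edge × ℕ) := scale I.edgeList.zipIdx

theorem encode_eq : I.encode = enc (I.nodeList, I.edgeList, I.pairList) := by
  simp only [encode, enc, nodeList, edgeList, pairList, List.map_map, bind_pure_comp,
    List.map_eq_map]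
  rfl

theorem zipIdx_edgeList : I.edgeList.zipIdx =
    (List.finRange I.m).map fun e =>
      ((I.endVals e, (I.cost e).num, (I.cost e).den), (e : ℕ)) := by
  refine List.ext_getElem (by simp [edgeList]) fun i h1 h2 => ?_
  simp [edgeList]

/-- The product of all denominators. -/
def denProd : ℕ := ∏ e, (I.cost e).den

/-- The scaled cost of an edge. -/
def scaledCost (e : Fin I.m) : ℕ := ∏ f, if f = e then (I.cost f).num else (I.cost f).den

theorem foldl_mul_eq {β : Type} (f : β → ℕ) (l : List β) :
    ∀ c, l.foldl (fun c b => c * f b) c = c * (l.map f).prod := by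
  induction l with
  | nil => simp
  | cons b l ih => intro c; simp [ih, mul_assoc]

theorem scaled_eq : I.scaled = (List.finRange I.m).map fun e => (I.edgeOf e, I.scaledCost e) := by
  rw [scaled, scale, zipIdx_edgeList, List.map_map]
  refine List.map_congr_left fun e _ => ?_
  simp only [Function.comp_apply, edgeOf, Prod.mk.injEq, true_and]
  rw [foldl_mul_eq (fun z' : ((ℕ × ℕ) × ℕ × ℕ) × ℕ =>
    bif z'.2 == (e : ℕ) then z'.1.2.1 else z'.1.2.2), one_mul, List.map_map, scaledCost,
    Fin.prod_univ_def]
  congr 1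
  refine List.map_congr_left fun f _ => ?_
  by_cases h : f = e
  · simp [h]
  · have : ((f : ℕ) == (e : ℕ)) = false := beq_eq_false_iff_ne.2 fun h' => h (Fin.ext h')
    simp [h, this]

/-- All costs are multiplied by the same positive factor, so comparisons between solutions are
unaffected. -/
theorem cast_scaledCost (e : Fin I.m) : (I.scaledCost e : ℚ≥0) = I.denProd * I.cost e := by
  rw [scaledCost, denProd, ← Finset.mul_prod_erase _ _ (Finset.mem_univ e),
    ← Finset.mul_prod_erase _ _ (Finset.mem_univ e), if_pos rfl,
    Finset.prod_congr rfl fun f hf => if_neg (Finset.ne_of_mem_erase hf)]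
  push_cast
  have h : ((I.cost e).den : ℚ≥0) * I.cost e = (I.cost e).num := NNRat.den_mul_eq_num _
  rw [mul_right_comm, h]

theorem denProd_pos : 0 < I.denProd := Finset.prod_pos fun e _ => (I.cost e).den_pos

theorem edgeOf_injective : Function.Injective I.edgeOf := fun e f h => by
  simpa [edgeOf, Fin.ext_iff] using congrArg Prod.fst h

theorem keys_scaled : I.scaled.map Prod.fst = (List.finRange I.m).map I.edgeOf := by
  rw [scaled_eq, List.map_map]; rfl

theorem nodup_keys : (I.scaled.map Prod.fst).Nodup := by
  rw [keys_scaled]; exact (List.nodup_finRange _).map I.edgeOf_injective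

theorem mem_keys {x : Edge} : x ∈ I.scaled.map Prod.fst ↔ ∃ e, I.edgeOf e = x := by
  simp [keys_scaled]

theorem mem_nodeList (v : Fin I.n) : (v : ℕ) ∈ I.nodeList :=
  List.mem_map.2 ⟨v, List.mem_finRange v, rfl⟩

theorem within_pairList : Within I.nodeList I.pairList := by
  intro p hp
  obtain ⟨q, _, rfl⟩ := List.mem_map.1 hp
  exact ⟨I.mem_nodeList _, I.mem_nodeList _⟩

theorem within_keys : Within I.nodeList (endsOf (I.scaled.map Prod.fst)) := by
  intro p hp
  obtain ⟨x, hx, rfl⟩ := mem_endsOf.1 hp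
  obtain ⟨e, rfl⟩ := I.mem_keys.1 hx
  exact ⟨I.mem_nodeList _, I.mem_nodeList _⟩

theorem wsum_scaled (J : List Edge) : (wsum I.scaled J : ℚ≥0) =
    I.denProd * ∑ e ∈ Finset.univ.filter fun e => I.edgeOf e ∈ J, I.cost e := by
  rw [wsum, scaled_eq, List.map_map, ← Fin.sum_univ_def, Finset.sum_filter, Finset.mul_sum]
  push_cast
  refine Finset.sum_congr rfl fun e _ => ?_
  simp only [Function.comp_apply]
  split_ifs <;> simp [cast_scaledCost]

/-! ### Solutions as lists -/

variable {I}

/-- The edges of a solution. -/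
def solutionEdges (S : OrientedSubgraph I) : List Edge :=
  ((List.finRange I.m).filter fun e => decide (e ∈ S.H)).map I.edgeOf

open Classical in
/-- The directions of the edges of a solution. -/
noncomputable def solutionDir (S : OrientedSubgraph I) (x : Edge) : ℕ × ℕ :=
  if h : ∃ h : x.1 < I.m, (⟨x.1, h⟩ : Fin I.m) ∈ S.H then
    ((S.dir ⟨_, h.2⟩).1, (S.dir ⟨_, h.2⟩).2)
  else x.2

theorem edgeOf_mem_solutionEdges {S : OrientedSubgraph I} {e : Fin I.m} :
    I.edgeOf e ∈ solutionEdges S ↔ e ∈ S.H := by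
  simp [solutionEdges, I.edgeOf_injective.eq_iff]

theorem solutionDir_edgeOf (S : OrientedSubgraph I) {e : Fin I.m} (he : e ∈ S.H) :
    solutionDir S (I.edgeOf e) = (((S.dir ⟨e, he⟩).1 : ℕ), ((S.dir ⟨e, he⟩).2 : ℕ)) :=
  dif_pos ⟨e.2, he⟩

theorem exists_of_mem_solutionEdges {S : OrientedSubgraph I} {x : Edge}
    (hx : x ∈ solutionEdges S) : ∃ e ∈ S.H, I.edgeOf e = x := by
  obtain ⟨e, he, rfl⟩ := List.mem_map.1 hx
  exact ⟨e, by simpa using he, rfl⟩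

theorem solutionDir_cases (S : OrientedSubgraph I) : ∀ x ∈ solutionEdges S,
    solutionDir S x = x.2 ∨ solutionDir S x = x.2.swap := by
  intro x hx
  obtain ⟨e, he, rfl⟩ := exists_of_mem_solutionEdges hx
  rw [solutionDir_edgeOf S he]
  have h := S.dir_spec ⟨e, he⟩
  simp only [edge, Sym2.eq_iff] at h
  rcases h with ⟨h1, h2⟩ | ⟨h1, h2⟩
  · left; rw [h1, h2]; rfl
  · right; rw [h1, h2]; rfl

theorem reach_solution {S : OrientedSubgraph I} (hS : S.Satisfies) : ∀ p ∈ I.pairList,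
    Reach ((solutionEdges S).map (solutionDir S)) p.1 p.2 := by
  intro p hp
  obtain ⟨q, hq, rfl⟩ := List.mem_map.1 hp
  have h := hS q hq
  simp only
  generalize q.2 = v at h
  induction h with
  | refl => exact .refl _ _
  | tail _ h ih =>
    obtain ⟨⟨e, he⟩, h⟩ := h
    refine ih.trans (.of_mem (List.mem_map.2 ⟨I.edgeOf e, edgeOf_mem_solutionEdges.2 he, ?_⟩))
    rw [solutionDir_edgeOf S he, h]

theorem wsum_solutionEdges (S : OrientedSubgraph I) :
    (wsum I.scaled (solutionEdges S) : ℚ≥0) = I.denProd * S.cost := by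
  rw [wsum_scaled, OrientedSubgraph.cost]
  congr 2
  ext e
  simp [edgeOf_mem_solutionEdges]

/-! ### From lists of numbers back to oriented subgraphs -/

variable (I)

/-- The oriented subgraph that consists of the edges in `J`, which are directed as in `D`. -/
def toSubgraph (J D : List Edge) : OrientedSubgraph I where
  H := Finset.univ.filter fun e => I.edgeOf e ∈ J
  dir e := if ((e.1 : ℕ), I.endVals e.1) ∈ D then I.ends e.1 else (I.ends e.1).swap
  dir_spec e := by
    split_ifs
    · rfl
    · exact Sym2.eq_swap

variable {I}

theorem eq_edgeOf {J : List Edge} (hJ : J ⊆ I.scaled.map Prod.fst) {f : Edge} (hf : f ∈ J)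
    {e : Fin I.m} (h : f.1 = e) : f = I.edgeOf e := by
  obtain ⟨e', rfl⟩ := I.mem_keys.1 (hJ hf)
  rw [show e' = e from Fin.ext h]

section

variable {J D : List Edge}

theorem nodup_ids (hJ : J ⊆ I.scaled.map Prod.fst) (hJnd : J.Nodup)
    (hid : D.map Prod.fst = (J.map Prod.fst).reverse) : (D.map Prod.fst).Nodup := by
  rw [hid, List.nodup_reverse]
  refine hJnd.map_on fun f hf g hg h => ?_
  obtain ⟨e, rfl⟩ := I.mem_keys.1 (hJ hf)
  exact (eq_edgeOf hJ hg h.symm).symm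

/-- Each edge number occurs only once in `D`, so testing whether `D` contains the edge as presented
in the input determines its direction. -/
theorem dir_eq (hJ : J ⊆ I.scaled.map Prod.fst) (hJnd : J.Nodup)
    (hDJ : ∀ o ∈ D, ∃ f ∈ J, Orients o f) (hid : D.map Prod.fst = (J.map Prod.fst).reverse)
    {o : Edge} (ho : o ∈ D) {e : Fin I.m} (hoe : o.1 = e) :
    ∃ he : e ∈ (I.toSubgraph J D).H,
      o.2 = ((((I.toSubgraph J D).dir ⟨e, he⟩).1 : ℕ), (((I.toSubgraph J D).dir ⟨e, he⟩).2 : ℕ)) := by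
  obtain ⟨f, hf, hof⟩ := hDJ o ho
  have hfo : f.1 = o.1 := by rcases hof with h | h <;> rw [h]; rfl
  obtain rfl := eq_edgeOf hJ hf (hfo.trans hoe)
  refine ⟨by simpa [toSubgraph] using hf, ?_⟩
  by_cases h : ((e : ℕ), I.endVals e) ∈ D
  · have h1 : o = ((e : ℕ), I.endVals e) :=
      List.inj_on_of_nodup_map (nodup_ids hJ hJnd hid) ho h hoe
    simp only [toSubgraph, if_pos h, h1]
    rfl
  · simp only [toSubgraph, if_neg h]
    rcases hof with rfl | rfl
    · exact absurd ho h
    · rfl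

theorem satisfies_toSubgraph (hJ : J ⊆ I.scaled.map Prod.fst) (hJnd : J.Nodup)
    (hDJ : ∀ o ∈ D, ∃ f ∈ J, Orients o f) (hid : D.map Prod.fst = (J.map Prod.fst).reverse)
    (hreach : ∀ p ∈ I.pairList, Reach (endsOf D) p.1 p.2) : (I.toSubgraph J D).Satisfies := by
  intro p hp
  have h := hreach ((p.1 : ℕ), (p.2 : ℕ)) (List.mem_map.2 ⟨p, hp, rfl⟩)
  have key : ∀ v, Reach (endsOf D) (p.1 : ℕ) v → ∃ y : Fin I.n, (y : ℕ) = v ∧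
      Relation.ReflTransGen (I.toSubgraph J D).digraph.Adj p.1 y := by
    intro v hv
    induction hv with
    | refl => exact ⟨p.1, rfl, .refl⟩
    | @tail b c _ h ih =>
      obtain ⟨y, hy, hr⟩ := ih
      obtain ⟨o, ho, ho2⟩ := mem_endsOf.1 h
      obtain ⟨f, hf, hof⟩ := hDJ o ho
      obtain ⟨e, rfl⟩ := I.mem_keys.1 (hJ hf)
      have hoe : o.1 = e := by rcases hof with h | h <;> rw [h] <;> rfl
      obtain ⟨he, h1⟩ := dir_eq hJ hJnd hDJ hid ho hoe
      rw [ho2, Prod.mk.injEq] at h1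
      refine ⟨((I.toSubgraph J D).dir ⟨e, he⟩).2, h1.2.symm, hr.tail ⟨⟨e, he⟩, ?_⟩⟩
      have h2 : ((I.toSubgraph J D).dir ⟨e, he⟩).1 = y := Fin.ext (h1.1.symm.trans hy.symm)
      rw [← h2]
  obtain ⟨y, hy, hr⟩ := key _ h
  rwa [Fin.ext hy] at hr

theorem encodeAnswer_toSubgraph (hJ : J ⊆ I.scaled.map Prod.fst) (hJnd : J.Nodup)
    (hDJ : ∀ o ∈ D, ∃ f ∈ J, Orients o f) (hid : D.map Prod.fst = (J.map Prod.fst).reverse) :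
    encodeAnswer I (some (I.toSubgraph J D)) = writeAnswer I.edgeList.zipIdx D := by
  rw [writeAnswer, zipIdx_edgeList, List.map_map]
  refine congrArg (Val.cons .nil) (congrArg Val.ofList ?_)
  rw [show ∀ l : List Val, l.map enc = l from fun l => List.map_id l]
  refine List.map_congr_left fun e _ => ?_
  simp only [Function.comp_apply]
  cases hfil : D.filter fun o => o.1 == (e : ℕ) with
  | nil =>
    have h : e ∉ (I.toSubgraph J D).H := by
      intro he
      have h1 : I.edgeOf e ∈ J := by simpa [toSubgraph] using he
      have h2 : (e : ℕ) ∈ D.map Prod.fst := by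
        rw [hid, List.mem_reverse]; exact List.mem_map_of_mem h1
      obtain ⟨o, ho, hoe⟩ := List.mem_map.1 h2
      exact List.filter_eq_nil_iff.1 hfil o ho (by simp [hoe])
    rw [dif_neg h]
    rfl
  | cons o l =>
    have h1 : o ∈ D.filter fun o => o.1 == (e : ℕ) := by rw [hfil]; simp
    rw [List.mem_filter, beq_iff_eq] at h1
    obtain ⟨he, h2⟩ := dir_eq hJ hJnd hDJ hid h1.1 h1.2
    rw [dif_pos he, elimList, h2]
    rfl

theorem cost_toSubgraph (J D : List Edge) :
    (wsum I.scaled J : ℚ≥0) = I.denProd * (I.toSubgraph J D).cost := wsum_scaled I J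

end

/-- The answer that the algorithm writes down is the code of an approximately optimal solution. -/
theorem exists_answer (I : Input) : ∃ a : Option (OrientedSubgraph I),
    solve (I.nodeList, I.edgeList, I.pairList) = encodeAnswer I a ∧ IsApproxAnswer 4 I a := by
  have hP := I.within_pairList
  have hE := I.within_keys
  have hnd := I.nodup_keys
  have key := fun S (hS : OrientedSubgraph.Satisfies S) => phases_spec hP hE hnd
    (K := solutionEdges S) (fun x hx => by
      obtain ⟨e, -, rfl⟩ := exists_of_mem_solutionEdges hx
      exact I.mem_keys.2 ⟨e, rfl⟩) (solutionDir_cases S) (reach_solution hS) rfl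
  set H := cheapCover I.nodeList (demands I.pairList) I.scaled with hH
  set F := augmentation I.nodeList I.pairList I.scaled H with hF
  have hsolve : solve (I.nodeList, I.edgeList, I.pairList) =
      finish I.nodeList I.pairList I.edgeList.zipIdx H F := rfl
  have hHE : H ⊆ I.scaled.map Prod.fst := cheapCover_subset _ _ hnd
  have hJ : H ++ F ⊆ I.scaled.map Prod.fst :=
    List.append_subset.2 ⟨hHE, fun e he => (mem_augmentation hnd he).1⟩
  have hJnd : (H ++ F).Nodup := nodup_phases hnd _
  have hJV := hE.mono (endsOf_subset hJ)
  have hHV := hE.mono (endsOf_subset hHE)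
  have hFV := hJV.mono (endsOf_subset (List.subset_append_right H F))
  have c1 := covers_iff (reqsWithin_demands hP) hHV
  have c2 := covers_iff (reqsWithin_conflicts hP hHV) hFV
  -- This test decides feasibility: if it succeeds, the union can be oriented and is a solution; if
  -- a solution exists, `key` shows that the test succeeds.
  by_cases hok : Meets (demands I.pairList) H ∧ Meets (conflicts I.nodeList I.pairList H) F
  · obtain ⟨h1, h2, h3⟩ := orient_phases hJnd hP hJV hok.1 hok.2
    refine ⟨some (I.toSubgraph (H ++ F) (orient I.nodeList
      (orientReqs I.nodeList I.pairList (H ++ F)) (H ++ F))), ?_, ?_, fun S hS => ?_⟩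
    · rw [hsolve, finish, c1.2 hok.1, c2.2 hok.2, encodeAnswer_toSubgraph hJ hJnd h1 h2]
      rfl
    · exact satisfies_toSubgraph hJ hJnd h1 h2 h3
    · have h4 : (wsum I.scaled (H ++ F) : ℚ≥0) ≤ 4 * wsum I.scaled (solutionEdges S) := by
        exact_mod_cast (key S hS).2.2
      rw [wsum_solutionEdges, cost_toSubgraph, mul_left_comm] at h4
      exact le_of_mul_le_mul_left h4 (by exact_mod_cast I.denProd_pos)
  · refine ⟨none, ?_, ?_⟩
    · rw [hsolve, finish]
      have : (covers I.nodeList (demands I.pairList) H &&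
          covers I.nodeList (conflicts I.nodeList I.pairList H) F) = false := by
        rw [Bool.eq_false_iff, ne_eq, Bool.and_eq_true, c1, c2]
        exact hok
      rw [this]
      rfl
    · rintro ⟨S, hS⟩
      exact hok ⟨(key S hS).1, (key S hS).2.1⟩

end Input

end SFO

/-- Steiner Forest Orientation has a polynomial-time 4-approximation algorithm. -/
theorem theorem1 :
    ∃ A : (I : SFO.Input) → Option (SFO.OrientedSubgraph I),
      TreeMachine.PolyTime SFO.Input.encode SFO.encodeAnswer A ∧
        ∀ I : SFO.Input, SFO.IsApproxAnswer 4 I (A I) := by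
  -- Only the code of the answer is computed; `A` selects an answer with that code.
  choose A hA hA' using SFO.Input.exists_answer
  obtain ⟨p, q, h⟩ := SFO.pTime_solve
  refine ⟨A, ⟨p, q, fun I => ?_⟩, hA'⟩
  rw [SFO.Input.encode_eq, ← hA]
  exact h (I.nodeList, I.edgeList, I.pairList)
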